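/- **Setting.** Fix integers $n\ge 2$ and $1\le k\le n-1$; write $[a,b]$ for an interval of integers. For $1\le r\le n-1$ let $R_r=\{(i,j): 1\le i\le r,\ i\le j\le i+n-r-1\}$ and $\mathbb T_r=(\mathbb C^\times)^{R_r}\times\mathbb C^\times\ni(Y_{ij},t)$, with conventions $Y_{i,i-1}=1$, $Y_{i,i+n-r}=t$, and $y_{ij}=Y_{ij}/Y_{i,j-1}$. Let $\mathbb X_m={\rm Gr}(m,n)\times\mathbb C^\times\ni N|t$, and let $P_I(N)$ be the Plücker coordinates of $N$, where a finite set $I$ of integers is reduced modulo $n$ to a subset of $\{1,\dots,n\}$ taken in increasing order, and $P_I(N)=0$ if this subset does not have $m$ elements. Minors $\Delta_{I,J}$ of $n\times n$ matrices are labelled by sets in the same way. * $\Theta_{n-r}:\mathbb T_r\to\mathbb X_{n-r}$ sends $(Y_{ij},t)$ to $N|t$, where $N$ is spanned by the first $n-r$ columns of $M_r M_{r-1}\cdots M_1$; here $M_i$ is the identity matrix modified to have entries $y_{ij}$ in position $(j,j)$ for $i\le j\le i+n-r$, and $1$ in position $(j,j-1)$ for $i<j\le i+n-r$. * $g(N|t)$,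 for $N|t\in\mathbb X_m$, is the matrix over $\mathbb C[\lambda]$ with entries $c_{ij}\,P_{[j-m+1,j-1]\cup\{i\}}(N)/P_{[j-m,j-1]}(N)$, where $c_{ij}=1$ if $j\le m$, $c_{ij}=t$ if $j>m$ and $i\ge j$, and $c_{ij}=\lambda$ if $j>m$ and $i<j$. It is defined iff $P_{[j-m,j-1]}(N)\ne0$ for all $j\in[1,n]$. * $\pi^m_z(A)=N|z$, where $N$ is the span of the first $m$ columns of $A|_{\lambda=(-1)^{m-1}z}$, defined iff these columns are linearly independent. $S(N|t)=\pi^m_t({\rm fl}(g(N|t)))$ for $N|t\in\mathbb X_m$, where ${\rm fl}(A)_{ij}=A_{n-j+1,n-i+1}$. * The geometric $R$-matrix $R:\mathbb X_l\times\mathbb X_m\to\mathbb X_m\times\mathbb X_l$ is the partial map $R(M|s,N|t)=\bigl(\pi^m_t(g(M|s)g(N|t)),\ S(\pi^l_s(g(S(N|t))\,g(S(M|s))))\bigr)$, defined where all the steps are defined. The geometric coenergy function is $E(M|s,N|t)=\Delta_{[n-d+1,n],[1,d]}(g(M|s)g(N|t))$ with $d=\min(l,m)$. * $\Theta R=(\Theta^{-1}\times\Theta^{-1})\circ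 R\circ(\Theta\times\Theta)$ and $\Theta E=E\circ(\Theta\times\Theta)$. Let $X=(X_{11},\dots,X_{1,n-1},s)\in\mathbb T_1$ and $Y=(Y_{ij},t)\in\mathbb T_k$. Put $x_j=X_{1j}/X_{1,j-1}$ ($1\le j\le n$, with $X_{10}=1$, $X_{1n}=s$; subscripts of $x$ are read modulo $n$) and $N|t=\Theta_{n-k}(Y)$. Let $A_t$ be the matrix $g(\Theta_{n-1}(X))\,g(\Theta_{n-k}(Y))$ evaluated at $\lambda=(-1)^{n-k-1}t$, and define $$\tau_I=\Delta_{I,[1,n-k]}(A_t)\,\frac{P_{[k+1,n]}(N)}{P_I(N)},\qquad \kappa_j=\tau_{[j+k,\,j+n-1]}\quad(j\in\mathbb Z/n\mathbb Z).$$ **Proposition.** 1. Suppose that $R$ is defined at $(\Theta_{n-1}(X),\Theta_{n-k}(Y))$ and that the second component of its value is $\Theta_{n-1}(X')$ with $X'\in\mathbb T_1$ (so that $X'$ is the second output of $\Theta R$ at $(X,Y)$). Then the last coordinate of $X'$ is $s$, and with $x'_j=X'_{1j}/X'_{1,j-1}$ we have, for all $j\in[1,n]$, $\kappa_{j+1}\ne0$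 and $$x'_j=x_j\,\frac{\kappa_j}{\kappa_{j+1}} .$$ Such an $X'$ exists whenever all $X_{1j},Y_{ij},s,t$ are positive real numbers and $s\neq t$, hence for $(X,Y)$ in a Zariski dense set. 2. Whenever $g(\Theta_{n-k}(Y))$ is defined, for all $j\in[1,n]$, $$\kappa_j=\sum_{p=0}^{n-k}x_{j+k+p}x_{j+k+p+1}\cdots x_{j+n-1}\;t^{a_{j,p,k}}\;\frac{P_{[j+k-1,j+n-1]\setminus\{j+k+p-1\}}(N)}{P_{[j+k,j+n-1]}(N)},$$ where $a_{j,p,k}=1$ if $n+2-p\le j+k\le n+1$, and $a_{j,p,k}=0$ otherwise. 3. Whenever $g(\Theta_{n-k}(Y))$ is defined, $\Theta E(X,Y)$ is defined, is independent of $\lambda$, and $$\Theta E(X,Y)=\kappa_1=\sum_{p=0}^{n-k}x_{k+p+1}x_{k+p+2}\cdots x_n\,Y_{k,k+p-1},\qquad Y_{k,k-1}:=1 .$$ -/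

import Mathlib

open Polynomial

namespace GeometricR

noncomputable section

/-! ### Index sets, minors, the Grassmannian

Rows and columns are numbered `1, …, n` in the text and by `Fin n` in the code: `p : Fin n`
stands for the index `p + 1`.  Sets of indices are given as finite sets of integers, which are
read modulo `n`. -/

/-- The set of residues modulo `n`, in `[n]`, of the elements of a finite set of integers. -/
def residues (n : ℕ) (I : Finset ℤ) : Finset (Fin n) :=
  Finset.univ.filter fun p => ∃ a ∈ I, a ≡ (p : ℤ) + 1 [ZMOD n]

/-- The maximal minor of an `n × m` matrix in the rows `I`, taken in increasing order (and `0` if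
`I` does not have exactly `m` elements modulo `n`). -/
def maxMinor {n m : ℕ} (B : Matrix (Fin n) (Fin m) ℂ) (I : Finset ℤ) : ℂ :=
  if h : (residues n I).card = m then
    (B.submatrix ((residues n I).orderEmbOfFin h) id).det
  else 0

/-- The minor `Δ_{I,J}(A)` of an `n × n` matrix. -/
def minor {n : ℕ} {R : Type*} [CommRing R] (A : Matrix (Fin n) (Fin n) R) (I J : Finset ℤ) : R :=
  if h : (residues n I).card = (residues n J).card then
    (A.submatrix ((residues n I).orderEmbOfFin rfl) ((residues n J).orderEmbOfFin h.symm)).det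
  else 0

/-- The Grassmannian of `m`-dimensional subspaces of `ℂⁿ`. -/
abbrev Gr (n m : ℕ) : Type :=
  {N : Submodule ℂ (Fin n → ℂ) // Module.finrank ℂ N = m}

/-- An `n × m` matrix whose columns are a basis of the subspace `N`. -/
def Gr.repMatrix {n m : ℕ} (N : Gr n m) : Matrix (Fin n) (Fin m) ℂ :=
  Matrix.of fun i j => (Module.finBasisOfFinrankEq ℂ N.1 N.2 j : Fin n → ℂ) i

/-- The Plücker coordinates of `N`; they depend on the choice of a basis of `N` only through a
common nonzero factor (`plucker_eq_smul`), and they enter below only through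
their vanishing and through ratios. -/
def plucker {n m : ℕ} (N : Gr n m) (I : Finset ℤ) : ℂ := maxMinor N.repMatrix I

/-- The Plücker coordinates may be computed from any matrix whose columns span `N`. -/
theorem plucker_eq_smul {n m : ℕ} (N : Gr n m) (B : Matrix (Fin n) (Fin m) ℂ)
    (hB : Submodule.span ℂ (Set.range fun j => B.col j) = N.1) :
    ∃ c : ℂ, c ≠ 0 ∧ ∀ I, maxMinor B I = c * plucker N I := by
  set b := Module.finBasisOfFinrankEq ℂ N.1 N.2 with hb
  have hmem : ∀ j, B.col j ∈ N.1 := fun j => by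
    rw [← hB]; exact Submodule.subset_span ⟨j, rfl⟩
  let w : Fin m → N.1 := fun j => ⟨B.col j, hmem j⟩
  have hw : ⊤ ≤ Submodule.span ℂ (Set.range w) := by
    intro x _
    have hx : (x : Fin n → ℂ) ∈ Submodule.span ℂ (Set.range fun j => B.col j) := by
      rw [hB]; exact x.2
    have hr : (Set.range fun j => B.col j) = N.1.subtype '' Set.range w := by
      rw [← Set.range_comp]; rfl
    rw [hr, Submodule.span_image] at hx
    obtain ⟨y, hy, hyx⟩ := hx
    rwa [← Subtype.ext hyx]
  have hwl : LinearIndependent ℂ w := by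
    apply linearIndependent_of_top_le_span_of_card_eq_finrank hw
    simp [N.2]
  let b' : Module.Basis (Fin m) ℂ N.1 := Module.Basis.mk hwl hw
  have hmul : B = N.repMatrix * b.toMatrix w := by
    ext i j
    have h1 := congrArg (fun v : N.1 => (v : Fin n → ℂ) i) (b.sum_toMatrix_smul_self w j)
    simp only [Submodule.coe_sum, Finset.sum_apply, Submodule.coe_smul, Pi.smul_apply,
      smul_eq_mul] at h1
    have h2 : B i j = (w j : Fin n → ℂ) i := rfl
    rw [h2, ← h1, Matrix.mul_apply]
    refine Finset.sum_congr rfl fun l _ => ?_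
    rw [mul_comm]; rfl
  refine ⟨(b.toMatrix w).det, ?_, fun I => ?_⟩
  · have hu : IsUnit (b.toMatrix w).det := by
      have h := Module.Basis.isUnit_det b b'
      rw [Module.Basis.det_apply] at h
      simpa [b', Module.Basis.coe_mk] using h
    exact hu.ne_zero
  · unfold plucker maxMinor
    split_ifs with h
    · have hs : B.submatrix ((residues n I).orderEmbOfFin h) id =
          N.repMatrix.submatrix ((residues n I).orderEmbOfFin h) id * b.toMatrix w := by
        conv_lhs => rw [hmul]
        ext i j
        simp [Matrix.mul_apply]
      rw [hs, Matrix.det_mul, mul_comm]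
    · simp

/-- The variety `𝕏_m = Gr(m,n) × ℂˣ`; a point `(N, t)` is written `N|t` in the text. -/
abbrev XVar (n m : ℕ) : Type := Gr n m × ℂˣ

/-! ### The unipotent crystal map `g` and the geometric `R`-matrix

Rational maps are treated as partial functions with their explicit domains of definition.
Folded matrices have entries in `ℂ[λ]`, the indeterminate `X` being the loop parameter `λ`. -/

/-- `A|_{λ = z}`. -/
def evalAt {n : ℕ} (A : Matrix (Fin n) (Fin n) ℂ[X]) (z : ℂ) : Matrix (Fin n) (Fin n) ℂ :=
  A.map (Polynomial.eval z)

/-- `g` is defined at `N|t` iff the cyclic Plücker coordinates `P_{[j-m,j-1]}(N)` are nonzero. -/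
def GDefined {n m : ℕ} (u : XVar n m) : Prop :=
  ∀ j ∈ Finset.Icc (1 : ℤ) n, plucker u.1 (Finset.Icc (j - m) (j - 1)) ≠ 0

/-- The coefficient `c_{ij}`: `1` if `j ≤ m`, `t` if `j > m` and `i ≥ j`, and `λ` if `j > m` and
`i < j`. -/
def gCoeff {n : ℕ} (m : ℕ) (t : ℂˣ) (i j : Fin n) : ℂ[X] :=
  if (j : ℕ) + 1 ≤ m then 1 else if j ≤ i then C (t : ℂ) else X

/-- The folded matrix with entries
`A_{ij} = c_{ij} P_{[j-m+1,j-1] ∪ {i}}(N) / P_{[j-m,j-1]}(N)`. -/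
def gMatrix {n m : ℕ} (u : XVar n m) : Matrix (Fin n) (Fin n) ℂ[X] :=
  Matrix.of fun p q =>
    let i : ℤ := (p : ℤ) + 1
    let j : ℤ := (q : ℤ) + 1
    gCoeff m u.2 p q *
      C (plucker u.1 (Finset.Icc (j - m + 1) (j - 1) ∪ {i}) /
        plucker u.1 (Finset.Icc (j - m) (j - 1)))

/-- The rational map `g`. -/
def g {n m : ℕ} (u : XVar n m) : Part (Matrix (Fin n) (Fin n) ℂ[X]) :=
  ⟨GDefined u, fun _ => gMatrix u⟩

/-- The rational map `g(u, v) = g(u) g(v)`. -/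
def gProd {n l m : ℕ} (u : XVar n l) (v : XVar n m) : Part (Matrix (Fin n) (Fin n) ℂ[X]) :=
  (g u).bind fun A => (g v).map fun B => A * B

/-- The span of the first `m` columns of a matrix. -/
def firstColSpan {n : ℕ} (m : ℕ) (A : Matrix (Fin n) (Fin n) ℂ) : Submodule ℂ (Fin n → ℂ) :=
  Submodule.span ℂ (Set.range fun j : {j : Fin n // (j : ℕ) < m} => A.col j)

/-- The evaluation-projection `π^m_z`: it sends `A` to `N|z`, with `N` the span of the first `m`
columns of `A|_{λ = (-1)^{m-1} z}`, and is defined if these columns have full rank.  (For `m ≥ 1`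
the exponent `m + 1` gives the same sign as `m - 1`.) -/
def piMap {n : ℕ} (m : ℕ) (z : ℂˣ) (A : Matrix (Fin n) (Fin n) ℂ[X]) : Part (XVar n m) :=
  ⟨Module.finrank ℂ (firstColSpan m (evalAt A ((-1) ^ (m + 1) * (z : ℂ)))) = m,
    fun h => (⟨firstColSpan m (evalAt A ((-1) ^ (m + 1) * (z : ℂ))), h⟩, z)⟩

/-- The flip over the anti-diagonal. -/
def flipMatrix {n : ℕ} {R : Type*} (A : Matrix (Fin n) (Fin n) R) : Matrix (Fin n) (Fin n) R :=
  Matrix.of fun i j => A j.rev i.rev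

/-- The geometric Schützenberger involution `S(N|t) = π^m_t (fl (g(N|t)))`. -/
def schutz {n m : ℕ} (u : XVar n m) : Part (XVar n m) :=
  (g u).bind fun A => piMap m u.2 (flipMatrix A)

/-- The rational map `Ψ_{m,l}(u, v) = π^m_t (g(u) g(v))`, where `v = N|t ∈ 𝕏_m`. -/
def psi {n l m : ℕ} (u : XVar n l) (v : XVar n m) : Part (XVar n m) :=
  (gProd u v).bind fun A => piMap m v.2 A

/-- The geometric `R`-matrix `R = (Ψ_{m,l}, S ∘ Ψ_{l,m} ∘ S)`, where `S(u, v) = (S(v), S(u))`. -/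
def geomR {n l m : ℕ} (u : XVar n l) (v : XVar n m) : Part (XVar n m × XVar n l) :=
  (psi u v).bind fun v' =>
    (schutz v).bind fun Sv =>
      (schutz u).bind fun Su =>
        (psi Sv Su).bind fun w =>
          (schutz w).map fun u' => (v', u')

/-- The geometric coenergy function `E(u, v) = Δ_{[n-d+1,n],[d]}(g(u) g(v))`, `d = min(l, m)`,
as an element of `ℂ[λ]`. -/
def coenergy {n l m : ℕ} (u : XVar n l) (v : XVar n m) : Part ℂ[X] :=
  (gProd u v).map fun A =>
    minor A (Finset.Icc ((n : ℤ) - (min l m : ℕ) + 1) n) (Finset.Icc 1 ((min l m : ℕ) : ℤ))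

/-! ### Rational rectangles and the Gelfand–Tsetlin parametrization -/

/-- `(i, j) ∈ R_k`, i.e. `1 ≤ i ≤ k` and `i ≤ j ≤ i + n - k - 1`. -/
abbrev InR (n k i j : ℕ) : Prop := (1 ≤ i ∧ i ≤ k) ∧ (i ≤ j ∧ j + 1 + k ≤ i + n)

/-- A rational `k`-rectangle `(Y_{ij}, t) ∈ 𝕋_k = (ℂˣ)^{R_k} × ℂˣ`. -/
structure RatRect (n k : ℕ) where
  entry : {p : ℕ × ℕ // InR n k p.1 p.2} → ℂˣ
  t : ℂˣ

/-- `Y_{ij}`, extended by `Y_{i,i-1} = 1` and `Y_{i,i+n-k} = t`. -/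
def RatRect.coord {n k : ℕ} (Y : RatRect n k) (i j : ℕ) : ℂ :=
  if h : InR n k i j then (Y.entry ⟨(i, j), h⟩ : ℂ) else if j + k = i + n then (Y.t : ℂ) else 1

/-- `y_{ij} = Y_{ij} / Y_{i,j-1}` (for `1 ≤ i ≤ k`, `i ≤ j ≤ i + n - k`). -/
def RatRect.ratio {n k : ℕ} (Y : RatRect n k) (i j : ℕ) : ℂ := Y.coord i j / Y.coord i (j - 1)

theorem RatRect.coord_ne_zero {n k : ℕ} (Y : RatRect n k) (i j : ℕ) : Y.coord i j ≠ 0 := by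
  unfold RatRect.coord
  split_ifs <;> simp

theorem RatRect.ratio_ne_zero {n k : ℕ} (Y : RatRect n k) (i j : ℕ) : Y.ratio i j ≠ 0 :=
  div_ne_zero (Y.coord_ne_zero _ _) (Y.coord_ne_zero _ _)

/-- The matrix `M_{[i,i+n-k]}(y_{ii}, …, y_{i,i+n-k})`: it agrees with the identity matrix, except
that it has `y_{ij}` in position `(j,j)` for `j ∈ [i,i+n-k]` and `1` in position `(j,j-1)` for
`j ∈ [i+1,i+n-k]`. -/
def rowFactor {n k : ℕ} (Y : RatRect n k) (i : ℕ) : Matrix (Fin n) (Fin n) ℂ :=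
  Matrix.of fun p q =>
    if p = q then
      if i ≤ (p : ℕ) + 1 ∧ (p : ℕ) + 1 ≤ i + n - k then Y.ratio i ((p : ℕ) + 1) else 1
    else if (p : ℕ) = (q : ℕ) + 1 ∧ i + 1 ≤ (p : ℕ) + 1 ∧ (p : ℕ) + 1 ≤ i + n - k then 1
    else 0

/-- The product of the matrices `rowFactor Y i`, `1 ≤ i ≤ r`, in decreasing order of `i`. -/
def tableauProd {n k : ℕ} (Y : RatRect n k) : ℕ → Matrix (Fin n) (Fin n) ℂ
  | 0 => 1
  | r + 1 => rowFactor Y (r + 1) * tableauProd Y r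

/-- The tableau matrix `Φ_k(Y)`. -/
def tableauMatrix {n k : ℕ} (Y : RatRect n k) : Matrix (Fin n) (Fin n) ℂ := tableauProd Y k

theorem det_rowFactor_ne_zero {n k : ℕ} (Y : RatRect n k) (i : ℕ) : (rowFactor Y i).det ≠ 0 := by
  rw [Matrix.det_of_isLowerTriangular]
  · refine Finset.prod_ne_zero_iff.2 fun p _ => ?_
    simp only [rowFactor, Matrix.of_apply, if_true]
    split_ifs
    · exact Y.ratio_ne_zero _ _
    · exact one_ne_zero
  · intro p q hpq
    have h : p < q := hpq
    have h1 : (p : ℕ) < q := h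
    simp only [rowFactor, Matrix.of_apply]
    rw [if_neg h.ne, if_neg (by omega)]

theorem det_tableauProd_ne_zero {n k : ℕ} (Y : RatRect n k) (r : ℕ) :
    (tableauProd Y r).det ≠ 0 := by
  induction r with
  | zero => simp [tableauProd]
  | succ r ih =>
    rw [tableauProd, Matrix.det_mul]
    exact mul_ne_zero (det_rowFactor_ne_zero Y _) ih

theorem finrank_firstColSpan {n m : ℕ} (hm : m ≤ n) (A : Matrix (Fin n) (Fin n) ℂ)
    (hA : A.det ≠ 0) : Module.finrank ℂ (firstColSpan m A) = m := by
  have hli : LinearIndependent ℂ A.col :=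
    Matrix.linearIndependent_cols_iff_isUnit.2 ((Matrix.isUnit_iff_isUnit_det A).2 hA.isUnit)
  have h2 : LinearIndependent ℂ (fun j : {j : Fin n // (j : ℕ) < m} => A.col j) :=
    hli.comp _ Subtype.val_injective
  unfold firstColSpan
  rw [finrank_span_eq_card h2, Fintype.card_subtype, Fin.card_filter_val_lt]
  omega

/-- The Gelfand–Tsetlin parametrization `Θ_{n-k} : 𝕋_k → 𝕏_{n-k}`, `(Y_{ij}, t) ↦ N|t`, where `N`
is the span of the first `n - k` columns of the tableau matrix. -/
def Theta {n k : ℕ} (Y : RatRect n k) : XVar n (n - k) :=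
  (⟨firstColSpan (n - k) (tableauMatrix Y),
    finrank_firstColSpan (Nat.sub_le n k) _ (det_tableauProd_ne_zero Y k)⟩, Y.t)

/-! ### The case of a one-row rectangle `X` -/

/-- `x_j = X_{1j} / X_{1,j-1}`, with the subscript `j ∈ ℤ` read modulo `n` (in `[n]`). -/
def rowVar {n : ℕ} (X : RatRect n 1) (j : ℤ) : ℂ := X.ratio 1 (((j - 1) % n).toNat + 1)

/-- The matrix `A_t`, i.e. `A = g(Θ_{n-1}(X)) g(Θ_{n-k}(Y))` evaluated at `λ = (-1)^{n-k-1} t`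
(for `k < n`, the exponent `n - k + 1` gives the same sign). -/
def productAt {n k : ℕ} (X : RatRect n 1) (Y : RatRect n k) : Matrix (Fin n) (Fin n) ℂ :=
  evalAt (gMatrix (Theta X) * gMatrix (Theta Y)) ((-1) ^ (n - k + 1) * (Y.t : ℂ))

/-- `τ_I(X,Y) = Δ_{I,[n-k]}(A_t) P_{[k+1,n]}(N) / P_I(N)`, where `N|t = Θ_{n-k}(Y)`. -/
def tau {n k : ℕ} (X : RatRect n 1) (Y : RatRect n k) (I : Finset ℤ) : ℂ :=
  minor (productAt X Y) I (Finset.Icc 1 ((n : ℤ) - k)) *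
    (plucker (Theta Y).1 (Finset.Icc ((k : ℤ) + 1) n) / plucker (Theta Y).1 I)

/-- `κ_j(X,Y) = τ_{[j+k,j+n-1]}(X,Y)`; it depends only on `j` modulo `n`. -/
def kappa {n k : ℕ} (X : RatRect n 1) (Y : RatRect n k) (j : ℤ) : ℂ :=
  tau X Y (Finset.Icc (j + k) (j + n - 1))

/-- The second output of the rational map `ΘR`, i.e. the second component of
`Θ⁻¹ ∘ R ∘ (Θ × Θ)`, is defined at `(X, Y)` and equal to `X'`: the map `R` is defined at
`(Θ_{n-1}(X), Θ_{n-k}(Y))`, and the second component of its value there is `Θ_{n-1}(X')`. -/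
def IsSecondOutput {n k : ℕ} (X : RatRect n 1) (Y : RatRect n k) (X' : RatRect n 1) : Prop :=
  ∃ v' : XVar n (n - k), (v', Theta X') ∈ geomR (Theta X) (Theta Y)

/-- All coordinates of the rational rectangle are positive real numbers. -/
def RatRect.IsPositive {n k : ℕ} (Y : RatRect n k) : Prop :=
  (∀ p, ∃ r : ℝ, 0 < r ∧ (Y.entry p : ℂ) = r) ∧ ∃ r : ℝ, 0 < r ∧ (Y.t : ℂ) = r

end

end GeometricR

open GeometricR

namespace GeometricR

noncomputable section

/-! ### Determinants -/

/-! Put m = n - k. Up to the factors c_ij and a sign, column q of g(N|t) is the unique vector of N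
that vanishes on the cyclic interval [q-m+1, q-1] and equals 1 at q-m (`gMatrix_apply`), so
statements about Plücker coordinates become statements about vectors of N. For X the subspace is a
hyperplane, and g(Θ(X)) is a cyclic bidiagonal matrix W with diagonal x_j, ones below it, and λ in
the corner (`gMatrix_Theta_one`).

Formula for κ_j: extend the rows of the first m columns of g(Θ(Y)) quasi-periodically to rows V_i.
Then W replaces V_{i+1} by x V_{i+1} + V_i with no boundary case, and a minor in m consecutive rows
expands into the m+1 minors that omit one of m+1 consecutive rows (`det_add_smul_succ`,
`kappa_eq_sum_windowDet`). Wrapping around modulo n costs powers of t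
(`maxMinor_eq_of_quasiPeriodic`). For j = 1 the last row of the rectangle Y is a linear relation
among the same m+1 rows (`sum_coord_mul_eq_zero`); so are the signed minors, and the relation is
unique up to scale, which gives the coenergy formula.

Second output: since g(S(u)) = fl(g(u)) (`gMatrix_schutz`) and fl reverses products, the output is S
of the hyperplane spanned by columns of fl(A_s), where A_s is the product at λ = (-1)^n s. That
hyperplane is determined by the kernel of A_s. If η spans ker W and T is the reduced adjugate of
g(Θ(Y)), then A_s T η is a multiple of W η = 0. The rows of T are the signed minors above, so (T
η)_a is, up to a common sign, κ η_a with the appropriate κ (`exists_reduced_adjugate`). Ratios of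
consecutive kernel entries then give x'_j = x_j κ_j/κ_{j+1}.

Existence at positive points: tableau matrices are products of nonnegative bidiagonal matrices, so
all maximal minors are nonnegative (`MinorsNonneg.of_bidiagonal`) and each κ_j is positive. The
condition s ≠ t keeps g(Θ(Y)) invertible at λ = (-1)^n s. -/

/-- Cramer's relation among m+1 vectors: border the matrix with a copy of column c and expand along
the copy. -/
theorem sum_alternating_det_mul {m : ℕ} {R : Type*} [CommRing R] (V : Fin (m + 1) → Fin m → R)
    (c : Fin m) :
    ∑ p : Fin (m + 1), (-1) ^ (p : ℕ) * (Matrix.of fun i => V (p.succAbove i)).det * V p c = 0 := by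
  have h : (Matrix.of fun p => (Fin.cons (V p c) (V p) : Fin (m + 1) → R)).det = 0 :=
    Matrix.det_zero_of_column_eq (i := 0) (j := c.succ) (Fin.succ_ne_zero c).symm
      (fun p => by simp)
  rw [Matrix.det_succ_column_zero] at h
  rw [← h]
  refine Finset.sum_congr rfl fun p _ => ?_
  have : ((Matrix.of fun p => (Fin.cons (V p c) (V p) : Fin (m + 1) → R)).submatrix
      p.succAbove Fin.succ) = Matrix.of fun i => V (p.succAbove i) := by
    ext i j; simp
  rw [this]
  simp only [Matrix.of_apply, Fin.cons_zero]
  ring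

/-- Border V with the column b_p = ∏_{i ≥ p} (-y_i). Since b_p + y_p b_{p+1} = 0, the unipotent row
operation L produces the rows on the left and clears b except for its last entry 1. Expanding before
and after L gives the two sides. -/
theorem det_add_smul_succ {m : ℕ} {R : Type*} [CommRing R] (V : Fin (m + 1) → Fin m → R)
    (y : ℕ → R) :
    (Matrix.of fun i : Fin m => V i.castSucc + y i • V i.succ).det =
      ∑ p : Fin (m + 1), (∏ i ∈ Finset.Ico (p : ℕ) m, y i) *
        (Matrix.of fun i => V (p.succAbove i)).det := by
  set b : ℕ → R := fun p => ∏ i ∈ Finset.Ico p m, -y i with hb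
  have hbm : b m = 1 := by simp [hb]
  have hbs : ∀ p, p < m → b p = -y p * b (p + 1) := fun p hp => by
    simp only [hb]; rw [Finset.prod_eq_prod_Ico_succ_bot hp]
  set Z : Matrix (Fin (m + 1)) (Fin (m + 1)) R :=
    Matrix.of fun p => (Fin.cons (b p) (V p) : Fin (m + 1) → R) with hZ
  set L : Matrix (Fin (m + 1)) (Fin (m + 1)) R :=
    Matrix.of fun i j => (if i = j then 1 else 0) + (if (j : ℕ) = i + 1 then y i else 0) with hL
  have hLdet : L.det = 1 := by
    rw [Matrix.det_of_isUpperTriangular]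
    · exact Finset.prod_eq_one fun i _ => by simp [hL]
    · intro i j hij
      have hij' : j < i := hij
      have : (j : ℕ) < i := hij'
      simp only [hL, Matrix.of_apply]
      rw [if_neg hij'.ne', if_neg (by omega), add_zero]
  have hrow : ∀ (i : Fin m) j, (L * Z) i.castSucc j = Z i.castSucc j + y i * Z i.succ j := by
    intro i j
    rw [Matrix.mul_apply]
    simp only [hL, Matrix.of_apply, add_mul, Finset.sum_add_distrib, ite_mul, one_mul, zero_mul,
      Finset.sum_ite_eq, Finset.mem_univ, if_true]
    congr 1
    rw [Finset.sum_eq_single i.succ]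
    · simp
    · intro k _ hk
      rw [if_neg]
      intro h; apply hk; ext; simpa using h
    · simp
  have hlast : ∀ j, (L * Z) (Fin.last m) j = Z (Fin.last m) j := by
    intro j
    rw [Matrix.mul_apply]
    simp only [hL, Matrix.of_apply, add_mul, Finset.sum_add_distrib, ite_mul, one_mul, zero_mul,
      Finset.sum_ite_eq, Finset.mem_univ, if_true]
    rw [add_eq_left]
    refine Finset.sum_eq_zero fun k _ => if_neg ?_
    have := k.2
    simp only [Fin.val_last]; omega
  have h1 : (L * Z).det = (-1) ^ m * (Matrix.of fun i : Fin m => V i.castSucc + y i • V i.succ).det := by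
    rw [Matrix.det_succ_column_zero, Finset.sum_eq_single (Fin.last m)]
    · rw [hlast]
      have : ((L * Z).submatrix (Fin.last m).succAbove Fin.succ) =
          Matrix.of fun i : Fin m => V i.castSucc + y i • V i.succ := by
        ext i j
        rw [Matrix.submatrix_apply, Fin.succAbove_last, hrow]
        simp [hZ]
      rw [this]
      simp [hZ, hbm]
    · intro i _ hi
      obtain ⟨i, rfl⟩ := Fin.exists_castSucc_eq.2 hi
      rw [hrow]
      have : Z i.castSucc 0 + y i * Z i.succ 0 = 0 := by
        simp only [hZ, Matrix.of_apply, Fin.cons_zero, Fin.val_castSucc, Fin.val_succ]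
        rw [hbs i i.2]; ring
      rw [this]; ring
    · simp
  have h2 : Z.det = ∑ p : Fin (m + 1), (-1) ^ (p : ℕ) * b p *
        (Matrix.of fun i => V (p.succAbove i)).det := by
    rw [Matrix.det_succ_column_zero]
    refine Finset.sum_congr rfl fun p _ => ?_
    have : Z.submatrix p.succAbove Fin.succ = Matrix.of fun i => V (p.succAbove i) := by
      ext i j; simp [hZ]
    rw [this]
    simp [hZ]
  rw [Matrix.det_mul, hLdet, one_mul, h2] at h1
  have h3 := congrArg (fun z => (-1) ^ m * z) h1
  simp only [← mul_assoc, ← mul_pow, neg_mul_neg, one_mul, one_pow] at h3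
  rw [← h3, Finset.mul_sum]
  refine Finset.sum_congr rfl fun p _ => ?_
  have hp : (p : ℕ) ≤ m := Nat.lt_succ_iff.1 p.2
  have : b p = (-1) ^ (m - (p : ℕ)) * ∏ i ∈ Finset.Ico (p : ℕ) m, y i := by
    simp only [hb]
    rw [Finset.prod_neg, Nat.card_Ico]
  rw [this]
  have h4 : ((-1) ^ m * ((-1) ^ (p : ℕ) * (-1) ^ (m - (p : ℕ))) : R) = 1 := by
    rw [← pow_add, ← pow_add]
    have : m + (p + (m - p)) = 2 * m := by omega
    rw [this, pow_mul]; simp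
  linear_combination ((∏ i ∈ Finset.Ico (p : ℕ) m, y i) *
        (Matrix.of fun i => V (p.succAbove i)).det) * h4

/-! ### Index sets modulo `n` -/

theorem mem_residues {n : ℕ} {I : Finset ℤ} {p : Fin n} :
    p ∈ residues n I ↔ ∃ a ∈ I, a ≡ (p : ℤ) + 1 [ZMOD n] := by
  simp [residues]

theorem maxMinor_congr {n m : ℕ} (B : Matrix (Fin n) (Fin m) ℂ) {I J : Finset ℤ}
    (h : residues n I = residues n J) : maxMinor B I = maxMinor B J := by
  unfold maxMinor; simp only [h]

theorem maxMinor_eq_of_strictMono {n m : ℕ} (B : Matrix (Fin n) (Fin m) ℂ) (I : Finset ℤ)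
    (σ : Fin m → Fin n) (hσ : StrictMono σ) (hI : ∀ p, p ∈ residues n I ↔ ∃ i, σ i = p) :
    maxMinor B I = (B.submatrix σ id).det := by
  have hr : residues n I = Finset.univ.image σ := by ext p; simp [hI]
  have hc : (residues n I).card = m := by
    rw [hr, Finset.card_image_of_injective _ hσ.injective]; simp
  unfold maxMinor
  rw [dif_pos hc, ← Finset.orderEmbOfFin_unique hc (fun i => (hI _).2 ⟨i, rfl⟩) hσ]

/-- Moving the last row n steps back, to the front, multiplies it by (-1)^(m+1) t. The m-cycle of
rows has sign (-1)^(m-1), so exactly one factor t remains. Repeating this brings all indices below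
n. -/
theorem maxMinor_eq_of_quasiPeriodic {n m : ℕ} (F : Matrix (Fin n) (Fin m) ℂ) (t : ℂ)
    (V : ℕ → Fin m → ℂ) (hV0 : ∀ i : Fin n, V i = F i)
    (hV : ∀ i, V i = ((-1) ^ (m + 1) * t) • V (i + n)) (I : Finset ℤ) (σ : Fin m → ℕ)
    (hσ : StrictMono σ) (hs : ∀ i j, σ i < σ j + n)
    (hI : ∀ p : Fin n, p ∈ residues n I ↔ ∃ i, σ i % n = p) :
    maxMinor F I = (∏ i, t ^ (σ i / n)) * (Matrix.of fun i => V (σ i)).det := by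
  induction hN : ∑ i, σ i using Nat.strong_induction_on generalizing σ with
  | _ N ih =>
  by_cases hlt : ∀ i, σ i < n
  · rw [maxMinor_eq_of_strictMono F I (fun i => ⟨σ i, hlt i⟩) (fun i j h => hσ h)]
    · rw [Finset.prod_eq_one, one_mul]
      · congr 1
        ext i j
        exact (congrFun (hV0 ⟨σ i, hlt i⟩) j).symm
      · intro i _
        rw [Nat.div_eq_of_lt (hlt i), pow_zero]
    · intro p
      rw [hI]
      simp only [Nat.mod_eq_of_lt (hlt _), Fin.ext_iff]
  · push Not at hlt
    obtain ⟨i0, hi0⟩ := hlt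
    obtain ⟨M, rfl⟩ : ∃ M, m = M + 1 := ⟨m - 1, by have := i0.2; omega⟩
    have hlast : n ≤ σ (Fin.last M) := hi0.trans (hσ.monotone (Fin.le_last i0))
    have hn : 0 < n := by have := hs i0 i0; omega
    -- The last index is lowered by n; the spread condition `hs` makes it the smallest, so the tuple
    -- stays increasing and its sum drops.
    set τ : Fin (M + 1) → ℕ := Fin.cons (σ (Fin.last M) - n) (fun i => σ i.castSucc) with hτ
    have hmono : StrictMono τ := by
      intro i j hij
      induction j using Fin.cases with
      | zero => exact absurd hij (Fin.not_lt_zero i)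
      | succ j =>
        induction i using Fin.cases with
        | zero =>
          simp only [hτ, Fin.cons_zero, Fin.cons_succ]
          have := hs (Fin.last M) j.castSucc
          omega
        | succ i =>
          simp only [hτ, Fin.cons_succ]
          exact hσ (by simpa using hij)
    have hlt' : ∀ i : Fin M, σ i.castSucc < σ (Fin.last M) := fun i => hσ (Fin.castSucc_lt_last i)
    have hspread : ∀ i j, τ i < τ j + n := by
      intro i j
      induction i using Fin.cases with
      | zero =>
        induction j using Fin.cases with
        | zero => omega
        | succ j =>
          simp only [hτ, Fin.cons_zero, Fin.cons_succ]
          have := hs (Fin.last M) j.castSucc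
          omega
      | succ i =>
        induction j using Fin.cases with
        | zero =>
          simp only [hτ, Fin.cons_zero, Fin.cons_succ]
          have := hlt' i
          omega
        | succ j =>
          simp only [hτ, Fin.cons_succ]
          exact hs _ _
    have hImem : ∀ p : Fin n, p ∈ residues n I ↔ ∃ i, τ i % n = p := by
      intro p
      rw [hI, Fin.exists_fin_succ', Fin.exists_fin_succ (P := fun i => τ i % n = p)]
      simp only [hτ, Fin.cons_zero, Fin.cons_succ]
      rw [← Nat.mod_eq_sub_mod hlast, or_comm]
    have hsum : ∑ i, τ i < N := by
      rw [← hN, Fin.sum_univ_succ, Fin.sum_univ_castSucc]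
      simp only [hτ, Fin.cons_zero, Fin.cons_succ]
      omega
    rw [ih _ hsum τ hmono hspread hImem rfl, Fin.prod_univ_succ, Fin.prod_univ_castSucc (fun i => t ^ (σ i / n))]
    have hd : (Matrix.of fun i => V (τ i)).det = t * (Matrix.of fun i => V (σ i)).det := by
      have h1 : ((Matrix.of fun i => V (τ i)).submatrix (finRotate (M + 1)) id) =
          Matrix.of fun i j => (Fin.snoc (fun _ => 1) ((-1) ^ M * t) : Fin (M + 1) → ℂ) i *
            (Matrix.of fun i => V (σ i)) i j := by
        ext i j
        induction i using Fin.lastCases with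
        | last =>
          simp only [Matrix.submatrix_apply, finRotate_last, Matrix.of_apply, hτ, Fin.cons_zero,
            Fin.snoc_last, id]
          rw [hV, Nat.sub_add_cancel hlast]
          simp [pow_succ]
        | cast i =>
          have : finRotate (M + 1) i.castSucc = i.succ := by
            have := finRotate_of_lt (n := M) i.2
            exact this
          simp only [Matrix.submatrix_apply, this, Matrix.of_apply, hτ, Fin.cons_succ,
            Fin.snoc_castSucc, id, one_mul]
      have h2 := Matrix.det_permute (finRotate (M + 1)) (Matrix.of fun i => V (τ i))
      rw [h1, Matrix.det_mul_column, sign_finRotate, Fin.prod_univ_castSucc] at h2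
      simp only [Fin.snoc_castSucc, Fin.snoc_last, Finset.prod_const_one, one_mul,
        Nat.add_sub_cancel] at h2
      push_cast at h2
      have h3 : ((-1 : ℂ) ^ M) * (-1) ^ M = 1 := by rw [← mul_pow]; simp
      linear_combination (-(Matrix.of fun i => V (τ i)).det + t * (Matrix.of fun i => V (σ i)).det) * h3
        - (-1) ^ M * h2
    rw [hd]
    simp only [hτ, Fin.cons_zero, Fin.cons_succ]
    obtain ⟨e, he⟩ : ∃ e, σ (Fin.last M) = e + n := ⟨_, (Nat.sub_add_cancel hlast).symm⟩
    rw [he, Nat.add_sub_cancel, Nat.add_div_right _ hn, pow_succ]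
    ring

/-! ### Plücker coordinates and functions in the subspace -/

theorem repMatrix_mulVec_mem {n m : ℕ} (N : Gr n m) (c : Fin m → ℂ) :
    N.repMatrix.mulVec c ∈ N.1 := by
  have : N.repMatrix.mulVec c =
      ∑ j, c j • (Module.finBasisOfFinrankEq ℂ N.1 N.2 j : Fin n → ℂ) := by
    ext p
    simp [Matrix.mulVec, dotProduct, Gr.repMatrix, mul_comm]
  rw [this]
  exact Submodule.sum_mem _ fun j _ => Submodule.smul_mem _ _ (Subtype.prop _)

theorem exists_repMatrix_mulVec {n m : ℕ} (N : Gr n m) {f : Fin n → ℂ} (hf : f ∈ N.1) :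
    ∃ c, N.repMatrix.mulVec c = f := by
  refine ⟨fun j => (Module.finBasisOfFinrankEq ℂ N.1 N.2).repr ⟨f, hf⟩ j, ?_⟩
  have h := congrArg (Subtype.val) ((Module.finBasisOfFinrankEq ℂ N.1 N.2).sum_repr ⟨f, hf⟩)
  ext p
  have h2 := congrFun h p
  simp only [Submodule.coe_sum, Finset.sum_apply, Submodule.coe_smul, Pi.smul_apply,
    smul_eq_mul] at h2
  rw [← h2]
  simp [Matrix.mulVec, dotProduct, Gr.repMatrix, mul_comm]

theorem repMatrix_mulVec_injective {n m : ℕ} (N : Gr n m) {c : Fin m → ℂ}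
    (h : N.repMatrix.mulVec c = 0) : c = 0 := by
  have hli := (Module.finBasisOfFinrankEq ℂ N.1 N.2).linearIndependent
  rw [Fintype.linearIndependent_iff] at hli
  funext j
  refine hli c ?_ j
  apply Subtype.ext
  ext p
  have := congrFun h p
  simpa [Matrix.mulVec, dotProduct, Gr.repMatrix, mul_comm] using this

theorem det_ne_zero_iff_mulVec {m : ℕ} (A : Matrix (Fin m) (Fin m) ℂ) :
    A.det ≠ 0 ↔ ∀ c, A.mulVec c = 0 → c = 0 := by
  rw [Ne, ← Matrix.exists_mulVec_eq_zero_iff]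
  push Not
  exact ⟨fun h c hc => by_contra fun h0 => h c h0 hc, fun h c h0 hc => h0 (h c hc)⟩

/-- A Plücker coordinate is the determinant of the restriction of N to the rows I, so it is nonzero
iff this restriction is injective on N. -/
theorem plucker_ne_zero_iff {n m : ℕ} (N : Gr n m) (I : Finset ℤ) :
    plucker N I ≠ 0 ↔ (residues n I).card = m ∧
      ∀ f ∈ N.1, (∀ p ∈ residues n I, f p = 0) → f = 0 := by
  unfold plucker maxMinor
  split_ifs with h
  · rw [det_ne_zero_iff_mulVec]
    simp only [h, true_and]
    constructor
    · intro H f hf hI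
      obtain ⟨c, rfl⟩ := exists_repMatrix_mulVec N hf
      rw [H c, Matrix.mulVec_zero]
      ext i
      exact hI _ (Finset.orderEmbOfFin_mem _ h i)
    · intro H c hc
      apply repMatrix_mulVec_injective N
      apply H _ (repMatrix_mulVec_mem N c)
      intro p hp
      have hp' : p ∈ Set.range ((residues n I).orderEmbOfFin h) := by
        rw [Finset.range_orderEmbOfFin]; exact hp
      obtain ⟨i, rfl⟩ := hp'
      exact congrFun hc i
  · simp [h]

theorem exists_mem_of_plucker_ne_zero {n m : ℕ} (N : Gr n m) (I : Finset ℤ)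
    (h : plucker N I ≠ 0) (v : Fin n → ℂ) :
    ∃ f ∈ N.1, ∀ p ∈ residues n I, f p = v p := by
  have hc := ((plucker_ne_zero_iff N I).1 h).1
  unfold plucker maxMinor at h
  rw [dif_pos hc] at h
  set A := N.repMatrix.submatrix ((residues n I).orderEmbOfFin hc) id
  have hu : IsUnit A.det := h.isUnit
  refine ⟨_, repMatrix_mulVec_mem N
    (A⁻¹.mulVec fun i => v ((residues n I).orderEmbOfFin hc i)), fun p hp => ?_⟩
  have hp' : p ∈ Set.range ((residues n I).orderEmbOfFin hc) := by
    rw [Finset.range_orderEmbOfFin]; exact hp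
  obtain ⟨i, rfl⟩ := hp'
  have h1 : A.mulVec (A⁻¹.mulVec fun i => v ((residues n I).orderEmbOfFin hc i)) =
      fun i => v ((residues n I).orderEmbOfFin hc i) := by
    rw [Matrix.mulVec_mulVec, Matrix.mul_nonsing_inv _ hu, Matrix.one_mulVec]
  exact congrFun h1 i

/-- `p` lies in the cyclic interval `[q - m, q - 1]`. -/
def CycBefore {n : ℕ} (m : ℕ) (q p : Fin n) : Prop :=
  (p < q ∧ (q : ℕ) ≤ p + m) ∨ (q ≤ p ∧ (q : ℕ) + n ≤ p + m)

theorem card_cycBefore {n m : ℕ} (hm : m ≤ n) (q : Fin n) (s : Finset (Fin n))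
    (hs : ∀ p, p ∈ s ↔ CycBefore m q p) : s.card = m := by
  have hn : 0 < n := q.pos
  have : s = Finset.univ.image (fun i : Fin m =>
      (⟨((q : ℕ) + n - m + i) % n, Nat.mod_lt _ hn⟩ : Fin n)) := by
    ext p
    simp only [hs, CycBefore, Finset.mem_image, Finset.mem_univ, true_and, Fin.ext_iff,
      Fin.lt_def, Fin.le_def]
    have hp := p.2
    have hq := q.2
    constructor
    · rintro (⟨h1, h2⟩ | ⟨h1, h2⟩)
      · refine ⟨⟨p + m - q, by omega⟩, ?_⟩
        simp only
        rw [show (q : ℕ) + n - m + (p + m - q) = p + n by omega, Nat.add_mod_right,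
          Nat.mod_eq_of_lt hp]
      · refine ⟨⟨p + m - (q + n), by omega⟩, ?_⟩
        simp only
        rw [show (q : ℕ) + n - m + (p + m - (q + n)) = p by omega, Nat.mod_eq_of_lt hp]
    · rintro ⟨i, hi⟩
      have hi2 := i.2
      by_cases h : (q : ℕ) + n - m + i < n
      · rw [Nat.mod_eq_of_lt h] at hi; omega
      · rw [Nat.mod_eq_sub_mod (by omega), Nat.mod_eq_of_lt (by omega)] at hi; omega
  rw [this, Finset.card_image_of_injective, Finset.card_univ, Fintype.card_fin]
  intro i j hij
  have hi := i.2
  have hj := j.2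
  have hq := q.2
  simp only [Fin.ext_iff] at hij ⊢
  have h1 : (q : ℕ) + n - m + i ≡ (q : ℕ) + n - m + j [MOD n] := hij
  have h2 : (i : ℕ) ≡ j [MOD n] := Nat.ModEq.add_left_cancel' _ h1
  exact Nat.ModEq.eq_of_lt_of_lt h2 (by omega) (by omega)

theorem mem_residues_Icc {n m : ℕ} (hm : m ≤ n) (q p : Fin n) :
    p ∈ residues n (Finset.Icc ((q : ℤ) + 1 - m) ((q : ℤ) + 1 - 1)) ↔ CycBefore m q p := by
  rw [mem_residues]
  simp only [Finset.mem_Icc, CycBefore, Fin.lt_def, Fin.le_def]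
  have hp := p.2
  have hq := q.2
  constructor
  · rintro ⟨a, ⟨h1, h2⟩, h3⟩
    obtain ⟨c, hc⟩ := h3.dvd
    have hc0 : c = 0 ∨ c = 1 := by
      have : -1 < c := by
        by_contra hcon
        have : (n : ℤ) * c ≤ n * (-1) := by
          apply mul_le_mul_of_nonneg_left <;> omega
        omega
      have : c < 2 := by
        by_contra hcon
        have : (n : ℤ) * 2 ≤ n * c := by
          apply mul_le_mul_of_nonneg_left <;> omega
        omega
      omega
    rcases hc0 with rfl | rfl <;> omega
  · rintro (⟨h1, h2⟩ | ⟨h1, h2⟩)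
    · exact ⟨p + 1, by omega, Int.ModEq.refl _⟩
    · refine ⟨p + 1 - n, by omega, ?_⟩
      exact (Int.modEq_iff_dvd.2 ⟨1, by ring⟩)

/-- The form in which the domain of g is used: an element of N is determined by its values on any
cyclic interval of length m. -/
theorem gDefined_iff {n m : ℕ} (hm : m ≤ n) (u : XVar n m) :
    GDefined u ↔ ∀ q : Fin n, ∀ f ∈ u.1.1, (∀ p, CycBefore m q p → f p = 0) → f = 0 := by
  have key : ∀ q : Fin n,
      plucker u.1 (Finset.Icc ((q : ℤ) + 1 - m) ((q : ℤ) + 1 - 1)) ≠ 0 ↔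
        ∀ f ∈ u.1.1, (∀ p, CycBefore m q p → f p = 0) → f = 0 := by
    intro q
    rw [plucker_ne_zero_iff, and_iff_right (card_cycBefore hm q _ fun p => mem_residues_Icc hm q p)]
    simp only [mem_residues_Icc hm]
  constructor
  · intro H q
    rw [← key]
    exact H _ (by have := q.2; simp only [Finset.mem_Icc]; omega)
  · intro H j hj
    simp only [Finset.mem_Icc] at hj
    have := (key ⟨(j - 1).toNat, by omega⟩).2 (H _)
    have hj' : (((j - 1).toNat : ℕ) : ℤ) + 1 = j := by omega
    simpa only [hj'] using this

/-- `f ∈ N` vanishes on the cyclic interval `[q - m + 1, q - 1]` and is `1` at `q - m`. -/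
structure IsCol {n : ℕ} (N : Submodule ℂ (Fin n → ℂ)) (m : ℕ) (q : Fin n) (f : Fin n → ℂ) :
    Prop where
  mem : f ∈ N
  eq_zero : ∀ p, CycBefore (m - 1) q p → f p = 0
  eq_one : ∀ p : Fin n, ((p : ℕ) + m = q ∨ (p : ℕ) + m = q + n) → f p = 1

theorem exists_isCol {n m : ℕ} (hm : 0 < m) (hmn : m ≤ n) {u : XVar n m} (hu : GDefined u)
    (q : Fin n) : ∃ f, IsCol u.1.1 m q f := by
  have h := hu ((q : ℤ) + 1) (by have := q.2; simp only [Finset.mem_Icc]; omega)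
  obtain ⟨f, hf, h1⟩ := exists_mem_of_plucker_ne_zero u.1 _ h
    (fun p => if (p : ℕ) + m = q ∨ (p : ℕ) + m = q + n then 1 else 0)
  simp only [mem_residues_Icc hmn] at h1
  have hq := q.2
  refine ⟨f, hf, fun p hp => ?_, fun p hp => ?_⟩
  · rw [h1, if_neg]
    · simp only [CycBefore, Fin.lt_def, Fin.le_def] at hp; omega
    · simp only [CycBefore, Fin.lt_def, Fin.le_def] at hp ⊢; omega
  · rw [h1, if_pos hp]
    have := p.2
    simp only [CycBefore, Fin.lt_def, Fin.le_def]; omega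

/-! ### The entries of `g` -/

theorem neg_one_pow_mul_self {R : Type*} [CommRing R] (a : ℕ) : ((-1 : R) ^ a) * (-1) ^ a = 1 := by
  rw [← mul_pow]; simp

theorem residues_union {n : ℕ} (I J : Finset ℤ) :
    residues n (I ∪ J) = residues n I ∪ residues n J := by
  ext p
  simp only [mem_residues, Finset.mem_union]
  constructor
  · rintro ⟨a, h | h, h'⟩
    exacts [Or.inl ⟨a, h, h'⟩, Or.inr ⟨a, h, h'⟩]
  · rintro (⟨a, h, h'⟩ | ⟨a, h, h'⟩)
    exacts [⟨a, Or.inl h, h'⟩, ⟨a, Or.inr h, h'⟩]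

theorem mem_residues_singleton {n : ℕ} (p r : Fin n) :
    r ∈ residues n {(p : ℤ) + 1} ↔ r = p := by
  rw [mem_residues]
  simp only [Finset.mem_singleton, exists_eq_left, Fin.ext_iff]
  constructor
  · intro h
    have h1 : (p : ℤ) ≡ r [ZMOD n] := Int.ModEq.add_right_cancel' 1 h
    exact (Nat.ModEq.eq_of_lt_of_lt (Int.natCast_modEq_iff.1 h1) p.2 r.2).symm
  · intro h; rw [h]

theorem mem_residues_Icc_union {n m : ℕ} (hm : 0 < m) (hmn : m ≤ n) (q p r : Fin n) :
    r ∈ residues n (Finset.Icc ((q : ℤ) + 1 - m + 1) ((q : ℤ) + 1 - 1) ∪ {(p : ℤ) + 1}) ↔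
      CycBefore (m - 1) q r ∨ r = p := by
  rw [residues_union, Finset.mem_union, mem_residues_singleton,
    ← mem_residues_Icc (by omega : m - 1 ≤ n)]
  have : (q : ℤ) + 1 - m + 1 = (q : ℤ) + 1 - (m - 1 : ℕ) := by omega
  rw [this]

/-- The determinant of the matrix with rows `F (σ i)` and `F p` is linear in the last row. -/
theorem exists_mulVec_eq_det_snoc {n M : ℕ} (F : Matrix (Fin n) (Fin (M + 1)) ℂ)
    (W : Fin M → Fin (M + 1) → ℂ) :
    ∃ c : Fin (M + 1) → ℂ, ∀ p,
      (Matrix.of (Fin.snoc W (F p) : Fin (M + 1) → Fin (M + 1) → ℂ)).det = F.mulVec c p := by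
  refine ⟨fun j => (-1) ^ (M + (j : ℕ)) * (Matrix.of fun i l => W i (j.succAbove l)).det,
    fun p => ?_⟩
  rw [Matrix.det_succ_row _ (Fin.last M)]
  simp only [Matrix.mulVec, dotProduct]
  refine Finset.sum_congr rfl fun j _ => ?_
  have : (Matrix.of (Fin.snoc W (F p) : Fin (M + 1) → Fin (M + 1) → ℂ)).submatrix
      (Fin.last M).succAbove j.succAbove = Matrix.of fun i l => W i (j.succAbove l) := by
    ext i l
    simp [Fin.succAbove_last]
  rw [this]
  simp only [Matrix.of_apply, Fin.snoc_last, Fin.val_last]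
  ring

/-- The numerator P_{[j-m+1,j-1] ∪ {i}} is, up to a sign from sorting the rows, linear in row i. As
a function of i it is therefore a vector of N vanishing on [j-m+1, j-1], hence proportional to `f`,
and the denominator fixes the scale. The sign survives only where the coefficient is t, turning it
into (-1)^(m-1) t. -/
theorem gMatrix_apply {n m : ℕ} (hm : 0 < m) (hmn : m < n) {u : XVar n m} (hu : GDefined u)
    {q : Fin n} {f : Fin n → ℂ} (hf : IsCol u.1.1 m q f) (p : Fin n) :
    gMatrix u p q = (if (q : ℕ) < m then 1 else if q ≤ p then C ((-1) ^ (m + 1) * (u.2 : ℂ))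
      else X) * C (f p) := by
  obtain ⟨M, rfl⟩ : ∃ M, m = M + 1 := ⟨m - 1, by omega⟩
  have hn : 0 < n := q.pos
  have hq := q.2
  set N := u.1 with hN
  -- Taking t to be this sign makes the quasi-period (-1)^(m+1) t equal to 1: the rows are truly
  -- periodic, and each winding contributes the factor `e`.
  set e : ℂ := (-1) ^ (M + 1 + 1) with he
  have hee : e * e = 1 := neg_one_pow_mul_self _
  set V : ℕ → Fin (M + 1) → ℂ := fun i => N.repMatrix ⟨i % n, Nat.mod_lt _ hn⟩ with hV
  set W : Fin M → Fin (M + 1) → ℂ := fun i => V (q + n - M + i) with hW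
  obtain ⟨c, hc⟩ := exists_mulVec_eq_det_snoc N.repMatrix W
  -- The representative of p that lies just after the block q+n-M, …, q+n-1 and within one period of
  -- it.
  set lift : Fin n → ℕ := fun p => if q ≤ p then p + n else p + n + n with hlift
  have hlift_mod : ∀ p : Fin n, lift p % n = p := by
    intro p
    simp only [hlift]
    split_ifs <;> simp [Nat.mod_eq_of_lt p.2]
  set K : ℂ := ∏ i : Fin M, e ^ (((q : ℕ) + n - M + i) / n) with hK
  have hP : ∀ p : Fin n, ¬ CycBefore M q p →
      plucker N (Finset.Icc ((q : ℤ) + 1 - (M + 1 : ℕ) + 1) ((q : ℤ) + 1 - 1) ∪ {(p : ℤ) + 1}) =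
        K * e ^ (lift p / n) * N.repMatrix.mulVec c p := by
    intro p hp
    have hp2 := p.2
    have hl1 : (q : ℕ) + n ≤ lift p := by
      simp only [CycBefore, Fin.lt_def, Fin.le_def] at hp
      simp only [hlift, Fin.le_def]; split_ifs <;> omega
    have hl2 : lift p < (q : ℕ) + n - M + n := by
      simp only [CycBefore, Fin.lt_def, Fin.le_def] at hp
      simp only [hlift, Fin.le_def]; split_ifs <;> omega
    have := maxMinor_eq_of_quasiPeriodic N.repMatrix e V (fun i => by
        simp only [hV, Nat.mod_eq_of_lt i.2]) (fun i => by
        simp only [hV, Nat.add_mod_right]; rw [← he, hee, one_smul])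
      (Finset.Icc ((q : ℤ) + 1 - (M + 1 : ℕ) + 1) ((q : ℤ) + 1 - 1) ∪ {(p : ℤ) + 1})
      (Fin.snoc (fun i : Fin M => (q : ℕ) + n - M + i) (lift p)) ?_ ?_ ?_
    · unfold plucker
      rw [this, Fin.prod_univ_castSucc, ← hc]
      simp only [Fin.snoc_castSucc, Fin.snoc_last, ← hK]
      congr 2
      ext i j
      induction i using Fin.lastCases with
      | last => simp only [Matrix.of_apply, Fin.snoc_last, hV, hlift_mod]
      | cast i => simp only [Matrix.of_apply, Fin.snoc_castSucc, hW]
    · intro i j hij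
      induction i using Fin.lastCases with
      | last => exact absurd hij (not_lt.2 (Fin.le_last j))
      | cast i =>
        have hi := i.2
        induction j using Fin.lastCases with
        | last => simp only [Fin.snoc_last, Fin.snoc_castSucc]; omega
        | cast j =>
          have : (i : ℕ) < j := hij
          simp only [Fin.snoc_castSucc]; omega
    · intro i j
      induction i using Fin.lastCases with
      | last =>
        induction j using Fin.lastCases with
        | last => simp only [Fin.snoc_last]; omega
        | cast j => simp only [Fin.snoc_last, Fin.snoc_castSucc]; omega
      | cast i =>
        have hi := i.2
        induction j using Fin.lastCases with
        | last => simp only [Fin.snoc_last, Fin.snoc_castSucc]; omega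
        | cast j => simp only [Fin.snoc_castSucc]; omega
    · intro r
      have hr := r.2
      rw [mem_residues_Icc_union (by omega) hmn.le, Fin.exists_fin_succ'
        (P := fun i => (Fin.snoc (fun i : Fin M => (q : ℕ) + n - M + i) (lift p) :
          Fin (M + 1) → ℕ) i % n = (r : ℕ))]
      simp only [Fin.snoc_castSucc, Fin.snoc_last, hlift_mod, Nat.add_sub_cancel]
      refine or_congr ?_ (by rw [Fin.ext_iff, eq_comm])
      simp only [CycBefore, Fin.lt_def, Fin.le_def]
      constructor
      · rintro (⟨h1, h2⟩ | ⟨h1, h2⟩)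
        · refine ⟨⟨r + M - q, by omega⟩, ?_⟩
          simp only
          rw [show (q : ℕ) + n - M + (r + M - q) = r + n by omega, Nat.add_mod_right,
            Nat.mod_eq_of_lt hr]
        · refine ⟨⟨r + M - (q + n), by omega⟩, ?_⟩
          simp only
          rw [show (q : ℕ) + n - M + (r + M - (q + n)) = r by omega, Nat.mod_eq_of_lt hr]
      · rintro ⟨i, hi⟩
        have hi2 := i.2
        by_cases h : (q : ℕ) + n - M + i < n
        · rw [Nat.mod_eq_of_lt h] at hi; omega
        · rw [Nat.mod_eq_sub_mod (by omega), Nat.mod_eq_of_lt (by omega)] at hi; omega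
  have hzero : ∀ p, CycBefore M q p → N.repMatrix.mulVec c p = 0 := by
    intro p hp
    rw [← hc]
    simp only [CycBefore, Fin.lt_def, Fin.le_def] at hp
    have hp2 := p.2
    set i : Fin M := ⟨if p < q then (p : ℕ) + M - q else p + M - (q + n), by
      simp only [Fin.lt_def]; split_ifs <;> omega⟩ with hi
    refine Matrix.det_zero_of_row_eq (i := i.castSucc) (j := Fin.last M)
      (Fin.castSucc_lt_last i).ne ?_
    change (Fin.snoc W (N.repMatrix p) : Fin (M + 1) → Fin (M + 1) → ℂ) i.castSucc =
      (Fin.snoc W (N.repMatrix p) : Fin (M + 1) → Fin (M + 1) → ℂ) (Fin.last M)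
    rw [Fin.snoc_castSucc, Fin.snoc_last]
    simp only [hW, hV]
    congr 1
    ext
    simp only [hi, Fin.lt_def]
    split_ifs with h
    · rw [show (q : ℕ) + n - M + (p + M - q) = p + n by omega, Nat.add_mod_right,
        Nat.mod_eq_of_lt hp2]
    · rw [show (q : ℕ) + n - M + (p + M - (q + n)) = p by omega, Nat.mod_eq_of_lt hp2]
  set p0 : Fin n := ⟨if (q : ℕ) < M + 1 then q + n - (M + 1) else q - (M + 1), by
    split_ifs <;> omega⟩ with hp0
  have hp0' : (p0 : ℕ) + (M + 1) = q ∨ (p0 : ℕ) + (M + 1) = q + n := by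
    simp only [hp0]; split_ifs <;> omega
  clear_value p0
  have hp0c : ¬ CycBefore M q p0 := by
    simp only [CycBefore, Fin.lt_def, Fin.le_def]; omega
  -- The difference of the two sides vanishes on a full window of length m, hence everywhere.
  have hprop : ∀ p, N.repMatrix.mulVec c p = N.repMatrix.mulVec c p0 * f p := by
    have h := (gDefined_iff hmn.le u).1 hu q
      (N.repMatrix.mulVec c - N.repMatrix.mulVec c p0 • f)
      (Submodule.sub_mem _ (repMatrix_mulVec_mem N c) (Submodule.smul_mem _ _ hf.mem)) ?_
    · intro p
      have := congrFun h p
      simpa [sub_eq_zero] using this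
    · intro p hp
      by_cases h : CycBefore M q p
      · simp [hzero p h, hf.eq_zero p h]
      · have : p = p0 := by
          have := p.2
          simp only [CycBefore, Fin.lt_def, Fin.le_def] at h hp
          ext; omega
        have hfp := hf.eq_one p0 hp0'
        rw [this]
        simp [hfp]
  have hden : plucker N (Finset.Icc ((q : ℤ) + 1 - (M + 1 : ℕ)) ((q : ℤ) + 1 - 1)) =
      K * e ^ (lift p0 / n) * N.repMatrix.mulVec c p0 := by
    rw [← hP p0 hp0c]
    apply maxMinor_congr
    ext r
    rw [mem_residues_Icc hmn.le, mem_residues_Icc_union (by omega) hmn.le]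
    have := r.2
    simp only [CycBefore, Fin.lt_def, Fin.le_def, Nat.add_sub_cancel, Fin.ext_iff]
    omega
  have hden0 : plucker N (Finset.Icc ((q : ℤ) + 1 - (M + 1 : ℕ)) ((q : ℤ) + 1 - 1)) ≠ 0 :=
    hu _ (by simp only [Finset.mem_Icc]; omega)
  have hratio : plucker N (Finset.Icc ((q : ℤ) + 1 - (M + 1 : ℕ) + 1) ((q : ℤ) + 1 - 1) ∪
      {(p : ℤ) + 1}) /
      plucker N (Finset.Icc ((q : ℤ) + 1 - (M + 1 : ℕ)) ((q : ℤ) + 1 - 1)) =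
      (if (q : ℕ) < M + 1 then 1 else if q ≤ p then e else 1) * f p := by
    have hp2 := p.2
    by_cases h : CycBefore M q p
    · rw [hf.eq_zero p h, mul_zero, div_eq_zero_iff]
      left
      by_contra hne
      have h1 := ((plucker_ne_zero_iff _ _).1 hne).1
      have h2 := card_cycBefore (m := M) (by omega) q _ (fun r => by
        rw [mem_residues_Icc_union (n := n) (m := M + 1) (by omega) hmn.le q p r,
          Nat.add_sub_cancel]
        constructor
        · rintro (h' | rfl)
          exacts [h', h]
        · exact Or.inl)
      omega
    · rw [div_eq_iff hden0, hP p h, hden, hprop p]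
      have hdiv1 : ∀ p : Fin n, (p + n) / n = 1 := fun p => by
        rw [Nat.add_div_right _ hn, Nat.div_eq_of_lt p.2]
      have hdiv2 : ∀ p : Fin n, (p + n + n) / n = 2 := fun p => by
        rw [Nat.add_div_right _ hn, hdiv1]
      have hlp : ∀ p : Fin n, lift p / n = if q ≤ p then 1 else 2 := by
        intro p; simp only [hlift]; split_ifs <;> simp [hdiv1, hdiv2]
      have hp2 := p.2
      simp only [hlp]
      simp only [CycBefore, Fin.lt_def, Fin.le_def] at h
      by_cases h1 : (q : ℕ) < M + 1
      · have hA : q ≤ p0 := by simp only [Fin.le_def]; omega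
        have hB : q ≤ p := by simp only [Fin.le_def]; omega
        rw [if_pos h1, if_pos hA, if_pos hB]; ring
      · have hA : ¬ q ≤ p0 := by
          have := p0.2
          simp only [Fin.le_def]; omega
        rw [if_neg h1, if_neg hA]
        split_ifs
        · linear_combination (-K * e * N.repMatrix.mulVec c p0 * f p) * hee
        · ring
  unfold gMatrix gCoeff
  simp only [Matrix.of_apply]
  rw [hratio]
  have : ((q : ℕ) + 1 ≤ M + 1) = ((q : ℕ) < M + 1) := by simp
  simp only [this]
  split_ifs <;> simp only [C_mul, one_mul]
  all_goals ring

/-! ### Column spans -/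

theorem mem_firstColSpan {n m : ℕ} (A : Matrix (Fin n) (Fin n) ℂ) (f : Fin n → ℂ) :
    f ∈ firstColSpan m A ↔ ∃ c : Fin n → ℂ, (∀ p : Fin n, m ≤ p → c p = 0) ∧ A.mulVec c = f := by
  constructor
  · intro hf
    unfold firstColSpan at hf
    induction hf using Submodule.span_induction with
    | mem x hx =>
      obtain ⟨j, rfl⟩ := hx
      refine ⟨Pi.single j.1 1, fun p hp => ?_, ?_⟩
      · have := j.2
        rw [Pi.single_eq_of_ne]
        intro h; subst h; omega
      · simp
    | zero => exact ⟨0, by simp, by simp⟩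
    | add x y _ _ hx hy =>
      obtain ⟨c, hc, rfl⟩ := hx
      obtain ⟨d, hd, rfl⟩ := hy
      exact ⟨c + d, fun p hp => by simp [hc p hp, hd p hp], Matrix.mulVec_add _ _ _⟩
    | smul a x _ hx =>
      obtain ⟨c, hc, rfl⟩ := hx
      exact ⟨a • c, fun p hp => by simp [hc p hp], Matrix.mulVec_smul _ _ _⟩
  · rintro ⟨c, hc, rfl⟩
    rw [Matrix.mulVec_eq_sum]
    refine Submodule.sum_mem _ fun j _ => ?_
    by_cases hj : (j : ℕ) < m
    · rw [op_smul_eq_smul]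
      exact Submodule.smul_mem _ _ (Submodule.subset_span ⟨⟨j, hj⟩, rfl⟩)
    · rw [hc j (by omega)]; simp

theorem finrank_firstColSpan_of_injective {n m : ℕ} (hm : m ≤ n) (A : Matrix (Fin n) (Fin n) ℂ)
    (h : ∀ c : Fin n → ℂ, (∀ p : Fin n, m ≤ p → c p = 0) → A.mulVec c = 0 → c = 0) :
    Module.finrank ℂ (firstColSpan m A) = m := by
  have h2 : LinearIndependent ℂ (fun j : {j : Fin n // (j : ℕ) < m} => A.col j) := by
    rw [Fintype.linearIndependent_iff]
    intro g hg i
    have := h (fun p => if hp : (p : ℕ) < m then g ⟨p, hp⟩ else 0)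
      (fun p hp => dif_neg (by omega)) ?_
    · have := congrFun this i.1
      simpa [i.2] using this
    · rw [← hg]
      ext p
      simp only [Matrix.mulVec, dotProduct, Finset.sum_apply, Pi.smul_apply, Matrix.col_apply,
        smul_eq_mul]
      rw [← Fintype.sum_subtype_add_sum_subtype (fun q : Fin n => (q : ℕ) < m)]
      have h0 : ∑ q : {q : Fin n // ¬ (q : ℕ) < m}, A p q *
          (if hp : (q.1 : ℕ) < m then g ⟨q.1, hp⟩ else 0) = 0 :=
        Finset.sum_eq_zero fun q _ => by rw [dif_neg q.2, mul_zero]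
      rw [h0, add_zero]
      exact Finset.sum_congr rfl fun q _ => by rw [dif_pos q.2, mul_comm]
  unfold firstColSpan
  rw [finrank_span_eq_card h2, Fintype.card_subtype, Fin.card_filter_val_lt]
  omega

/-! ### The columns of `g` span -/

/-- Any m cyclically consecutive columns span N, by triangular elimination: subtracting the multiple
g(p1) f_b with b = p1 + m kills the entry at p1 and keeps the zeros already obtained between p1 and
c. -/
theorem le_of_isCol_mem {n m : ℕ} (hmn : m < n) {u : XVar n m} (hu : GDefined u)
    {f : Fin n → Fin n → ℂ} (hf : ∀ q, IsCol u.1.1 m q (f q)) (c : Fin n)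
    (L : Submodule ℂ (Fin n → ℂ))
    (hL : ∀ b : Fin n, ((c < b ∧ (b : ℕ) ≤ c + m) ∨ (b ≤ c ∧ (b : ℕ) + n ≤ c + m)) → f b ∈ L) :
    u.1.1 ≤ L := by
  have hc := c.2
  have key : ∀ d ≤ m, ∀ g ∈ u.1.1, (∀ p : Fin n, ((p ≤ c ∧ (c : ℕ) < p + (m - d)) ∨
      (c < p ∧ (c : ℕ) + n < p + (m - d))) → g p = 0) → g ∈ L := by
    intro d
    induction d with
    | zero =>
      intro _ g hg h
      have : g = 0 := by
        refine (gDefined_iff hmn.le u).1 hu ⟨if (c : ℕ) + 1 < n then c + 1 else 0, by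
          split_ifs <;> omega⟩ g hg fun p hp => h p ?_
        have := p.2
        simp only [CycBefore, Fin.lt_def, Fin.le_def] at hp ⊢
        split_ifs at hp <;> omega
      rw [this]; exact L.zero_mem
    | succ d ih =>
      intro hd g hg h
      set i := m - (d + 1) with hi
      have hp1 : ∃ p1 : Fin n, (p1 : ℕ) + i = c ∨ (p1 : ℕ) + i = c + n :=
        ⟨⟨if i ≤ (c : ℕ) then c - i else c + n - i, by split_ifs <;> omega⟩, by
          simp only; split_ifs <;> omega⟩
      obtain ⟨p1, hp1v⟩ := hp1
      have hb : ∃ b : Fin n, (p1 : ℕ) + m = b ∨ (p1 : ℕ) + m = b + n :=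
        ⟨⟨if (p1 : ℕ) + m < n then p1 + m else p1 + m - n, by
          have := p1.2; split_ifs <;> omega⟩, by simp only; split_ifs <;> omega⟩
      obtain ⟨b, hbv⟩ := hb
      have hp12 := p1.2
      have hb2 := b.2
      have hbL : f b ∈ L := hL b (by simp only [Fin.lt_def, Fin.le_def]; omega)
      have h1 := ih (by omega) (g - g p1 • f b)
        (Submodule.sub_mem _ hg (Submodule.smul_mem _ _ (hf b).mem)) ?_
      · have := L.add_mem h1 (L.smul_mem (g p1) hbL)
        simpa using this
      · intro p hp
        have hp2 := p.2
        simp only [Fin.lt_def, Fin.le_def] at hp h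
        by_cases hpp : p = p1
        · have := (hf b).eq_one p1 hbv
          rw [hpp]; simp [this]
        · have hpp' : (p : ℕ) ≠ p1 := fun h => hpp (Fin.ext h)
          have h2 := h p (by omega)
          have h3 := (hf b).eq_zero p (by
            simp only [CycBefore, Fin.lt_def, Fin.le_def]; omega)
          simp [h2, h3]
  intro g hg
  refine key m le_rfl g hg fun p hp => ?_
  have := p.2
  simp only [Fin.lt_def, Fin.le_def] at hp; omega

/-- The values on a window are coordinates on N, so evaluation at any other position is a
combination of them. This yields linear relations between rows of g. -/
theorem exists_eval_eq_sum {n m : ℕ} (hmn : m ≤ n) {u : XVar n m} (hu : GDefined u) (q0 : Fin n) :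
    ∃ α : Fin n → Fin n → ℂ, (∀ a q, ¬ CycBefore m q0 q → α a q = 0) ∧
      ∀ f ∈ u.1.1, ∀ a, f a = ∑ q, α a q * f q := by
  classical
  have h := hu ((q0 : ℤ) + 1) (by have := q0.2; simp only [Finset.mem_Icc]; omega)
  choose e he1 he2 using fun q : Fin n =>
    exists_mem_of_plucker_ne_zero u.1 _ h (fun p => if p = q then 1 else 0)
  simp only [mem_residues_Icc hmn] at he2
  refine ⟨fun a q => if CycBefore m q0 q then e q a else 0, fun a q hq => if_neg hq,
    fun f hf a => ?_⟩
  have h0 : f - ∑ q, (if CycBefore m q0 q then f q else 0) • e q = 0 := by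
    refine (gDefined_iff hmn u).1 hu q0 _ (Submodule.sub_mem _ hf
      (Submodule.sum_mem _ fun q _ => Submodule.smul_mem _ _ (he1 q))) fun p hp => ?_
    simp only [Pi.sub_apply, Finset.sum_apply, Pi.smul_apply, smul_eq_mul, he2 _ p hp]
    simp [hp]
  have h1 := congrFun h0 a
  simp only [Pi.sub_apply, Finset.sum_apply, Pi.smul_apply, smul_eq_mul, Pi.zero_apply,
    sub_eq_zero] at h1
  rw [h1]
  refine Finset.sum_congr rfl fun q _ => ?_
  by_cases hq : CycBefore m q0 q
  · simp only [if_pos hq]; ring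
  · simp only [if_neg hq]; ring

/-! ### The Schützenberger involution -/

theorem evalAt_gMatrix_apply {n m : ℕ} (hm : 0 < m) (hmn : m < n) {u : XVar n m}
    (hu : GDefined u) {q : Fin n} {f : Fin n → ℂ} (hf : IsCol u.1.1 m q f) (z : ℂ) (p : Fin n) :
    evalAt (gMatrix u) z p q = (if (q : ℕ) < m then 1 else if q ≤ p then
      (-1) ^ (m + 1) * (u.2 : ℂ) else z) * f p := by
  unfold evalAt
  rw [Matrix.map_apply, gMatrix_apply hm hmn hu hf]
  split_ifs <;> simp only [eval_mul, eval_one, eval_C, eval_X]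

/-- At `λ = (-1)^{m-1} t` the columns of `g(N|t)` lie in `N`. -/
theorem evalAt_gMatrix_apply_self {n m : ℕ} (hm : 0 < m) (hmn : m < n) {u : XVar n m}
    (hu : GDefined u) {q : Fin n} {f : Fin n → ℂ} (hf : IsCol u.1.1 m q f) (p : Fin n) :
    evalAt (gMatrix u) ((-1) ^ (m + 1) * (u.2 : ℂ)) p q =
      (if (q : ℕ) < m then 1 else (-1) ^ (m + 1) * (u.2 : ℂ)) * f p := by
  rw [evalAt_gMatrix_apply hm hmn hu hf]
  split_ifs <;> rfl

theorem mem_piMap {n m : ℕ} {z : ℂˣ} {A : Matrix (Fin n) (Fin n) ℂ[X]} {x : XVar n m} :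
    x ∈ piMap m z A ↔
      ∃ h : Module.finrank ℂ (firstColSpan m (evalAt A ((-1) ^ (m + 1) * (z : ℂ)))) = m,
        x = (⟨firstColSpan m (evalAt A ((-1) ^ (m + 1) * (z : ℂ))), h⟩, z) := by
  unfold piMap
  simp only [Part.mem_mk_iff, eq_comm]

theorem mem_g {n m : ℕ} {u : XVar n m} {A : Matrix (Fin n) (Fin n) ℂ[X]} :
    A ∈ g u ↔ GDefined u ∧ A = gMatrix u := by
  unfold g
  simp only [Part.mem_mk_iff, exists_prop, eq_comm]

theorem mem_schutz {n m : ℕ} {u x : XVar n m} :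
    x ∈ schutz u ↔ GDefined u ∧ x ∈ piMap m u.2 (flipMatrix (gMatrix u)) := by
  unfold schutz
  simp only [Part.mem_bind_iff, mem_g]
  constructor
  · rintro ⟨_, ⟨h, rfl⟩, h'⟩; exact ⟨h, h'⟩
  · rintro ⟨h, h'⟩; exact ⟨_, ⟨h, rfl⟩, h'⟩

theorem mem_psi {n l m : ℕ} {u : XVar n l} {v x : XVar n m} :
    x ∈ psi u v ↔ GDefined u ∧ GDefined v ∧ x ∈ piMap m v.2 (gMatrix u * gMatrix v) := by
  unfold psi gProd
  simp only [Part.mem_bind_iff, Part.mem_map_iff, mem_g]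
  constructor
  · rintro ⟨_, ⟨_, ⟨h1, rfl⟩, _, ⟨h2, rfl⟩, rfl⟩, h3⟩; exact ⟨h1, h2, h3⟩
  · rintro ⟨h1, h2, h3⟩; exact ⟨_, ⟨_, ⟨h1, rfl⟩, _, ⟨h2, rfl⟩, rfl⟩, h3⟩

theorem evalAt_flipMatrix {n : ℕ} (A : Matrix (Fin n) (Fin n) ℂ[X]) (z : ℂ) :
    evalAt (flipMatrix A) z = flipMatrix (evalAt A z) := rfl

theorem evalAt_mul {n : ℕ} (A B : Matrix (Fin n) (Fin n) ℂ[X]) (z : ℂ) :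
    evalAt (A * B) z = evalAt A z * evalAt B z := by
  ext i j
  simp [evalAt, Matrix.mul_apply, eval_finsetSum]

theorem flipMatrix_mul {n : ℕ} {R : Type*} [CommRing R] (A B : Matrix (Fin n) (Fin n) R) :
    flipMatrix (A * B) = flipMatrix B * flipMatrix A := by
  ext i j
  simp only [flipMatrix, Matrix.of_apply, Matrix.mul_apply]
  rw [← Equiv.sum_comp Fin.revPerm]
  exact Finset.sum_congr rfl fun q _ => by simp [mul_comm]

/-- A functional which vanishes on all columns `f_b`, for `b` in the cyclic interval
`[rev q + 1, rev q + m]`, vanishes on `N`. -/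
theorem sum_eq_zero_of_isCol {n m : ℕ} (hmn : m < n) {u : XVar n m} (hu : GDefined u)
    {f : Fin n → Fin n → ℂ} (hf : ∀ q, IsCol u.1.1 m q (f q)) (q : Fin n) (c : Fin n → ℂ)
    (hc : ∀ p, CycBefore m q p → ∑ a, f p.rev a * c a = 0) {h : Fin n → ℂ} (hh : h ∈ u.1.1) :
    ∑ a, h a * c a = 0 := by
  let L : Submodule ℂ (Fin n → ℂ) :=
    { carrier := {h | ∑ a, h a * c a = 0}
      add_mem' := fun {x y} hx hy => by
        simp only [Set.mem_ofPred_eq, Pi.add_apply, add_mul, Finset.sum_add_distrib] at *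
        rw [hx, hy, add_zero]
      zero_mem' := by simp
      smul_mem' := fun r x hx => by
        simp only [Set.mem_ofPred_eq, Pi.smul_apply, smul_eq_mul, mul_assoc] at *
        rw [← Finset.mul_sum, hx, mul_zero] }
  refine le_of_isCol_mem hmn hu hf q.rev L (fun b hb => ?_) hh
  have hq := q.2
  have hb2 := b.2
  have := hc b.rev (by
    simp only [CycBefore, Fin.lt_def, Fin.le_def, Fin.val_rev] at *; omega)
  rwa [Fin.rev_rev] at this

theorem flip_mulVec_apply {n m : ℕ} (hm : 0 < m) (hmn : m < n) {u : XVar n m}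
    (hu : GDefined u) {f : Fin n → Fin n → ℂ} (hf : ∀ q, IsCol u.1.1 m q (f q)) (c : Fin n → ℂ)
    (p : Fin n) :
    (evalAt (flipMatrix (gMatrix u)) ((-1) ^ (m + 1) * (u.2 : ℂ))).mulVec c p =
      (if (p.rev : ℕ) < m then 1 else (-1) ^ (m + 1) * (u.2 : ℂ)) *
        ∑ a, f p.rev a * c a.rev := by
  rw [evalAt_flipMatrix]
  simp only [Matrix.mulVec, dotProduct, flipMatrix, Matrix.of_apply,
    evalAt_gMatrix_apply_self hm hmn hu (hf _)]
  rw [Finset.mul_sum, ← Equiv.sum_comp Fin.revPerm]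
  exact Finset.sum_congr rfl fun q _ => by simp [mul_assoc]

theorem coeff_ne_zero {m : ℕ} (t : ℂˣ) : ((-1) ^ (m + 1) * (t : ℂ)) ≠ 0 :=
  mul_ne_zero (pow_ne_zero _ (by norm_num)) t.ne_zero

/-- A kernel vector of the flipped columns, reversed, is a functional supported on the last m
positions that vanishes on all columns of g, hence on N; but values of N on that window are
arbitrary. -/
theorem finrank_flip_gMatrix {n m : ℕ} (hm : 0 < m) (hmn : m < n) {u : XVar n m}
    (hu : GDefined u) :
    Module.finrank ℂ (firstColSpan m
      (evalAt (flipMatrix (gMatrix u)) ((-1) ^ (m + 1) * (u.2 : ℂ)))) = m := by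
  choose f hf using exists_isCol hm hmn.le hu
  have hn : 0 < n := by omega
  apply finrank_firstColSpan_of_injective hmn.le
  intro c hc h0
  have h1 : ∀ g ∈ u.1.1, ∑ a, g a * c a.rev = 0 := by
    intro g hg
    refine sum_eq_zero_of_isCol hmn hu hf ⟨0, hn⟩ (fun a => c a.rev) (fun p _ => ?_) hg
    have h := congrFun h0 p
    rw [flip_mulVec_apply hm hmn hu hf] at h
    refine (mul_eq_zero.1 h).resolve_left ?_
    split_ifs
    · exact one_ne_zero
    · exact coeff_ne_zero _
  have hI := hu 1 (by simp only [Finset.mem_Icc]; omega)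
  have hr : ∀ p : Fin n, p ∈ residues n (Finset.Icc ((1 : ℤ) - m) (1 - 1)) ↔
      CycBefore m ⟨0, hn⟩ p := by
    intro p
    rw [← mem_residues_Icc hmn.le]
    simp
  -- Testing against the element of N that equals the conjugate of the functional on the window
  -- turns the relation into a vanishing sum of squared moduli.
  obtain ⟨e, he, he1⟩ := exists_mem_of_plucker_ne_zero u.1 _ hI (fun p => star (c p.rev))
  simp only [hr] at he1
  have h2 := h1 e he
  have h3 : ∀ a, e a * c a.rev = ((Complex.normSq (c a.rev) : ℝ) : ℂ) := by
    intro a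
    by_cases ha : CycBefore m ⟨0, hn⟩ a
    · rw [he1 a ha, Complex.normSq_eq_conj_mul_self]; rfl
    · have : c a.rev = 0 := hc _ (by
        have := a.2
        simp only [CycBefore, Fin.lt_def, Fin.le_def, Fin.val_rev] at *; omega)
      simp [this]
  simp only [h3] at h2
  rw [← Complex.ofReal_sum, Complex.ofReal_eq_zero,
    Finset.sum_eq_zero_iff_of_nonneg fun _ _ => Complex.normSq_nonneg _] at h2
  funext p
  have := h2 p.rev (Finset.mem_univ _)
  simpa using this

theorem exists_mem_schutz {n m : ℕ} (hm : 0 < m) (hmn : m < n) {u : XVar n m}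
    (hu : GDefined u) : ∃ x, x ∈ schutz u :=
  ⟨_, mem_schutz.2 ⟨hu, mem_piMap.2 ⟨finrank_flip_gMatrix hm hmn hu, rfl⟩⟩⟩

theorem snd_of_mem_schutz {n m : ℕ} {u x : XVar n m} (hx : x ∈ schutz u) : x.2 = u.2 := by
  obtain ⟨_, h⟩ := mem_schutz.1 hx
  obtain ⟨_, rfl⟩ := mem_piMap.1 h
  rfl

/-- Vanishing of a flipped combination on a window says that a functional kills m consecutive
columns of g(u), hence all of N, hence every entry of the combination. -/
theorem gDefined_of_mem_schutz {n m : ℕ} (hm : 0 < m) (hmn : m < n) {u x : XVar n m}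
    (hx : x ∈ schutz u) : GDefined x := by
  obtain ⟨hu, h⟩ := mem_schutz.1 hx
  obtain ⟨_, rfl⟩ := mem_piMap.1 h
  choose f hf using exists_isCol hm hmn.le hu
  rw [gDefined_iff hmn.le]
  intro q y hy hy0
  obtain ⟨c, hc, rfl⟩ := (mem_firstColSpan _ _).1 hy
  have hne : ∀ p : Fin n, (if (p.rev : ℕ) < m then (1 : ℂ) else (-1) ^ (m + 1) * (u.2 : ℂ)) ≠ 0 := by
    intro p
    split_ifs
    · exact one_ne_zero
    · exact coeff_ne_zero _
  ext p
  rw [flip_mulVec_apply hm hmn hu hf, Pi.zero_apply,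
    sum_eq_zero_of_isCol hmn hu hf q (fun a => c a.rev) (fun p hp => ?_) (hf _).mem, mul_zero]
  have := hy0 p hp
  rw [flip_mulVec_apply hm hmn hu hf] at this
  exact (mul_eq_zero.1 this).resolve_left (hne p)

/-- The columns of fl(g(u)) are rows of g(u). By `exists_eval_eq_sum` they lie in the flipped
subspace, and the zeros and the normalising ones of the f_q are symmetric under the anti-diagonal
flip, so after rescaling they are the distinguished columns for `x`. -/
theorem gMatrix_schutz {n m : ℕ} (hm : 0 < m) (hmn : m < n) {u x : XVar n m}
    (hx : x ∈ schutz u) : gMatrix x = flipMatrix (gMatrix u) := by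
  have hgx := gDefined_of_mem_schutz hm hmn hx
  obtain ⟨hu, h⟩ := mem_schutz.1 hx
  have hn : 0 < n := by omega
  choose f hf using exists_isCol hm hmn.le hu
  obtain ⟨h2, rfl⟩ := mem_piMap.1 h
  set c' : Fin n → ℂ := fun b => if (b : ℕ) < m then 1 else (-1) ^ (m + 1) * (u.2 : ℂ) with hc'
  have hrow : ∀ a : Fin n, (fun p : Fin n => c' p.rev * f p.rev a) ∈ firstColSpan m
      (evalAt (flipMatrix (gMatrix u)) ((-1) ^ (m + 1) * (u.2 : ℂ))) := by
    intro a
    obtain ⟨α, hα0, hα⟩ := exists_eval_eq_sum hmn.le hu ⟨0, hn⟩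
    rw [mem_firstColSpan]
    refine ⟨fun q => α a q.rev, fun p hp => hα0 _ _ ?_, ?_⟩
    · simp only [CycBefore, Fin.lt_def, Fin.le_def, Fin.val_rev]
      have := p.2
      omega
    · ext p
      rw [flip_mulVec_apply hm hmn hu hf, hα _ (hf p.rev).mem]
      simp only [Fin.rev_rev, hc']
      congr 1
      exact Finset.sum_congr rfl fun _ _ => mul_comm _ _
  ext i j : 2
  have hi := i.2
  have hj := j.2
  set d : ℂ := if (j : ℕ) < m then 1 else (-1) ^ (m + 1) * (u.2 : ℂ) with hd
  have hd0 : d ≠ 0 := by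
    rw [hd]
    split_ifs
    · exact one_ne_zero
    · exact coeff_ne_zero _
  have hcol : IsCol (firstColSpan m (evalAt (flipMatrix (gMatrix u))
      ((-1) ^ (m + 1) * (u.2 : ℂ)))) m j (d⁻¹ • fun p : Fin n => c' p.rev * f p.rev j.rev) := by
    refine ⟨Submodule.smul_mem _ _ (hrow _), fun p hp => ?_, fun p hp => ?_⟩
    · have := (hf p.rev).eq_zero j.rev (by
        have := p.2
        simp only [CycBefore, Fin.lt_def, Fin.le_def, Fin.val_rev] at *; omega)
      simp [this]
    · have hp2 := p.2
      have h1 := (hf p.rev).eq_one j.rev (by simp only [Fin.val_rev]; omega)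
      have h3 : c' p.rev = d := by
        simp only [hc', hd, Fin.val_rev]
        refine if_congr ?_ rfl rfl
        omega
      simp [h1, h3, hd0]
  rw [gMatrix_apply hm hmn hgx hcol]
  simp only [flipMatrix, Matrix.of_apply]
  rw [gMatrix_apply hm hmn hu (hf i.rev)]
  simp only [Pi.smul_apply, smul_eq_mul, Fin.rev_le_rev]
  -- On and below the diagonal both coefficients are constants. Above it, either the entry is zero
  -- by the support condition or both coefficients are λ.
  by_cases hji : j ≤ i
  · have key : (if (j : ℕ) < m then (1 : ℂ[X]) else if j ≤ i then
        C ((-1) ^ (m + 1) * (u.2 : ℂ)) else X) = C d := by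
      rw [if_pos hji, hd]; split_ifs <;> simp
    have key2 : (if (i.rev : ℕ) < m then (1 : ℂ[X]) else if j ≤ i then
        C ((-1) ^ (m + 1) * (u.2 : ℂ)) else X) = C (c' i.rev) := by
      rw [if_pos hji]; simp only [hc']; split_ifs <;> simp
    rw [key, key2, ← C_mul, ← C_mul, mul_inv_cancel_left₀ hd0]
  · have hij : (i : ℕ) < j := not_le.1 hji
    by_cases hjm : (j : ℕ) < m
    · have h0 := (hf i.rev).eq_zero j.rev (by
        simp only [CycBefore, Fin.lt_def, Fin.le_def, Fin.val_rev]; omega)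
      rw [h0]; simp
    · by_cases him : (i.rev : ℕ) < m
      · have h0 := (hf i.rev).eq_zero j.rev (by
          simp only [CycBefore, Fin.lt_def, Fin.le_def, Fin.val_rev] at *; omega)
        rw [h0]; simp
      · have : c' i.rev = d := by simp only [hc', hd, if_neg him, if_neg hjm]
        rw [if_neg hjm, if_neg hji, if_neg him, this, inv_mul_cancel_left₀ hd0]

/-! ### The tableau matrix -/

theorem rowFactor_mulVec {n k : ℕ} (Y : RatRect n k) (i : ℕ) (f : Fin n → ℂ) (p : Fin n) :
    (rowFactor Y i).mulVec f p =
      (if i ≤ (p : ℕ) + 1 ∧ (p : ℕ) + 1 ≤ i + n - k then Y.ratio i (p + 1) else 1) * f p +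
      ∑ q : Fin n, if (p : ℕ) = q + 1 ∧ i + 1 ≤ (p : ℕ) + 1 ∧ (p : ℕ) + 1 ≤ i + n - k
        then f q else 0 := by
  have h1 : (if i ≤ (p : ℕ) + 1 ∧ (p : ℕ) + 1 ≤ i + n - k then Y.ratio i (p + 1) else 1) * f p =
      ∑ q, if p = q then
        (if i ≤ (p : ℕ) + 1 ∧ (p : ℕ) + 1 ≤ i + n - k then Y.ratio i (p + 1) else 1) * f q
        else 0 := by
    rw [Finset.sum_ite_eq]; simp
  rw [h1, ← Finset.sum_add_distrib]
  simp only [Matrix.mulVec, dotProduct, rowFactor, Matrix.of_apply]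
  refine Finset.sum_congr rfl fun q _ => ?_
  by_cases hpq : p = q
  · subst hpq
    rw [if_pos rfl, if_pos rfl, if_neg (c := (p : ℕ) = p + 1 ∧ _) (by omega), add_zero]
  · rw [if_neg hpq, if_neg hpq, zero_add, ite_mul, one_mul, zero_mul]

theorem rowFactor_mulVec_of_not {n k : ℕ} (Y : RatRect n k) {i : ℕ} (f : Fin n → ℂ) {p : Fin n}
    (hp : (p : ℕ) + 1 < i ∨ i + n - k < p + 1) : (rowFactor Y i).mulVec f p = f p := by
  rw [rowFactor_mulVec, if_neg (by omega), Finset.sum_eq_zero, one_mul, add_zero]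
  intro q _
  rw [if_neg (by omega)]

theorem rowFactor_mulVec_of_eq {n k : ℕ} (Y : RatRect n k) {i : ℕ} (f : Fin n → ℂ) {p : Fin n}
    (hk : k ≤ n) (hp : (p : ℕ) + 1 = i) : (rowFactor Y i).mulVec f p = Y.ratio i i * f p := by
  rw [rowFactor_mulVec, if_pos (by omega), Finset.sum_eq_zero, hp, add_zero]
  intro q _
  rw [if_neg (by omega)]

theorem rowFactor_mulVec_of_lt {n k : ℕ} (Y : RatRect n k) {i : ℕ} (f : Fin n → ℂ) {p q : Fin n}
    (hpq : (p : ℕ) = q + 1) (hi : i ≤ p) (hp : (p : ℕ) + 1 ≤ i + n - k) :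
    (rowFactor Y i).mulVec f p = Y.ratio i (p + 1) * f p + f q := by
  rw [rowFactor_mulVec, if_pos (by omega), Finset.sum_eq_single q, if_pos (by omega)]
  · intro r _ hr
    rw [if_neg]
    intro h
    apply hr
    ext; omega
  · simp

theorem tableauProd_succ_mulVec {n k : ℕ} (Y : RatRect n k) (r : ℕ) (c : Fin n → ℂ) :
    (tableauProd Y (r + 1)).mulVec c =
      (rowFactor Y (r + 1)).mulVec ((tableauProd Y r).mulVec c) := by
  rw [tableauProd, Matrix.mulVec_mulVec]

theorem tableauProd_mulVec_eq_zero {n k : ℕ} (Y : RatRect n k) (hk : k ≤ n) {c : Fin n → ℂ}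
    (hc : ∀ p : Fin n, n - k ≤ p → c p = 0) (r : ℕ) (p : Fin n) (hp : n - k + r ≤ p) :
    (tableauProd Y r).mulVec c p = 0 := by
  induction r generalizing p with
  | zero => simpa [tableauProd] using hc p (by omega)
  | succ r ih =>
    rw [tableauProd_succ_mulVec, rowFactor_mulVec_of_not _ _ (by omega)]
    exact ih p (by omega)

/-- Vanishing on the top `q` and the bottom entries propagates down the product. -/
theorem tableauProd_mulVec_vanish {n k : ℕ} (Y : RatRect n k) (hk : k ≤ n) {c : Fin n → ℂ}
    (hc : ∀ p : Fin n, n - k ≤ p → c p = 0) (q : ℕ) (hq : q ≤ n - k) (r : ℕ) (hr : r ≤ k)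
    (h : ∀ p : Fin n, ((p : ℕ) < q ∨ q + r ≤ p) → (tableauProd Y r).mulVec c p = 0) : c = 0 := by
  induction r with
  | zero =>
    ext p
    simpa [tableauProd] using h p (by omega)
  | succ r ih =>
    rw [tableauProd_succ_mulVec] at h
    set G := (tableauProd Y r).mulVec c with hG
    apply ih (by omega)
    -- The top zeros are recovered downwards by forward substitution in the bidiagonal factor; the
    -- bottom zeros (`h2` below) upwards, through its subdiagonal ones.
    have h1 : ∀ a : ℕ, ∀ p : Fin n, (p : ℕ) = a → a < q → G p = 0 := by
      intro a
      induction a with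
      | zero =>
        intro p hp ha
        have h2 := h p (by omega)
        by_cases hr0 : r = 0
        · rw [rowFactor_mulVec_of_eq _ _ hk (by omega)] at h2
          exact (mul_eq_zero.1 h2).resolve_left (Y.ratio_ne_zero _ _)
        · rwa [rowFactor_mulVec_of_not _ _ (by omega)] at h2
      | succ a iha =>
        intro p hp ha
        have h2 := h p (by omega)
        rcases lt_trichotomy (a + 1) r with h3 | h3 | h3
        · rwa [rowFactor_mulVec_of_not _ _ (by omega)] at h2
        · rw [rowFactor_mulVec_of_eq _ _ hk (by omega)] at h2
          exact (mul_eq_zero.1 h2).resolve_left (Y.ratio_ne_zero _ _)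
        · have hpn := p.2
          rw [rowFactor_mulVec_of_lt _ _ (q := ⟨a, by omega⟩) hp (by omega) (by omega),
            iha ⟨a, by omega⟩ rfl (by omega), add_zero] at h2
          exact (mul_eq_zero.1 h2).resolve_left (Y.ratio_ne_zero _ _)
    have h2 : ∀ d : ℕ, ∀ p : Fin n, n - k + r ≤ p + d → q + r ≤ p → G p = 0 := by
      intro d
      induction d with
      | zero => exact fun p hp _ => tableauProd_mulVec_eq_zero Y hk hc r p (by omega)
      | succ d ihd =>
        intro p hp hqp
        by_cases hpd : n - k + r ≤ p
        · exact tableauProd_mulVec_eq_zero Y hk hc r p hpd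
        have h3 := h ⟨p + 1, by omega⟩ (by simp only; omega)
        rw [rowFactor_mulVec_of_lt _ _ (q := p) rfl (by simp only; omega) (by simp only; omega),
          ihd ⟨p + 1, by omega⟩ (by simp only; omega) (by simp only; omega), mul_zero,
          zero_add] at h3
        exact h3
    rintro p (hp | hp)
    · exact h1 p p rfl hp
    · exact h2 (n - k + r) p (by omega) hp

/-- Vanishing on the window `[a, a + n - k - 1]` propagates down to the `a`-th product. -/
theorem tableauProd_mulVec_vanish_window {n k : ℕ} (Y : RatRect n k) (hk : k ≤ n) {c : Fin n → ℂ}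
    (a : ℕ) (d : ℕ)
    (h : ∀ p : Fin n, a ≤ (p : ℕ) → (p : ℕ) < a + (n - k) →
      (tableauProd Y (a + d)).mulVec c p = 0) (p : Fin n) (hp : a ≤ (p : ℕ))
    (hp' : (p : ℕ) < a + (n - k)) : (tableauProd Y a).mulVec c p = 0 := by
  induction d with
  | zero => exact h p hp hp'
  | succ d ih =>
    rw [← add_assoc, tableauProd_succ_mulVec] at h
    apply ih
    set G := (tableauProd Y (a + d)).mulVec c with hG
    have key : ∀ b : ℕ, ∀ p : Fin n, (p : ℕ) = a + b → b < n - k → G p = 0 := by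
      intro b
      induction b with
      | zero =>
        intro p hp hb
        have h2 := h p (by omega) (by omega)
        by_cases hd : d = 0
        · rw [rowFactor_mulVec_of_eq _ _ hk (by omega)] at h2
          exact (mul_eq_zero.1 h2).resolve_left (Y.ratio_ne_zero _ _)
        · rwa [rowFactor_mulVec_of_not _ _ (by omega)] at h2
      | succ b ihb =>
        intro p hp hb
        have h2 := h p (by omega) (by omega)
        rcases lt_trichotomy (b + 1) d with h3 | h3 | h3
        · rwa [rowFactor_mulVec_of_not _ _ (by omega)] at h2
        · rw [rowFactor_mulVec_of_eq _ _ hk (by omega)] at h2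
          exact (mul_eq_zero.1 h2).resolve_left (Y.ratio_ne_zero _ _)
        · have hpn := p.2
          rw [rowFactor_mulVec_of_lt _ _ (q := ⟨a + b, by omega⟩) hp (by omega) (by omega),
            ihb ⟨a + b, by omega⟩ rfl (by omega), add_zero] at h2
          exact (mul_eq_zero.1 h2).resolve_left (Y.ratio_ne_zero _ _)
    intro p hp hp'
    exact key (p - a) p (by omega) (by omega)

/-- The cyclic Plücker coordinates do not vanish on the image of `Θ`. -/
theorem gDefined_Theta {n k : ℕ} (hk : k ≤ n) (Y : RatRect n k) : GDefined (Theta Y) := by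
  rw [gDefined_iff (Nat.sub_le n k)]
  intro q f hf h
  obtain ⟨c, hc, rfl⟩ := (mem_firstColSpan _ _).1 hf
  have hq := q.2
  suffices c = 0 by rw [this, Matrix.mulVec_zero]
  unfold tableauMatrix at h
  simp only [CycBefore, Fin.lt_def, Fin.le_def] at h
  by_cases hqm : (q : ℕ) < n - k
  · refine tableauProd_mulVec_vanish Y hk hc q (by omega) k le_rfl fun p hp => h p ?_
    have := p.2
    omega
  · have hw := tableauProd_mulVec_vanish_window Y hk (c := c) (q - (n - k)) (k - (q - (n - k)))
      (by
        rw [Nat.add_sub_cancel' (by omega)]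
        intro p hp hp'
        exact h p (by omega))
    refine tableauProd_mulVec_vanish Y hk hc 0 (by omega) (q - (n - k)) (by omega) fun p hp => ?_
    by_cases hp' : (p : ℕ) < q - (n - k) + (n - k)
    · exact hw p (by omega) hp'
    · exact tableauProd_mulVec_eq_zero Y hk hc _ p (by omega)

theorem RatRect.coord_pred {n k : ℕ} (Y : RatRect n k) (hk : 1 ≤ k) (hkn : k < n) :
    Y.coord k (k - 1) = 1 := by
  unfold RatRect.coord
  rw [dif_neg (by omega), if_neg (by omega)]

theorem RatRect.coord_last {n k : ℕ} (Y : RatRect n k) : Y.coord k n = Y.t := by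
  unfold RatRect.coord
  rw [dif_neg (by omega), if_pos (by omega)]

/-- The last row of the rectangle gives a linear relation between the last entries of the
elements of `N`. -/
theorem sum_coord_mul_eq_zero {n k : ℕ} (hk : 1 ≤ k) (hkn : k < n) (Y : RatRect n k)
    {f : Fin n → ℂ} (hf : f ∈ (Theta Y).1.1) (g : ℕ → ℂ) (hg : ∀ p : Fin n, g p = f p) :
    ∑ s ∈ Finset.range (n - k + 1), (-1) ^ s * Y.coord k (k + s - 1) * g (k - 1 + s) = 0 := by
  obtain ⟨c, hc, rfl⟩ := (mem_firstColSpan _ _).1 hf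
  obtain ⟨k', rfl⟩ : ∃ k', k = k' + 1 := ⟨k - 1, by omega⟩
  unfold tableauMatrix at hg
  simp only [tableauProd_succ_mulVec] at hg
  set G := (tableauProd Y k').mulVec c with hG
  -- The sum telescopes: each partial sum is a single term in G, the product with the last factor
  -- removed, and G vanishes at the final position.
  have key : ∀ S, ∀ hS : S ≤ n - (k' + 1),
      ∑ s ∈ Finset.range (S + 1), (-1) ^ s * Y.coord (k' + 1) (k' + 1 + s - 1) * g (k' + s) =
        (-1) ^ S * Y.coord (k' + 1) (k' + 1 + S) * G ⟨k' + S, by omega⟩ := by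
    intro S
    induction S with
    | zero =>
      intro _
      have h1 := hg ⟨k', by omega⟩
      rw [rowFactor_mulVec_of_eq (i := k' + 1) _ _ hkn.le rfl] at h1
      have h2 := Y.coord_pred hk hkn
      rw [Nat.add_sub_cancel] at h2
      simp only at h1
      simp [h1, RatRect.ratio, h2]
    | succ S ih =>
      intro hS
      rw [Finset.sum_range_succ, ih (by omega)]
      have h1 := hg ⟨k' + (S + 1), by omega⟩
      rw [rowFactor_mulVec_of_lt _ _ (q := ⟨k' + S, by omega⟩) rfl (by simp only; omega)
        (by simp only; omega)] at h1
      simp only at h1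
      have h2 := Y.coord_ne_zero (k' + 1) (k' + 1 + S)
      rw [h1, RatRect.ratio, show k' + (S + 1) + 1 = k' + 1 + (S + 1) by omega,
        show k' + 1 + (S + 1) - 1 = k' + 1 + S by omega]
      field_simp
      ring
  rw [Nat.add_sub_cancel, key _ le_rfl]
  have := tableauProd_mulVec_eq_zero Y hkn.le hc k' ⟨k' + (n - (k' + 1)), by omega⟩
    (by simp only; omega)
  rw [← hG] at this
  rw [this, mul_zero]

/-! ### The one-row case -/

theorem rowVar_succ {n : ℕ} (X : RatRect n 1) (p : Fin n) :
    rowVar X ((p : ℤ) + 1) = X.ratio 1 (p + 1) := by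
  unfold rowVar
  have : (((p : ℤ) + 1 - 1) % n).toNat = p := by
    rw [add_sub_cancel_right, Int.emod_eq_of_lt (by omega) (by have := p.2; omega)]; simp
  rw [this]

theorem sum_coord_one_mul_eq_zero {n : ℕ} (hn : 1 < n) (X : RatRect n 1) {f : Fin n → ℂ}
    (hf : f ∈ (Theta X).1.1) : ∑ p : Fin n, (-1) ^ (p : ℕ) * X.coord 1 p * f p = 0 := by
  have h := sum_coord_mul_eq_zero le_rfl hn X hf
    (fun i => if h : i < n then f ⟨i, h⟩ else 0) (fun p => by simp)
  rw [show n - 1 + 1 = n by omega, Finset.sum_range] at h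
  rw [← h]
  refine Finset.sum_congr rfl fun p _ => ?_
  simp

/-- With m = n - 1 a distinguished column has only two possibly nonzero entries, at q and cyclically
next to it. The single linear equation of the hyperplane determines the one at q. -/
theorem gMatrix_Theta_one {n : ℕ} (hn : 1 < n) (X : RatRect n 1) (p q : Fin n) :
    gMatrix (Theta X) p q = if p = q then C (X.ratio 1 (p + 1)) else
      if (p : ℕ) = q + 1 then 1 else if (p : ℕ) + n = q + 1 then Polynomial.X else 0 := by
  have hg := gDefined_Theta hn.le X
  obtain ⟨f, hf⟩ := exists_isCol (by omega) (Nat.sub_le n 1) hg q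
  rw [gMatrix_apply (by omega) (by omega) hg hf]
  have hp := p.2
  have hq := q.2
  have hrel := sum_coord_one_mul_eq_zero hn X hf.mem
  have hX0 : X.coord 1 0 = 1 := X.coord_pred le_rfl hn
  set q1 : Fin n := ⟨if (q : ℕ) + 1 < n then q + 1 else 0, by split_ifs <;> omega⟩ with hq1
  have hq1v : (q1 : ℕ) = if (q : ℕ) + 1 < n then (q : ℕ) + 1 else 0 := rfl
  have hne : q ≠ q1 := by
    intro h
    have : (q : ℕ) = q1 := congrArg _ h
    rw [hq1v] at this
    split_ifs at this <;> omega
  have hf1 : f q1 = 1 := hf.eq_one q1 (by rw [hq1v]; split_ifs <;> omega)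
  have hf0 : ∀ r, r ≠ q → r ≠ q1 → f r = 0 := by
    intro r h1 h2
    apply hf.eq_zero
    have h1' : (r : ℕ) ≠ q := fun h => h1 (Fin.ext h)
    have h2' : (r : ℕ) ≠ q1 := fun h => h2 (Fin.ext h)
    rw [hq1v] at h2'
    have := r.2
    simp only [CycBefore, Fin.lt_def, Fin.le_def]
    split_ifs at h2' <;> omega
  rw [Fintype.sum_eq_add q q1 hne (fun r hr => by rw [hf0 r hr.1 hr.2, mul_zero]), hf1] at hrel
  have hc := X.coord_ne_zero 1 q
  have h11 : ((-1 : ℂ) ^ (q : ℕ)) * (-1) ^ (q : ℕ) = 1 := neg_one_pow_mul_self _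
  by_cases hqn : (q : ℕ) + 1 < n
  · rw [if_pos (by omega)]
    rw [if_pos hqn] at hq1v
    have hfq : f q = X.ratio 1 (q + 1) := by
      rw [RatRect.ratio, eq_div_iff (by simpa using hc)]
      rw [hq1v, pow_succ] at hrel
      simp only [Nat.add_sub_cancel]
      linear_combination (-1) ^ (q : ℕ) * hrel + (X.coord 1 (q + 1) - f q * X.coord 1 q) * h11
    by_cases h1 : p = q
    · rw [h1, hfq]; simp
    · rw [if_neg h1]
      by_cases h2 : (p : ℕ) = q + 1
      · have : p = q1 := Fin.ext (by rw [hq1v, h2])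
        rw [if_pos h2, this, hf1]; simp
      · rw [if_neg h2, if_neg (by omega), hf0 p h1 (fun h => h2 (by rw [h, hq1v]))]; simp
  · rw [if_neg (by omega)]
    rw [if_neg hqn] at hq1v
    have hqv : (q : ℕ) = n - 1 := by omega
    by_cases h1 : p = q
    · subst h1
      rw [if_pos le_rfl, if_pos rfl, ← C_mul]
      congr 1
      rw [RatRect.ratio, show (p : ℕ) + 1 = n by omega, X.coord_last]
      have hpow : (-1 : ℂ) ^ (n - 1 + 1) = (-1) ^ ((p : ℕ) + 1) := by rw [hqv]
      have hcoord : X.coord 1 (n - 1) = X.coord 1 p := by rw [hqv]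
      rw [hpow, hcoord, eq_div_iff hc]
      rw [hq1v, hX0] at hrel
      change (-1) ^ ((p : ℕ) + 1) * (X.t : ℂ) * f p * X.coord 1 p = _
      rw [pow_succ]
      linear_combination -(X.t : ℂ) * hrel
    · rw [if_neg h1]
      have hpq : ¬ q ≤ p := by
        have : (p : ℕ) ≠ q := fun h => h1 (Fin.ext h)
        simp only [Fin.le_def]; omega
      rw [if_neg hpq, if_neg (by omega)]
      by_cases h2 : (p : ℕ) + n = q + 1
      · have : p = q1 := Fin.ext (by rw [hq1v]; omega)
        rw [if_pos h2, this, hf1]; simp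
      · rw [if_neg h2, hf0 p h1 (fun h => h2 (by rw [h, hq1v]; omega))]; simp

/-! ### Quasi-periodic extensions -/

/-- The extension of `F` to `ℕ` with `F (i + n) = z⁻¹ F i`. -/
def quasi {n : ℕ} (hn : 0 < n) (z : ℂ) {E : Type*} [AddCommGroup E] [Module ℂ E] (F : Fin n → E)
    (i : ℕ) : E :=
  z⁻¹ ^ (i / n) • F ⟨i % n, Nat.mod_lt _ hn⟩

theorem quasi_coe {n : ℕ} (hn : 0 < n) (z : ℂ) {E : Type*} [AddCommGroup E] [Module ℂ E]
    (F : Fin n → E) (p : Fin n) : quasi hn z F p = F p := by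
  unfold quasi
  simp [Nat.div_eq_of_lt p.2, Nat.mod_eq_of_lt p.2]

theorem quasi_eq_smul {n : ℕ} (hn : 0 < n) {z : ℂ} (hz : z ≠ 0) {E : Type*} [AddCommGroup E]
    [Module ℂ E] (F : Fin n → E) (i : ℕ) : quasi hn z F i = z • quasi hn z F (i + n) := by
  unfold quasi
  simp only [Nat.add_mod_right]
  rw [Nat.add_div_right _ hn, smul_smul, pow_succ, mul_comm, mul_assoc, inv_mul_cancel₀ hz, mul_one]

/-- The corner entry z of a cyclic bidiagonal matrix is absorbed by the quasi-periodicity: on the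
extension the matrix acts by one recursion, without a boundary case. -/
theorem quasi_succ {n : ℕ} (hn : 0 < n) {z : ℂ} (hz : z ≠ 0) {E : Type*} [AddCommGroup E]
    [Module ℂ E] (F G : Fin n → E) (x : Fin n → ℂ)
    (h1 : ∀ p q : Fin n, (p : ℕ) = q + 1 → G p = x p • F p + F q)
    (h0 : ∀ p q : Fin n, (p : ℕ) + n = q + 1 → G p = x p • F p + z • F q) (i : ℕ) :
    quasi hn z G (i + 1) =
      x ⟨(i + 1) % n, Nat.mod_lt _ hn⟩ • quasi hn z F (i + 1) + quasi hn z F i := by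
  have hi : i = i % n + n * (i / n) := (Nat.mod_add_div i n).symm
  have hr := Nat.mod_lt i hn
  unfold quasi
  by_cases h : i % n + 1 < n
  · have hmod : (i + 1) % n = i % n + 1 := by
      rw [Nat.add_mod, Nat.mod_eq_of_lt (a := 1) (by omega), Nat.mod_eq_of_lt h]
    have hdiv : (i + 1) / n = i / n := by
      conv_lhs => rw [hi, show i % n + n * (i / n) + 1 = i % n + 1 + n * (i / n) by ring]
      rw [Nat.add_mul_div_left _ _ hn, Nat.div_eq_of_lt h, zero_add]
    simp only [hdiv]
    rw [h1 _ ⟨i % n, hr⟩ hmod, smul_add, smul_comm]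
  · have hmod : (i + 1) % n = 0 := by
      conv_lhs => rw [hi, show i % n + n * (i / n) + 1 = i % n + 1 + n * (i / n) by ring]
      rw [Nat.add_mul_mod_self_left, show i % n + 1 = n by omega, Nat.mod_self]
    have hdiv : (i + 1) / n = i / n + 1 := by
      conv_lhs => rw [hi, show i % n + n * (i / n) + 1 = i % n + 1 + n * (i / n) by ring]
      rw [Nat.add_mul_div_left _ _ hn, show i % n + 1 = n by omega, Nat.div_self hn, add_comm]
    simp only [hdiv]
    rw [h0 _ ⟨i % n, hr⟩ (by simp only [hmod]; omega), smul_add, smul_comm]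
    congr 1
    rw [smul_smul, pow_succ, mul_assoc, inv_mul_cancel₀ hz, mul_one]

theorem evalAt_gMatrix_Theta_one_mulVec {n : ℕ} (hn : 1 < n) (X : RatRect n 1) (z : ℂ)
    (v : Fin n → ℂ) (p q : Fin n) :
    ((p : ℕ) = q + 1 → (evalAt (gMatrix (Theta X)) z).mulVec v p =
      X.ratio 1 (p + 1) * v p + v q) ∧
    ((p : ℕ) + n = q + 1 → (evalAt (gMatrix (Theta X)) z).mulVec v p =
      X.ratio 1 (p + 1) * v p + z * v q) := by
  have hentry : ∀ p q, evalAt (gMatrix (Theta X)) z p q = if p = q then X.ratio 1 (p + 1) else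
      if (p : ℕ) = q + 1 then 1 else if (p : ℕ) + n = q + 1 then z else 0 := by
    intro p q
    unfold evalAt
    rw [Matrix.map_apply, gMatrix_Theta_one hn]
    split_ifs <;> simp
  have hp := p.2
  have hq := q.2
  constructor
  · intro h
    have hne : p ≠ q := fun h' => by have := congrArg Fin.val h'; omega
    simp only [Matrix.mulVec, dotProduct]
    rw [Fintype.sum_eq_add p q hne]
    · rw [hentry, hentry, if_pos rfl, if_neg hne, if_pos h, one_mul]
    · intro r hr
      have h1 : (q : ℕ) ≠ r := fun h' => hr.2 (Fin.ext h'.symm)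
      rw [hentry, if_neg (Ne.symm hr.1), if_neg (by omega), if_neg (by omega), zero_mul]
  · intro h
    have hne : p ≠ q := fun h' => by have := congrArg Fin.val h'; omega
    simp only [Matrix.mulVec, dotProduct]
    rw [Fintype.sum_eq_add p q hne]
    · rw [hentry, hentry, if_pos rfl, if_neg hne, if_neg (by omega), if_pos h]
    · intro r hr
      have h1 : (q : ℕ) ≠ r := fun h' => hr.2 (Fin.ext h'.symm)
      rw [hentry, if_neg (Ne.symm hr.1), if_neg (by omega), if_neg (by omega), zero_mul]

/-! ### The minors `κ_j` -/

theorem mem_residues_of_image {n m : ℕ} {I : Finset ℤ} {σ : Fin m → ℕ}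
    (hI : ∀ a : ℤ, a ∈ I ↔ ∃ i, a = (σ i : ℤ) + 1) (p : Fin n) :
    p ∈ residues n I ↔ ∃ i, σ i % n = p := by
  rw [mem_residues]
  have key : ∀ i, ((σ i : ℤ) + 1 ≡ (p : ℤ) + 1 [ZMOD n]) ↔ σ i % n = p := by
    intro i
    constructor
    · intro h
      have h1 : (σ i : ℤ) ≡ p [ZMOD n] := Int.ModEq.add_right_cancel' 1 h
      have h2 : σ i ≡ p [MOD n] := Int.natCast_modEq_iff.1 h1
      rw [h2, Nat.mod_eq_of_lt p.2]
    · intro h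
      have h2 : σ i ≡ p [MOD n] := by rw [Nat.ModEq, h, Nat.mod_eq_of_lt p.2]
      exact (Int.natCast_modEq_iff.2 h2).add_right 1
  constructor
  · rintro ⟨a, ha, h⟩
    obtain ⟨i, rfl⟩ := (hI a).1 ha
    exact ⟨i, (key i).1 h⟩
  · rintro ⟨i, hi⟩
    exact ⟨_, (hI _).2 ⟨i, rfl⟩, (key i).2 hi⟩

theorem minor_Icc_eq_maxMinor {n m : ℕ} (hm : m ≤ n) (A : Matrix (Fin n) (Fin n) ℂ)
    (I : Finset ℤ) :
    minor A I (Finset.Icc 1 (m : ℤ)) = maxMinor (A.submatrix id (Fin.castLE hm)) I := by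
  have hJ : ∀ p : Fin n, p ∈ residues n (Finset.Icc 1 (m : ℤ)) ↔ ∃ i, Fin.castLE hm i = p := by
    intro p
    rw [mem_residues_of_image (σ := fun i : Fin m => (i : ℕ))]
    · refine exists_congr fun i => ?_
      rw [Nat.mod_eq_of_lt (by omega), Fin.ext_iff, Fin.val_castLE]
    · intro a
      rw [Finset.mem_Icc]
      constructor
      · intro h
        exact ⟨⟨(a - 1).toNat, by omega⟩, by simp only; omega⟩
      · rintro ⟨i, rfl⟩
        have := i.2
        omega
  have hr : residues n (Finset.Icc 1 (m : ℤ)) = Finset.univ.image (Fin.castLE hm) := by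
    ext p; simp [hJ]
  have hc : (residues n (Finset.Icc 1 (m : ℤ))).card = m := by
    rw [hr, Finset.card_image_of_injective _ (Fin.castLE_injective hm)]; simp
  unfold minor maxMinor
  by_cases h : (residues n I).card = m
  · rw [dif_pos (h.trans hc.symm), dif_pos h]
    subst h
    rw [← Finset.orderEmbOfFin_unique hc (f := Fin.castLE hm) (fun i => (hJ _).2 ⟨i, rfl⟩)
      (Fin.strictMono_castLE hm)]
    rfl
  · rw [dif_neg (by rw [hc]; exact h), dif_neg h]

/-- The first `n - k` columns of `g(N|t)`. -/
def colMatrix {n k : ℕ} (f : Fin n → Fin n → ℂ) : Matrix (Fin n) (Fin (n - k)) ℂ :=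
  Matrix.of fun p q => f (Fin.castLE (Nat.sub_le n k) q) p

theorem exists_maxMinor_colMatrix {n k : ℕ} (hk : 1 ≤ k) (hkn : k < n) (Y : RatRect n k)
    {f : Fin n → Fin n → ℂ} (hf : ∀ q, IsCol (Theta Y).1.1 (n - k) q (f q)) :
    ∃ c : ℂ, c ≠ 0 ∧
      ∀ I, maxMinor (colMatrix (k := k) f) I = c * plucker (Theta Y).1 I := by
  refine plucker_eq_smul _ _ (le_antisymm ?_ ?_)
  · rw [Submodule.span_le]
    rintro _ ⟨j, rfl⟩
    exact (hf _).mem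
  · refine le_of_isCol_mem (by omega) (gDefined_Theta hkn.le Y) hf ⟨n - 1, by omega⟩ _ fun b hb => ?_
    have hb2 := b.2
    simp only [Fin.lt_def, Fin.le_def] at hb
    exact Submodule.subset_span ⟨⟨b, by omega⟩, rfl⟩

theorem maxMinor_colMatrix_last {n k : ℕ} (hk : 1 ≤ k) (hkn : k < n) (Y : RatRect n k)
    {f : Fin n → Fin n → ℂ} (hf : ∀ q, IsCol (Theta Y).1.1 (n - k) q (f q)) :
    maxMinor (colMatrix (k := k) f) (Finset.Icc ((k : ℤ) + 1) n) = 1 := by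
  rw [maxMinor_eq_of_strictMono _ _ (fun i : Fin (n - k) => (⟨k + i, by omega⟩ : Fin n))]
  · rw [Matrix.det_of_isUpperTriangular]
    · refine Finset.prod_eq_one fun i _ => ?_
      simp only [colMatrix, Matrix.submatrix_apply, Matrix.of_apply, id]
      exact (hf _).eq_one _ (by simp only [Fin.val_castLE]; omega)
    · intro i j hij
      have hij' : (j : ℕ) < i := hij
      simp only [colMatrix, Matrix.submatrix_apply, Matrix.of_apply, id]
      refine (hf _).eq_zero _ ?_
      simp only [CycBefore, Fin.lt_def, Fin.le_def, Fin.val_castLE]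
      omega
  · intro i j hij
    have : (i : ℕ) < j := hij
    simp only [Fin.lt_def]; omega
  · intro p
    rw [mem_residues_of_image (σ := fun i : Fin (n - k) => k + i)]
    · refine exists_congr fun i => ?_
      rw [Nat.mod_eq_of_lt (by omega), Fin.ext_iff]
    · intro a
      rw [Finset.mem_Icc]
      constructor
      · intro h
        exact ⟨⟨(a - 1 - k).toNat, by omega⟩, by simp only; omega⟩
      · rintro ⟨i, rfl⟩
        have := i.2
        push_cast
        omega

/-- The first n - k columns of g carry coefficient 1, and their minor in the last n - k rows is 1 by
unitriangularity, so the normalisation in `tau` reduces to a quotient of two minors in the same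
rows. -/
theorem tau_eq {n k : ℕ} (hk : 1 ≤ k) (hkn : k < n) (X : RatRect n 1) (Y : RatRect n k)
    {f : Fin n → Fin n → ℂ} (hf : ∀ q, IsCol (Theta Y).1.1 (n - k) q (f q)) (I : Finset ℤ) :
    tau X Y I = maxMinor (evalAt (gMatrix (Theta X)) ((-1) ^ (n - k + 1) * (Y.t : ℂ)) *
      colMatrix (k := k) f) I / maxMinor (colMatrix (k := k) f) I := by
  obtain ⟨c, hc, hcI⟩ := exists_maxMinor_colMatrix hk hkn Y hf
  have h1 := maxMinor_colMatrix_last hk hkn Y hf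
  unfold tau
  have h2 : plucker (Theta Y).1 (Finset.Icc ((k : ℤ) + 1) n) / plucker (Theta Y).1 I =
      1 / maxMinor (colMatrix (k := k) f) I := by
    rw [← h1, hcI, hcI, mul_div_mul_left _ _ hc]
  rw [h2, mul_one_div, show (n : ℤ) - k = (n - k : ℕ) by omega,
    minor_Icc_eq_maxMinor (Nat.sub_le n k)]
  congr 2
  unfold productAt
  rw [evalAt_mul]
  ext p q
  simp only [Matrix.submatrix_apply, Matrix.mul_apply, id]
  refine Finset.sum_congr rfl fun r _ => ?_
  rw [evalAt_gMatrix_apply (m := n - k) (by omega) (by omega) (gDefined_Theta hkn.le Y) (hf _),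
    if_pos (by simp), one_mul]
  rfl

/-- The minor of the rows `b, …, b + m` without the row `b + p`. -/
def windowDet {m : ℕ} (V : ℕ → Fin m → ℂ) (b : ℕ) (p : Fin (m + 1)) : ℂ :=
  (Matrix.of fun i : Fin m => V (b + p.succAbove i)).det

theorem maxMinor_window {n m : ℕ} (hn : 0 < n) (hmn : m < n) (F : Matrix (Fin n) (Fin m) ℂ)
    (t : ℂ) (ht : t ≠ 0) (b : ℕ) (p : Fin (m + 1)) (I : Finset ℤ)
    (hI : ∀ a : ℤ, a ∈ I ↔ ((b : ℤ) + 1 ≤ a ∧ a ≤ b + m + 1) ∧ a ≠ b + p + 1) :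
    maxMinor F I = (∏ i : Fin m, t ^ ((b + p.succAbove i) / n)) *
      windowDet (quasi hn ((-1) ^ (m + 1) * t) F) b p := by
  have hne : (-1) ^ (m + 1) * t ≠ 0 := mul_ne_zero (pow_ne_zero _ (by norm_num)) ht
  refine maxMinor_eq_of_quasiPeriodic F t (quasi hn ((-1) ^ (m + 1) * t) F)
    (fun i => quasi_coe hn _ F i) (fun i => quasi_eq_smul hn hne F i) I
    (fun i => b + p.succAbove i) ?_ ?_ ?_
  · intro i j hij
    have : p.succAbove i < p.succAbove j := Fin.strictMono_succAbove p hij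
    exact Nat.add_lt_add_left this b
  · intro i j
    have := (p.succAbove i).2
    omega
  · intro r
    refine mem_residues_of_image (fun a => ?_) r
    rw [hI]
    constructor
    · rintro ⟨h1, h2⟩
      have h3 : (⟨(a - 1 - b).toNat, by omega⟩ : Fin (m + 1)) ≠ p := by
        intro h
        have := congrArg Fin.val h
        simp only at this
        omega
      obtain ⟨i, hi⟩ := Fin.exists_succAbove_eq h3
      refine ⟨i, ?_⟩
      rw [hi]
      push_cast
      omega
    · rintro ⟨i, rfl⟩
      have h1 := (p.succAbove i).2
      have h2 : ((p.succAbove i : Fin (m + 1)) : ℕ) ≠ p := fun h =>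
        Fin.succAbove_ne p i (Fin.ext h)
      push_cast
      omega

/-- Modulo n this is one of the cyclic intervals in the definition of `GDefined`; the proof shifts j
into [1, n]. -/
theorem plucker_window_ne_zero {n k : ℕ} (hkn : k < n) (Y : RatRect n k) (j : ℤ) :
    plucker (Theta Y).1 (Finset.Icc (j + k) (j + n - 1)) ≠ 0 := by
  have hn : (0 : ℤ) < n := by omega
  have h0 := Int.emod_nonneg (j - 1) hn.ne'
  have h1 := Int.emod_lt_of_pos (j - 1) hn
  have hg := gDefined_Theta hkn.le Y ((j - 1) % n + 1) (by simp only [Finset.mem_Icc]; omega)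
  unfold plucker at hg ⊢
  rwa [maxMinor_congr]
  ext p
  have hdiv := Int.emod_add_mul_ediv (j - 1) n
  set e := (j - 1) / (n : ℤ)
  set r := (j - 1) % (n : ℤ)
  have hring : (n : ℤ) * (e + 1) = n * e + n := by ring
  simp only [mem_residues, Finset.mem_Icc]
  constructor
  · rintro ⟨a, ha, h⟩
    refine ⟨a - n * (e + 1), by push_cast [hkn.le]; omega, ?_⟩
    exact (Int.modEq_iff_dvd.2 ⟨e + 1, by ring⟩).trans h
  · rintro ⟨a, ha, h⟩
    push_cast [hkn.le] at ha
    refine ⟨a + n * (e + 1), by omega, ?_⟩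
    exact (Int.modEq_iff_dvd.2 ⟨-(e + 1), by ring⟩).trans h

theorem rowVar_natCast_succ {n : ℕ} (X : RatRect n 1) (i : ℕ) :
    rowVar X ((i : ℤ) + 1) = X.ratio 1 (i % n + 1) := by
  unfold rowVar
  have : (((i : ℤ) + 1 - 1) % n).toNat = i % n := by
    rw [add_sub_cancel_right, ← Int.natCast_mod, Int.toNat_natCast]
  rw [this]

/-- Numerator and denominator use the same rows, so their powers of t cancel. The rows of W F in the
window are x V_{i+1} + V_i, and `det_add_smul_succ` expands their determinant. -/
theorem kappa_eq_sum_windowDet {n k : ℕ} (hk : 1 ≤ k) (hkn : k < n) (hn : 0 < n)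
    (X : RatRect n 1) (Y : RatRect n k)
    {f : Fin n → Fin n → ℂ} (hf : ∀ q, IsCol (Theta Y).1.1 (n - k) q (f q)) (j : ℤ) (b : ℕ)
    (hjb : j + k = b + 2) :
    windowDet (quasi hn ((-1) ^ (n - k + 1) * (Y.t : ℂ)) (colMatrix (k := k) f)) b 0 ≠ 0 ∧
    kappa X Y j = ∑ p : Fin (n - k + 1),
      (∏ i ∈ Finset.Ico (p : ℕ) (n - k), rowVar X ((b : ℤ) + 2 + i)) *
        (windowDet (quasi hn ((-1) ^ (n - k + 1) * (Y.t : ℂ)) (colMatrix (k := k) f)) b p /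
          windowDet (quasi hn ((-1) ^ (n - k + 1) * (Y.t : ℂ)) (colMatrix (k := k) f)) b 0) := by
  set z : ℂ := (-1) ^ (n - k + 1) * (Y.t : ℂ) with hz
  have hz0 : z ≠ 0 := coeff_ne_zero _
  set F : Matrix (Fin n) (Fin (n - k)) ℂ := colMatrix (k := k) f with hF
  set W := evalAt (gMatrix (Theta X)) z with hW
  have hI : ∀ a : ℤ, a ∈ Finset.Icc (j + k) (j + n - 1) ↔
      ((b : ℤ) + 1 ≤ a ∧ a ≤ b + (n - k : ℕ) + 1) ∧ a ≠ b + ((0 : Fin (n - k + 1)) : ℕ) + 1 := by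
    intro a
    simp only [Finset.mem_Icc, Fin.val_zero]
    omega
  have h1 := maxMinor_window hn (by omega : n - k < n) F Y.t Y.t.ne_zero b 0 _ hI
  have h2 := maxMinor_window hn (by omega : n - k < n) (W * F) Y.t Y.t.ne_zero b 0 _ hI
  rw [← hz] at h1 h2
  obtain ⟨c, hc, hcI⟩ := exists_maxMinor_colMatrix hk hkn Y hf
  have hne : maxMinor F (Finset.Icc (j + k) (j + n - 1)) ≠ 0 := by
    rw [hcI]; exact mul_ne_zero hc (plucker_window_ne_zero hkn Y j)
  rw [h1] at hne
  refine ⟨(mul_ne_zero_iff.1 hne).2, ?_⟩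
  unfold kappa
  rw [tau_eq hk hkn X Y hf, ← hF, ← hz, ← hW, h1, h2, mul_div_mul_left _ _ (mul_ne_zero_iff.1 hne).1]
  simp only [← mul_div_assoc]
  rw [← Finset.sum_div]
  congr 1
  have h3 := det_add_smul_succ (fun p : Fin (n - k + 1) => quasi hn z F (b + p))
    (fun i => rowVar X ((b : ℤ) + 2 + i))
  rw [← Finset.sum_congr rfl fun p _ => rfl] at h3
  refine Eq.trans ?_ h3
  unfold windowDet
  congr 2
  funext i
  have hrow : ∀ p q : Fin n, ((p : ℕ) = q + 1 → (W * F) p = X.ratio 1 (p + 1) • F p + F q) ∧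
      ((p : ℕ) + n = q + 1 → (W * F) p = X.ratio 1 (p + 1) • F p + z • F q) := by
    intro p q
    have hmv : ∀ c, (W * F) p c = W.mulVec (fun r => F r c) p := fun c => rfl
    constructor
    · intro h
      funext c
      rw [hmv, (evalAt_gMatrix_Theta_one_mulVec (by omega) X z _ p q).1 h]
      rfl
    · intro h
      funext c
      rw [hmv, (evalAt_gMatrix_Theta_one_mulVec (by omega) X z _ p q).2 h]
      rfl
  have h4 := quasi_succ hn hz0 F (W * F) (fun p => X.ratio 1 (p + 1))
    (fun p q h => (hrow p q).1 h) (fun p q h => (hrow p q).2 h) (b + i)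
  simp only [Fin.zero_succAbove, Fin.val_succ, Fin.val_castSucc]
  rw [← add_assoc, h4, add_comm]
  congr 2
  rw [← rowVar_natCast_succ]
  congr 1
  push_cast
  ring

theorem div_of_lt_two_mul {n i : ℕ} (h : i < 2 * n) : i / n = if i < n then 0 else 1 := by
  split_ifs with h1
  · exact Nat.div_eq_of_lt h1
  · exact Nat.div_eq_of_lt_le (by omega) (by omega)

/-- Multiplying each minor by the power of t of its omitted row gives both the same total factor,
the product over all n-k+1 rows. What is left is the ratio of the powers of t of rows b + p and b:
an extra t exactly when row b + p has wrapped and row b has not. -/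
theorem windowDet_div {n k : ℕ} (hk : 1 ≤ k) (hkn : k < n) (hn : 0 < n) (Y : RatRect n k)
    {f : Fin n → Fin n → ℂ} (hf : ∀ q, IsCol (Theta Y).1.1 (n - k) q (f q)) (j : ℤ) (b : ℕ)
    (hjb : j + k = b + 2) (hb : b + (n - k) < 2 * n) (p : Fin (n - k + 1)) :
    windowDet (quasi hn ((-1) ^ (n - k + 1) * (Y.t : ℂ)) (colMatrix (k := k) f)) b p /
          windowDet (quasi hn ((-1) ^ (n - k + 1) * (Y.t : ℂ)) (colMatrix (k := k) f)) b 0 =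
      (Y.t : ℂ) ^ (if (n : ℤ) + 2 - (p : ℕ) ≤ j + k ∧ j + k ≤ n + 1 then 1 else 0) *
        (plucker (Theta Y).1 (Finset.Icc (j + k - 1) (j + n - 1) \ {j + k + (p : ℕ) - 1}) /
          plucker (Theta Y).1 (Finset.Icc (j + k) (j + n - 1))) := by
  set z : ℂ := (-1) ^ (n - k + 1) * (Y.t : ℂ) with hz
  set F : Matrix (Fin n) (Fin (n - k)) ℂ := colMatrix (k := k) f with hF
  have ht := Y.t.ne_zero
  have hp := p.2
  have hI0 : ∀ a : ℤ, a ∈ Finset.Icc (j + k) (j + n - 1) ↔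
      ((b : ℤ) + 1 ≤ a ∧ a ≤ b + (n - k : ℕ) + 1) ∧ a ≠ b + ((0 : Fin (n - k + 1)) : ℕ) + 1 := by
    intro a
    simp only [Finset.mem_Icc, Fin.val_zero]
    omega
  have hI : ∀ a : ℤ, a ∈ Finset.Icc (j + k - 1) (j + n - 1) \ {j + k + (p : ℕ) - 1} ↔
      ((b : ℤ) + 1 ≤ a ∧ a ≤ b + (n - k : ℕ) + 1) ∧ a ≠ b + (p : ℕ) + 1 := by
    intro a
    simp only [Finset.mem_Icc, Finset.mem_sdiff, Finset.mem_singleton]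
    omega
  have h1 := maxMinor_window hn (by omega : n - k < n) F Y.t ht b 0 _ hI0
  have h2 := maxMinor_window hn (by omega : n - k < n) F Y.t ht b p _ hI
  rw [← hz] at h1 h2
  obtain ⟨c, hc, hcI⟩ := exists_maxMinor_colMatrix hk hkn Y hf
  rw [← hF] at hcI
  have hP := plucker_window_ne_zero hkn Y j
  have hprod : ∀ p : Fin (n - k + 1), (Y.t : ℂ) ^ ((b + p) / n) *
      ∏ i : Fin (n - k), (Y.t : ℂ) ^ ((b + p.succAbove i) / n) =
      ∏ q : Fin (n - k + 1), (Y.t : ℂ) ^ ((b + q) / n) :=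
    fun p => (Fin.prod_univ_succAbove (fun q : Fin (n - k + 1) => (Y.t : ℂ) ^ ((b + q) / n)) p).symm
  have hT : ∏ q : Fin (n - k + 1), (Y.t : ℂ) ^ ((b + q) / n) ≠ 0 :=
    Finset.prod_ne_zero_iff.2 fun _ _ => pow_ne_zero _ ht
  have hA := hprod 0
  have hB := hprod p
  rw [hcI] at h1 h2
  set T := ∏ q : Fin (n - k + 1), (Y.t : ℂ) ^ ((b + q) / n)
  have h1' : T * windowDet (quasi hn z F) b 0 = (Y.t : ℂ) ^ ((b + (0 : Fin (n - k + 1))) / n) *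
      (c * plucker (Theta Y).1 (Finset.Icc (j + k) (j + n - 1))) := by
    rw [h1, ← hA]; ring
  have h2' : T * windowDet (quasi hn z F) b p = (Y.t : ℂ) ^ ((b + p) / n) *
      (c * plucker (Theta Y).1
        (Finset.Icc (j + k - 1) (j + n - 1) \ {j + k + (p : ℕ) - 1})) := by
    rw [h2, ← hB]; ring
  have hexp : (Y.t : ℂ) ^ ((b + p) / n) = (Y.t : ℂ) ^ ((b + (0 : Fin (n - k + 1))) / n) *
      (Y.t : ℂ) ^ (if (n : ℤ) + 2 - (p : ℕ) ≤ j + k ∧ j + k ≤ n + 1 then 1 else 0) := by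
    rw [← pow_add]
    congr 1
    rw [div_of_lt_two_mul (by omega), div_of_lt_two_mul (by rw [Fin.val_zero]; omega), Fin.val_zero]
    split_ifs <;> omega
  rw [hexp] at h2'
  have ht0 : (Y.t : ℂ) ^ ((b + (0 : Fin (n - k + 1))) / n) ≠ 0 := pow_ne_zero _ ht
  rw [← mul_div_mul_left _ _ hT, h1', h2', mul_assoc, mul_div_mul_left _ _ ht0,
    mul_left_comm, mul_div_mul_left _ _ hc, mul_div_assoc]

theorem kappa_formula {n k : ℕ} (hk : 1 ≤ k) (hkn : k < n) (X : RatRect n 1) (Y : RatRect n k)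
    (j : ℤ) (hj : j ∈ Finset.Icc (1 : ℤ) n) :
    kappa X Y j =
      ∑ s ∈ Finset.range (n - k + 1),
        (∏ i ∈ Finset.Icc (j + k + s) (j + n - 1), rowVar X i) *
          (Y.t : ℂ) ^ (if (n : ℤ) + 2 - s ≤ j + k ∧ j + k ≤ n + 1 then 1 else 0) *
          (plucker (Theta Y).1 (Finset.Icc (j + k - 1) (j + n - 1) \ {j + k + s - 1}) /
            plucker (Theta Y).1 (Finset.Icc (j + k) (j + n - 1))) := by
  have hn : 0 < n := by omega
  rw [Finset.mem_Icc] at hj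
  choose f hf using exists_isCol (by omega) (Nat.sub_le n k) (gDefined_Theta hkn.le Y)
  have hjb : j + k = ((j + k - 2).toNat : ℕ) + 2 := by omega
  set b := (j + k - 2).toNat
  rw [(kappa_eq_sum_windowDet hk hkn hn X Y hf j b hjb).2, Finset.sum_range]
  refine Finset.sum_congr rfl fun p _ => ?_
  rw [windowDet_div hk hkn hn Y hf j b hjb (by omega), mul_assoc]
  congr 1
  refine Finset.prod_nbij' (fun i => (b : ℤ) + 2 + i) (fun i => (i - b - 2).toNat) ?_ ?_ ?_ ?_ ?_
  · intro i hi
    simp only [Finset.mem_Ico, Finset.mem_Icc] at *; omega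
  · intro i hi
    simp only [Finset.mem_Ico, Finset.mem_Icc] at *; omega
  · intro i hi
    simp only [Finset.mem_Ico] at *; omega
  · intro i hi
    simp only [Finset.mem_Icc] at *; omega
  · intro i _; rfl

/-! ### The coenergy function -/

/-- For j = 1 the window is the last n-k+1 rows. Both the last row of Y and the minors, with
alternating signs, are relations among these rows; since the minor omitting the first row is
nonzero, such a relation is determined by its first coefficient. -/
theorem kappa_one_eq {n k : ℕ} (hk : 1 ≤ k) (hkn : k < n) (X : RatRect n 1) (Y : RatRect n k) :
    kappa X Y 1 =
      ∑ s ∈ Finset.range (n - k + 1),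
        (∏ i ∈ Finset.Icc ((k : ℤ) + s + 1) n, rowVar X i) * Y.coord k (k + s - 1) := by
  have hn : 0 < n := by omega
  choose f hf using exists_isCol (by omega) (Nat.sub_le n k) (gDefined_Theta hkn.le Y)
  have hjb : (1 : ℤ) + k = (k - 1 : ℕ) + 2 := by omega
  obtain ⟨hD, hK⟩ := kappa_eq_sum_windowDet hk hkn hn X Y hf 1 (k - 1) hjb
  rw [hK, Finset.sum_range]
  set z : ℂ := (-1) ^ (n - k + 1) * (Y.t : ℂ) with hz
  set V := quasi hn z (colMatrix (k := k) f) with hV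
  have hrel : ∀ c, ∑ p : Fin (n - k + 1), (-1) ^ (p : ℕ) * Y.coord k (k + p - 1) *
      V (k - 1 + p) c = 0 := by
    intro c
    have h := sum_coord_mul_eq_zero hk hkn Y (hf (Fin.castLE (Nat.sub_le n k) c)).mem
      (fun i => V i c) (fun p => congrFun (quasi_coe hn z (colMatrix (k := k) f) p) c)
    rwa [Finset.sum_range] at h
  have hcr : ∀ c, ∑ p : Fin (n - k + 1), (-1) ^ (p : ℕ) * windowDet V (k - 1) p *
      V (k - 1 + p) c = 0 :=
    fun c => sum_alternating_det_mul (fun p : Fin (n - k + 1) => V (k - 1 + p)) c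
  have hcoord : ∀ p : Fin (n - k + 1), windowDet V (k - 1) p =
      windowDet V (k - 1) 0 * Y.coord k (k + p - 1) := by
    -- The difference of the two relations, scaled so that its first coefficient vanishes; the rest
    -- would be a nontrivial relation between rows of an invertible matrix.
    set w : Fin (n - k + 1) → ℂ := fun p => (-1) ^ (p : ℕ) * (windowDet V (k - 1) p -
      windowDet V (k - 1) 0 * Y.coord k (k + p - 1)) with hw
    have hw0 : w 0 = 0 := by
      simp only [hw, Fin.val_zero, add_zero, Y.coord_pred hk hkn]; ring
    have hwz : (fun i : Fin (n - k) => w i.succ) = 0 := by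
      by_contra hne
      apply hD
      unfold windowDet
      rw [← Matrix.exists_vecMul_eq_zero_iff]
      refine ⟨_, hne, ?_⟩
      funext c
      have h5 : ∑ p : Fin (n - k + 1), w p * V (k - 1 + p) c = 0 := by
        have := congrArg₂ (fun a b => a - windowDet V (k - 1) 0 * b) (hcr c) (hrel c)
        simp only [mul_zero, sub_zero] at this
        rw [← this, Finset.mul_sum, ← Finset.sum_sub_distrib]
        refine Finset.sum_congr rfl fun p _ => ?_
        simp only [hw]; ring
      rw [Fin.sum_univ_succ, hw0, zero_mul, zero_add] at h5
      simpa [Matrix.vecMul, dotProduct] using h5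
    intro p
    have hwp : w p = 0 := by
      induction p using Fin.cases with
      | zero => exact hw0
      | succ i => exact congrFun hwz i
    have := (mul_eq_zero.1 hwp).resolve_left (pow_ne_zero _ (by norm_num))
    exact sub_eq_zero.1 this
  refine Finset.sum_congr rfl fun p _ => ?_
  rw [hcoord, mul_div_cancel_left₀ _ hD]
  congr 1
  refine Finset.prod_nbij' (fun i => ((k - 1 : ℕ) : ℤ) + 2 + i) (fun i => (i - k - 1).toNat)
    ?_ ?_ ?_ ?_ ?_
  · intro i hi
    simp only [Finset.mem_Ico, Finset.mem_Icc] at *; omega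
  · intro i hi
    simp only [Finset.mem_Ico, Finset.mem_Icc] at *; omega
  · intro i hi
    simp only [Finset.mem_Ico] at *; omega
  · intro i hi
    simp only [Finset.mem_Icc] at *; omega
  · intro i _; rfl

theorem kappa_one_eq_minor {n k : ℕ} (hkn : k < n) (X : RatRect n 1) (Y : RatRect n k) :
    kappa X Y 1 = minor (productAt X Y) (Finset.Icc ((k : ℤ) + 1) n) (Finset.Icc 1 ((n : ℤ) - k)) := by
  have h := plucker_window_ne_zero hkn Y 1
  have hI : Finset.Icc (1 + (k : ℤ)) (1 + n - 1) = Finset.Icc ((k : ℤ) + 1) n := by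
    congr 1 <;> ring
  unfold kappa tau
  rw [hI] at h ⊢
  rw [div_self h, mul_one]

theorem minor_eq_C {n : ℕ} (A : Matrix (Fin n) (Fin n) ℂ[X]) (z : ℂ) (I J : Finset ℤ)
    (h : ∀ p ∈ residues n I, ∀ q ∈ residues n J, ∃ c : ℂ, A p q = C c) :
    minor A I J = C (minor (evalAt A z) I J) := by
  unfold minor
  split_ifs with hc
  · rw [RingHom.map_det]
    congr 1
    ext i j : 2
    obtain ⟨c, hc'⟩ := h _ (Finset.orderEmbOfFin_mem _ rfl i) _ (Finset.orderEmbOfFin_mem _ hc.symm j)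
    simp [evalAt, hc']
  · simp

/-- In W only the first row contains λ, and the rows [k+1, n] avoid it because k ≥ 1; the first n -
k columns of g(Θ(Y)) are free of λ. So the minor is constant and may be computed at any λ. -/
theorem C_kappa_one_mem_coenergy {n k : ℕ} (hk : 1 ≤ k) (hkn : k < n) (X : RatRect n 1)
    (Y : RatRect n k) : C (kappa X Y 1) ∈ coenergy (Theta X) (Theta Y) := by
  have hgX := gDefined_Theta (by omega) X
  have hgY := gDefined_Theta hkn.le Y
  unfold coenergy gProd
  simp only [Part.mem_map_iff, Part.mem_bind_iff, mem_g]
  refine ⟨_, ⟨_, ⟨hgX, rfl⟩, _, ⟨hgY, rfl⟩, rfl⟩, ?_⟩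
  have hmin : min (n - 1) (n - k) = n - k := by omega
  rw [hmin, show (n : ℤ) - (n - k : ℕ) + 1 = k + 1 by omega, kappa_one_eq_minor hkn,
    show ((n - k : ℕ) : ℤ) = n - k by omega]
  refine minor_eq_C _ _ _ _ fun p hp q hq => ?_
  have hp0 : 0 < (p : ℕ) := by
    obtain ⟨a, ha, h⟩ := mem_residues.1 hp
    rw [Finset.mem_Icc] at ha
    by_contra h0
    have : (p : ℤ) = 0 := by omega
    rw [this] at h
    obtain ⟨c, hc⟩ := h.dvd
    have h1 : c < 0 := by
      by_contra h1
      have : (0 : ℤ) ≤ n * c := mul_nonneg (by omega) (by omega)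
      omega
    have : (n : ℤ) * c ≤ n * (-1) := mul_le_mul_of_nonneg_left (by omega) (by omega)
    omega
  have hqm : (q : ℕ) < n - k := by
    obtain ⟨a, ha, h⟩ := mem_residues.1 hq
    rw [Finset.mem_Icc] at ha
    obtain ⟨c, hc⟩ := h.dvd
    have hq2 := q.2
    have h1 : c < 1 := by
      by_contra h1
      have : (n : ℤ) * 1 ≤ n * c := mul_le_mul_of_nonneg_left (by omega) (by omega)
      omega
    have h2 : (n : ℤ) * c ≤ n * 0 := mul_le_mul_of_nonneg_left (by omega) (by omega)
    omega
  obtain ⟨f, hf⟩ := exists_isCol (by omega) (Nat.sub_le n k) hgY q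
  have hW : ∀ r, ∃ c : ℂ, gMatrix (Theta X) p r = C c := by
    intro r
    rw [gMatrix_Theta_one (by omega)]
    split_ifs with h1 h2 h3
    · exact ⟨_, rfl⟩
    · exact ⟨1, by simp⟩
    · have := r.2; omega
    · exact ⟨0, by simp⟩
  choose c hc using hW
  refine ⟨∑ r, c r * f r, ?_⟩
  rw [Matrix.mul_apply, map_sum]
  refine Finset.sum_congr rfl fun r _ => ?_
  rw [hc, gMatrix_apply (by omega) (by omega) hgY hf, if_pos hqm, one_mul, C_mul]

/-! ### The reduced adjugate of `g(N|t)` -/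

/-- Off the diagonal, on the common support of `w a` and `f b`, the coefficients containing λ are
proportional to those in `horth`; γ is the constant of proportionality times μ. On the diagonal only
r = a and r = a - m contribute, and `horth` evaluates the product of the entries at a. -/
theorem sum_dual_mul_col {n m : ℕ} (hm : 0 < m) (hmn : m < n) {R : Type*} [CommRing R]
    {lam mu : R} (hmu : IsUnit mu) (f w : Fin n → Fin n → R)
    (hf0 : ∀ b r, CycBefore (m - 1) b r → f b r = 0)
    (hf1 : ∀ b r : Fin n, ((r : ℕ) + m = b ∨ (r : ℕ) + m = b + n) → f b r = 1)
    (hw0 : ∀ a r, ¬ (CycBefore m a r ∨ r = a) → w a r = 0)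
    (hw1 : ∀ a r : Fin n, ((r : ℕ) + m = a ∨ (r : ℕ) + m = a + n) → w a r = 1)
    (horth : ∀ a b, ∑ r, w a r * (if a < r then mu else 1) * f b r = 0) (a b : Fin n) :
    ∑ r, (w a r * if a < r then lam else 1) *
      ((if (b : ℕ) < m then 1 else if b ≤ r then mu else lam) * f b r) =
      if a = b then lam - mu else 0 := by
  have ha := a.2
  have hb := b.2
  have key : ∀ γ : R, (∀ r, w a r ≠ 0 → f b r ≠ 0 → mu * ((if a < r then lam else 1) *
      (if (b : ℕ) < m then 1 else if b ≤ r then mu else lam)) =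
        γ * (if a < r then mu else 1)) →
      ∑ r, (w a r * if a < r then lam else 1) *
        ((if (b : ℕ) < m then 1 else if b ≤ r then mu else lam) * f b r) = 0 := by
    intro γ h
    rw [← hmu.mul_right_eq_zero, ← mul_zero γ, ← horth a b, Finset.mul_sum, Finset.mul_sum]
    refine Finset.sum_congr rfl fun r _ => ?_
    by_cases h1 : w a r = 0
    · rw [h1]; ring
    by_cases h2 : f b r = 0
    · rw [h2]; ring
    linear_combination (w a r * f b r) * h r h1 h2
  have hws : ∀ r, w a r ≠ 0 → CycBefore m a r ∨ (r : ℕ) = a := by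
    intro r h
    by_contra h'
    exact h (hw0 a r (by rw [Fin.ext_iff]; exact h'))
  have hfs : ∀ r, f b r ≠ 0 → ¬ CycBefore (m - 1) b r := fun r h h' => h (hf0 b r h')
  simp only [CycBefore, Fin.lt_def, Fin.le_def] at hws hfs key ⊢
  rcases lt_trichotomy (a : ℕ) b with hab | hab | hab
  · rw [if_neg (fun h => by rw [h] at hab; omega)]
    by_cases hbm : (b : ℕ) < m
    · refine key lam fun r h1 h2 => ?_
      have h3 := hws r h1
      have h4 := hfs r h2
      have hr := r.2
      rw [if_pos hbm, if_pos (by omega), if_pos (by omega)]; ring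
    · refine key (mu * lam) fun r h1 h2 => ?_
      have h3 := hws r h1
      have h4 := hfs r h2
      have hr := r.2
      rw [if_neg hbm]
      by_cases har : (a : ℕ) < r
      · rw [if_pos har, if_pos har, if_pos (by omega)]; ring
      · rw [if_neg har, if_neg har, if_neg (by omega)]; ring
  · have hab' : a = b := Fin.ext hab
    subst hab'
    rw [if_pos rfl]
    obtain ⟨r0, hr0⟩ : ∃ r0 : Fin n, (r0 : ℕ) + m = a ∨ (r0 : ℕ) + m = a + n :=
      ⟨⟨if m ≤ (a : ℕ) then a - m else a + n - m, by split_ifs <;> omega⟩, by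
        simp only; split_ifs <;> omega⟩
    have hr02 := r0.2
    have hne : a ≠ r0 := fun h => by have := congrArg Fin.val h; omega
    have hz : ∀ r : Fin n, r ≠ a ∧ r ≠ r0 → w a r * f a r = 0 := by
      intro r hr
      by_contra h
      have h3 := hws r (left_ne_zero_of_mul h)
      have h4 := hfs r (right_ne_zero_of_mul h)
      have hr2 := r.2
      have h5 : (r : ℕ) ≠ a := fun h => hr.1 (Fin.ext h)
      have h6 : (r : ℕ) ≠ r0 := fun h => hr.2 (Fin.ext h)
      omega
    have ho := horth a a
    simp only [Fin.lt_def] at ho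
    rw [Fintype.sum_eq_add a r0 hne (fun r hr => by
      rw [mul_right_comm, hz r hr, zero_mul]), hw1 a r0 hr0, hf1 a r0 hr0] at ho
    rw [Fintype.sum_eq_add a r0 hne (fun r hr => by
      linear_combination ((if (a : ℕ) < r then lam else 1) *
        (if (a : ℕ) < m then 1 else if (a : ℕ) ≤ r then mu else lam)) * hz r hr),
      hw1 a r0 hr0, hf1 a r0 hr0]
    rw [if_neg (by omega)] at ho ⊢
    by_cases ham : (a : ℕ) < m
    · have har : (a : ℕ) < r0 := by omega
      simp only [if_pos har, if_pos ham] at ho ⊢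
      linear_combination ho
    · have har : ¬ (a : ℕ) < r0 := by omega
      have har' : ¬ (a : ℕ) ≤ r0 := by omega
      simp only [if_neg har, if_neg ham, if_neg har', if_pos le_rfl] at ho ⊢
      linear_combination mu * ho
  · rw [if_neg (fun h => by rw [h] at hab; omega)]
    by_cases hbm : (b : ℕ) < m
    · refine key mu fun r h1 h2 => ?_
      have h3 := hws r h1
      have h4 := hfs r h2
      have hr := r.2
      rw [if_pos hbm, if_neg (by omega), if_neg (by omega)]; ring
    · refine key (mu * mu) fun r h1 h2 => ?_
      have h3 := hws r h1
      have h4 := hfs r h2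
      have hr := r.2
      rw [if_neg hbm, if_neg (by omega), if_pos (by omega), if_neg (by omega)]; ring

theorem mul_eq_smul_one_comm {n : ℕ} {R : Type*} [CommRing R] [IsDomain R]
    {P Q : Matrix (Fin n) (Fin n) R} {c : R} (hc : c ≠ 0) (h : P * Q = c • 1) : Q * P = c • 1 := by
  have hQ : Q.det ≠ 0 := by
    intro h0
    have := congrArg Matrix.det h
    rw [Matrix.det_mul, h0, mul_zero, Matrix.det_smul, Matrix.det_one, mul_one] at this
    exact pow_ne_zero _ hc this.symm
  have h1 : (Q * P - c • 1) * Q = 0 := by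
    rw [Matrix.sub_mul, Matrix.mul_assoc, h]; simp
  have h2 : (Q * P - c • 1) * Q * Q.adjugate = 0 := by rw [h1, Matrix.zero_mul]
  rw [Matrix.mul_assoc, Matrix.mul_adjugate, Matrix.mul_smul, Matrix.mul_one] at h2
  exact sub_eq_zero.1 ((smul_eq_zero.1 h2).resolve_left hQ)

/-- The kernel of `g(Θ_{n-1}(X))` at `λ = (-1)^n s`. -/
def kernelVec {n : ℕ} (X : RatRect n 1) (q : Fin n) : ℂ := (-1) ^ (q : ℕ) / X.coord 1 (q + 1)

theorem kernelVec_ne_zero {n : ℕ} (X : RatRect n 1) (q : Fin n) : kernelVec X q ≠ 0 :=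
  div_ne_zero (pow_ne_zero _ (by norm_num)) (X.coord_ne_zero _ _)

theorem ratio_mul_kernelVec {n : ℕ} (X : RatRect n 1) {p q : Fin n} (h : (p : ℕ) = q + 1) :
    X.ratio 1 (p + 1) * kernelVec X p + kernelVec X q = 0 := by
  unfold kernelVec RatRect.ratio
  have h1 := X.coord_ne_zero 1 (p + 1)
  have h2 := X.coord_ne_zero 1 p
  rw [Nat.add_sub_cancel, show (q : ℕ) + 1 = p by omega, h, pow_succ]
  rw [h] at h1 h2
  field_simp
  ring

theorem ratio_mul_kernelVec_zero {n : ℕ} (hn : 1 < n) (X : RatRect n 1) {p q : Fin n}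
    (h : (p : ℕ) + n = q + 1) :
    X.ratio 1 (p + 1) * kernelVec X p + ((-1) ^ (n - 1 + 1) * (X.t : ℂ)) * kernelVec X q = 0 := by
  have hp : (p : ℕ) = 0 := by have := q.2; omega
  have hq : (q : ℕ) = n - 1 := by omega
  have h0 : X.coord 1 0 = 1 := X.coord_pred le_rfl hn
  have h1 := X.coord_ne_zero 1 1
  have h2 := X.t.ne_zero
  unfold kernelVec RatRect.ratio
  rw [hp, hq, show n - 1 + 1 = n by omega, X.coord_last]
  simp only [zero_add, Nat.sub_self, h0]
  obtain ⟨n', rfl⟩ : ∃ n', n = n' + 1 := ⟨n - 1, by omega⟩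
  rw [Nat.add_sub_cancel, pow_succ]
  have := neg_one_pow_mul_self (R := ℂ) n'
  field_simp
  linear_combination -this

theorem evalAt_mulVec_kernelVec {n : ℕ} (hn : 1 < n) (X : RatRect n 1) :
    (evalAt (gMatrix (Theta X)) ((-1) ^ (n - 1 + 1) * (X.t : ℂ))).mulVec (kernelVec X) = 0 := by
  ext p
  have hp2 := p.2
  by_cases hp : (p : ℕ) = 0
  · rw [(evalAt_gMatrix_Theta_one_mulVec hn X _ _ p ⟨n - 1, by omega⟩).2 (by simp only; omega)]
    exact ratio_mul_kernelVec_zero hn X (by simp only; omega)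
  · rw [(evalAt_gMatrix_Theta_one_mulVec hn X _ _ p ⟨p - 1, by omega⟩).1 (by simp only; omega)]
    exact ratio_mul_kernelVec X (by simp only; omega)

/-- Translates the coefficient "z above the diagonal" of the reduced adjugate into the winding
number used by `quasi`. -/
theorem ite_lt_mod_eq {n m k : ℕ} (hn : 0 < n) (hm : m + k = n) {z : ℂ} (hz : z ≠ 0) (a : Fin n)
    (hk : 0 < k)
    (p : Fin (m + 1)) :
    (if a < (⟨((a : ℕ) + k + p) % n, Nat.mod_lt _ hn⟩ : Fin n) then z else 1) =
      z * z⁻¹ ^ (((a : ℕ) + k + p) / n) := by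
  have ha := a.2
  have hp := p.2
  rw [div_of_lt_two_mul (by omega)]
  simp only [Fin.lt_def]
  by_cases h : (a : ℕ) + k + p < n
  · rw [Nat.mod_eq_of_lt h, if_pos (by omega), if_pos h, pow_zero, mul_one]
  · rw [Nat.mod_eq_sub_mod (by omega), Nat.mod_eq_of_lt (by omega), if_neg (by omega), if_neg h,
      pow_one, mul_inv_cancel₀ hz]

/-- The matrix `B̃` with `B̃ g(N|t) = g(N|t) B̃ = λ - (-1)^{n-k-1} t`. -/
theorem exists_reduced_adjugate {n k : ℕ} (hk : 1 ≤ k) (hkn : k < n) (Y : RatRect n k) :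
    ∃ T : Matrix (Fin n) (Fin n) ℂ[X],
      T * gMatrix (Theta Y) = (X - C ((-1) ^ (n - k + 1) * (Y.t : ℂ))) • 1 ∧
      gMatrix (Theta Y) * T = (X - C ((-1) ^ (n - k + 1) * (Y.t : ℂ))) • 1 ∧
      (∀ z : ℂ, z ≠ 0 → evalAt T z ≠ 0) ∧
      ∀ (Z : RatRect n 1) (a : Fin n), kappa Z Y ((a : ℤ) + 2) * kernelVec Z a =
        (-1) ^ (n - k) *
          (evalAt T ((-1) ^ (n - 1 + 1) * (Z.t : ℂ))).mulVec (kernelVec Z) a := by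
  have hn : 0 < n := by omega
  have hmk : n - k + k = n := by omega
  have hgY := gDefined_Theta hkn.le Y
  choose f hf using exists_isCol (by omega) (Nat.sub_le n k) hgY
  set mu : ℂ := (-1) ^ (n - k + 1) * (Y.t : ℂ) with hmu
  have hmu0 : mu ≠ 0 := coeff_ne_zero _
  set V := quasi hn mu (colMatrix (k := k) f) with hV
  have hK := fun (Z : RatRect n 1) (a : Fin n) =>
    kappa_eq_sum_windowDet hk hkn hn Z Y hf ((a : ℤ) + 2) (a + k) (by push_cast; ring)
  -- The coefficients of Cramer's relation among the rows a+k, …, a+n of the extension, normalised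
  -- to start with 1; `w` places them at these positions modulo n.
  set d : Fin n → Fin (n - k + 1) → ℂ := fun a p =>
    (-1) ^ (p : ℕ) * (windowDet V (a + k) p / windowDet V (a + k) 0) with hd
  have hd0 : ∀ Z : RatRect n 1, ∀ a, d a 0 = 1 := by
    intro Z a
    simp only [hd, Fin.val_zero, pow_zero, one_mul]
    exact div_self (hK Z a).1
  -- The coefficients do not involve Z, so any rectangle may be supplied.
  have hd0 : ∀ a, d a 0 = 1 := hd0 ⟨fun _ => 1, 1⟩
  set idx : Fin n → Fin (n - k + 1) → Fin n := fun a p =>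
    ⟨((a : ℕ) + k + p) % n, Nat.mod_lt _ hn⟩ with hidx
  set w : Fin n → Fin n → ℂ := fun a r => ∑ p, if idx a p = r then d a p else 0 with hw
  have hsum : ∀ (a : Fin n) (φ : Fin n → ℂ), ∑ r, w a r * φ r = ∑ p, d a p * φ (idx a p) := by
    intro a φ
    simp only [hw, Finset.sum_mul]
    rw [Finset.sum_comm]
    refine Finset.sum_congr rfl fun p _ => ?_
    simp only [ite_mul, zero_mul, Finset.sum_ite_eq, Finset.mem_univ, if_true]
  have hidxv : ∀ a p, (idx a p : ℕ) = if (a : ℕ) + k + p < n then (a : ℕ) + k + p else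
      (a : ℕ) + k + p - n := by
    intro a p
    have ha := a.2
    have hp := p.2
    simp only [hidx]
    split_ifs with h
    · exact Nat.mod_eq_of_lt h
    · rw [Nat.mod_eq_sub_mod (by omega), Nat.mod_eq_of_lt (by omega)]
  have hw0 : ∀ a r, ¬ (CycBefore (n - k) a r ∨ r = a) → w a r = 0 := by
    intro a r h
    refine Finset.sum_eq_zero fun p _ => if_neg ?_
    rintro rfl
    apply h
    have ha := a.2
    have hp := p.2
    simp only [CycBefore, Fin.ext_iff, Fin.lt_def, Fin.le_def, hidxv]
    split_ifs <;> omega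
  have hw1 : ∀ a r : Fin n, ((r : ℕ) + (n - k) = a ∨ (r : ℕ) + (n - k) = a + n) → w a r = 1 := by
    intro a r h
    have ha := a.2
    have hr := r.2
    simp only [hw]
    rw [Finset.sum_eq_single 0, if_pos, hd0]
    · ext
      rw [hidxv, Fin.val_zero]
      split_ifs <;> omega
    · intro p _ hp
      have hp' : (p : ℕ) ≠ 0 := fun h => hp (Fin.ext h)
      have hp2 := p.2
      rw [if_neg]
      rw [Fin.ext_iff, hidxv]
      split_ifs <;> omega
    · simp
  have horth0 : ∀ a (c : Fin (n - k)), ∑ r, w a r * ((if a < r then mu else 1) *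
      f (Fin.castLE (Nat.sub_le n k) c) r) = 0 := by
    intro a c
    rw [hsum]
    have hcr := sum_alternating_det_mul (fun p : Fin (n - k + 1) => V (a + k + p)) c
    have h2 := congrArg (fun x => mu / windowDet V (a + k) 0 * x) hcr
    simp only [mul_zero] at h2
    rw [← h2, Finset.mul_sum]
    refine Finset.sum_congr rfl fun p _ => ?_
    rw [ite_lt_mod_eq hn hmk hmu0 a hk]
    have h3 : V (a + k + p) c = mu⁻¹ ^ (((a : ℕ) + k + p) / n) *
        f (Fin.castLE (Nat.sub_le n k) c) (idx a p) := rfl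
    rw [h3]
    simp only [hd]
    change _ = mu / windowDet V (a + k) 0 * ((-1) ^ (p : ℕ) * windowDet V (a + k) p * _)
    ring
  -- Orthogonality to the first n - k columns suffices, since these span N.
  have horth : ∀ a b, ∑ r, w a r * (if a < r then mu else 1) * f b r = 0 := by
    intro a b
    have := sum_eq_zero_of_isCol (by omega : n - k < n) hgY hf ⟨0, hn⟩
      (fun r => w a r * (if a < r then mu else 1)) (fun p hp => ?_) (hf b).mem
    · rw [← this]
      exact Finset.sum_congr rfl fun r _ => mul_comm _ _
    · have hp2 := p.2
      have hpr : (p.rev : ℕ) < n - k := by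
        simp only [CycBefore, Fin.lt_def, Fin.le_def] at hp
        rw [Fin.val_rev]; omega
      rw [← horth0 a ⟨p.rev, hpr⟩]
      refine Finset.sum_congr rfl fun r _ => ?_
      have : Fin.castLE (Nat.sub_le n k) ⟨p.rev, hpr⟩ = p.rev := rfl
      rw [this]; ring
  set T : Matrix (Fin n) (Fin n) ℂ[X] := Matrix.of fun a r => C (w a r) * if a < r then X else 1
    with hT
  have hTB : T * gMatrix (Theta Y) = (X - C mu) • 1 := by
    refine Matrix.ext fun a b => ?_
    rw [Matrix.mul_apply]
    have h1 := sum_dual_mul_col (by omega : 0 < n - k) (by omega : n - k < n) (lam := (X : ℂ[X]))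
      (mu := C mu) (Polynomial.isUnit_C.2 hmu0.isUnit) (fun b r => C (f b r)) (fun a r => C (w a r))
      (fun b r h => by rw [(hf b).eq_zero r h, C_0])
      (fun b r h => by rw [(hf b).eq_one r h, C_1])
      (fun a r h => by rw [hw0 a r h, C_0]) (fun a r h => by rw [hw1 a r h, C_1])
      (fun a b => by
        have := congrArg (⇑(C : ℂ →+* ℂ[X])) (horth a b)
        rw [map_sum, C_0] at this
        rw [← this]
        refine Finset.sum_congr rfl fun r _ => ?_
        split_ifs <;> simp) a b
    rw [Matrix.smul_apply, Matrix.one_apply, smul_eq_mul, mul_ite, mul_one, mul_zero, ← h1]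
    refine Finset.sum_congr rfl fun r _ => ?_
    rw [gMatrix_apply (by omega) (by omega) hgY (hf b)]
    rfl
  refine ⟨T, hTB, mul_eq_smul_one_comm (Polynomial.X_sub_C_ne_zero mu) hTB, ?_, ?_⟩
  · intro z hz h
    have h1 := congrFun (congrFun h ⟨0, hn⟩) ⟨k, hkn⟩
    have h2 := hw1 ⟨0, hn⟩ ⟨k, hkn⟩ (by simp only; omega)
    simp only [evalAt, hT, Matrix.map_apply, Matrix.of_apply, h2, Fin.lt_def,
      if_pos (show 0 < k from hk)] at h1
    simp [hz] at h1
  · intro Z a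
    set lam : ℂ := (-1) ^ (n - 1 + 1) * (Z.t : ℂ) with hlam
    have hlam0 : lam ≠ 0 := coeff_ne_zero _
    have hTe : ∀ a r, evalAt T lam a r = w a r * if a < r then lam else 1 := by
      intro a r
      simp only [evalAt, hT, Matrix.map_apply, Matrix.of_apply]
      split_ifs <;> simp
    simp only [Matrix.mulVec, dotProduct, hTe, mul_assoc]
    rw [hsum, (hK Z a).2]
    set e := quasi hn lam (kernelVec Z) with he
    have hes : ∀ i : ℕ, e i = -(rowVar Z ((i : ℤ) + 2) * e (i + 1)) := by
      intro i
      have h := quasi_succ hn hlam0 (kernelVec Z) (fun _ => 0) (fun p => Z.ratio 1 (p + 1))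
        (fun p q h => (ratio_mul_kernelVec Z h).symm)
        (fun p q h => (ratio_mul_kernelVec_zero (by omega) Z h).symm) i
      have h0 : quasi hn lam (fun _ : Fin n => (0 : ℂ)) (i + 1) = 0 := by simp [quasi]
      rw [h0] at h
      rw [show (i : ℤ) + 2 = ((i + 1 : ℕ) : ℤ) + 1 by push_cast; ring, rowVar_natCast_succ]
      simp only [smul_eq_mul] at h
      linear_combination -h
    -- Iterating e_i = -x e_{i+1} converts the monomials in the x's in the formula for κ into
    -- entries of the kernel vector; the signs match those in `d`.
    have hprod : ∀ l : ℕ, ∀ b p : ℕ, (∏ i ∈ Finset.Ico p (p + l), rowVar Z ((b : ℤ) + 2 + i)) *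
        e (b + p + l) = (-1) ^ l * e (b + p) := by
      intro l
      induction l with
      | zero => intro b p; simp
      | succ l ih =>
        intro b p
        rw [← add_assoc, Finset.prod_Ico_succ_top (by omega), pow_succ]
        have h1 := ih b p
        have h2 := hes (b + p + l)
        have h3 : ((b : ℤ) + 2 + (p + l : ℕ)) = ((b + p + l : ℕ) : ℤ) + 2 := by push_cast; ring
        rw [h3, ← add_assoc]
        rw [h2] at h1
        linear_combination -h1
    have hea : kernelVec Z a = lam * e (a + k + (n - k)) := by
      rw [show (a : ℕ) + k + (n - k) = a + n by omega]
      rw [← quasi_coe hn lam (kernelVec Z) a, quasi_eq_smul hn hlam0, smul_eq_mul]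
    rw [Finset.sum_mul, Finset.mul_sum]
    refine Finset.sum_congr rfl fun p _ => ?_
    have hp := p.2
    have h4 := hprod (n - k - p) (a + k) p
    rw [Nat.add_sub_cancel' (by omega), show (a : ℕ) + k + p + (n - k - p) = a + k + (n - k) by omega]
      at h4
    rw [ite_lt_mod_eq hn hmk hlam0 a hk, hea]
    have h5 : e (a + k + p) = lam⁻¹ ^ (((a : ℕ) + k + p) / n) * kernelVec Z (idx a p) := rfl
    rw [h5] at h4
    simp only [hd]
    have h6 : ((-1 : ℂ)) ^ (n - k) = (-1) ^ (n - k - (p : ℕ)) * (-1) ^ (p : ℕ) := by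
      rw [← pow_add]; congr 1; omega
    have h7 := neg_one_pow_mul_self (R := ℂ) (p : ℕ)
    rw [h6]
    push_cast at h4 ⊢
    linear_combination (lam * windowDet V (a + k) p / windowDet V (a + k) 0) * h4 -
      ((-1) ^ (n - k - (p : ℕ)) * lam * windowDet V (a + k) p / windowDet V (a + k) 0 *
        lam⁻¹ ^ (((a : ℕ) + k + p) / n) * kernelVec Z (idx a p)) * h7

/-! ### Hyperplanes -/

theorem mem_iff_of_annihilates {n : ℕ} (hn : 1 < n) {H : Gr n (n - 1)} {l : Fin n → ℂ}
    (hl : l ≠ 0) (h : ∀ f ∈ H.1, ∑ p, l p * f p = 0) (f : Fin n → ℂ) :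
    f ∈ H.1 ↔ ∑ p, l p * f p = 0 := by
  set φ : Module.Dual ℂ (Fin n → ℂ) := ∑ p, l p • LinearMap.proj p with hφ
  have hφa : ∀ f, φ f = ∑ p, l p * f p := fun f => by simp [hφ, LinearMap.sum_apply]
  have hφ0 : φ ≠ 0 := by
    intro h0
    apply hl
    ext p
    have := hφa (Pi.single p 1)
    rw [h0] at this
    simpa [Pi.single_apply] using this.symm
  have hk := Module.Dual.finrank_ker_add_one_of_ne_zero hφ0
  rw [Module.finrank_fin_fun] at hk
  have hle : H.1 ≤ LinearMap.ker φ := fun f hf => by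
    rw [LinearMap.mem_ker, hφa]; exact h f hf
  have heq := Submodule.eq_of_le_of_finrank_eq hle (by rw [H.2]; omega)
  rw [heq, LinearMap.mem_ker, hφa]

theorem exists_annihilator {n : ℕ} (hn : 1 < n) (H : Gr n (n - 1)) :
    ∃ l : Fin n → ℂ, l ≠ 0 ∧ ∀ f ∈ H.1, ∑ p, l p * f p = 0 := by
  have hlt : H.1 < ⊤ := by
    rw [lt_top_iff_ne_top]
    intro h
    have := H.2
    rw [h, finrank_top, Module.finrank_fin_fun] at this
    omega
  obtain ⟨φ, hφ, hle⟩ := Submodule.exists_le_ker_of_lt_top _ hlt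
  have hφa : ∀ f, φ f = ∑ p, φ (fun j => if p = j then 1 else 0) * f p := fun f => by
    rw [LinearMap.pi_apply_eq_sum_univ φ f]
    exact Finset.sum_congr rfl fun p _ => mul_comm _ _
  refine ⟨fun p => φ (fun j => if p = j then 1 else 0), ?_, fun f hf => ?_⟩
  · intro h
    apply hφ
    ext1
    ext1
    rw [LinearMap.comp_apply, hφa]
    simp [fun p => congrFun h p]
  · rw [← hφa]; exact hle hf

/-- If l_q = 0, the q-th basis vector would lie in the hyperplane and vanish on the window of the n
- 1 other positions. -/
theorem annihilator_ne_zero {n : ℕ} (hn : 1 < n) {u : XVar n (n - 1)} (hu : GDefined u)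
    {l : Fin n → ℂ} (hl : l ≠ 0) (h : ∀ f ∈ u.1.1, ∑ p, l p * f p = 0) (q : Fin n) : l q ≠ 0 := by
  intro h0
  have hmem : Pi.single q (1 : ℂ) ∈ u.1.1 := by
    rw [mem_iff_of_annihilates hn hl h]
    simp [Pi.single_apply, h0]
  have := (gDefined_iff (Nat.sub_le n 1) u).1 hu q _ hmem (fun p hp => by
    rw [Pi.single_apply, if_neg]
    rintro rfl
    have := p.2
    simp only [CycBefore, Fin.lt_def, Fin.le_def] at hp; omega)
  have := congrFun this q
  simp at this

theorem gDefined_of_annihilator {n : ℕ} (hn : 1 < n) {u : XVar n (n - 1)} {l : Fin n → ℂ}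
    (hl : ∀ q, l q ≠ 0) (h : ∀ f ∈ u.1.1, ∑ p, l p * f p = 0) : GDefined u := by
  rw [gDefined_iff (Nat.sub_le n 1)]
  intro q f hf h0
  have h1 : ∀ p, p ≠ q → f p = 0 := by
    intro p hp
    apply h0
    have hp' : (p : ℕ) ≠ q := fun h => hp (Fin.ext h)
    have := p.2
    simp only [CycBefore, Fin.lt_def, Fin.le_def]; omega
  have h2 := h f hf
  rw [Finset.sum_eq_single q (fun p _ hp => by rw [h1 p hp, mul_zero]) (by simp)] at h2
  ext p
  by_cases hp : p = q
  · rw [hp]; exact (mul_eq_zero.1 h2).resolve_left (hl q)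
  · exact h1 p hp

/-- The coordinates X_{1p} are, with alternating signs, the coefficients of the equation of the
hyperplane. Hence Θ reaches every hyperplane with nonzero coefficients. -/
theorem exists_Theta_eq {n : ℕ} (hn : 1 < n) {u : XVar n (n - 1)}
    {l : Fin n → ℂ} (hl : ∀ q, l q ≠ 0) (h : ∀ f ∈ u.1.1, ∑ p, l p * f p = 0) :
    ∃ X : RatRect n 1, Theta X = u ∧
      ∀ p : Fin n, X.coord 1 p = (-1) ^ (p : ℕ) * l p / l ⟨0, by omega⟩ := by
  have hl0 := hl ⟨0, by omega⟩
  have hne : ∀ p : Fin n, (-1) ^ (p : ℕ) * l p / l ⟨0, by omega⟩ ≠ 0 := fun p =>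
    div_ne_zero (mul_ne_zero (pow_ne_zero _ (by norm_num)) (hl p)) hl0
  set Z : RatRect n 1 := ⟨fun p => Units.mk0 _ (hne ⟨p.1.2, by have := p.2; omega⟩), u.2⟩ with hZ
  have hc : ∀ p : Fin n, Z.coord 1 p = (-1) ^ (p : ℕ) * l p / l ⟨0, by omega⟩ := by
    intro p
    have hp := p.2
    by_cases h0 : (p : ℕ) = 0
    · have : p = ⟨0, by omega⟩ := Fin.ext h0
      rw [h0, this, pow_zero, one_mul, div_self hl0]
      exact Z.coord_pred le_rfl hn
    · unfold RatRect.coord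
      rw [dif_pos (by omega)]
      rfl
  refine ⟨Z, Prod.ext (Subtype.ext ?_) rfl, hc⟩
  have hlne : l ≠ 0 := fun h0 => hl0 (by rw [h0]; rfl)
  have h1 : ∀ f ∈ (Theta Z).1.1, ∑ p, l p * f p = 0 := by
    intro f hf
    have h2 := sum_coord_one_mul_eq_zero hn Z hf
    have h3 := congrArg (fun x => l ⟨0, by omega⟩ * x) h2
    simp only [mul_zero] at h3
    rw [← h3, Finset.mul_sum]
    refine Finset.sum_congr rfl fun p _ => ?_
    rw [hc]
    have := neg_one_pow_mul_self (R := ℂ) (p : ℕ)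
    field_simp
    linear_combination (-l p * f p) * this
  ext f
  rw [mem_iff_of_annihilates hn hlne h1, mem_iff_of_annihilates hn hlne h]

/-! ### The second output -/

/-- Handles the degenerate parameter d = 0 as well. If T v = 0 then d = 0, and rank B ≥ n - 1 forces
ker T = im B, so v = B x. Both x and any T b lie in ker(W B), which is at most a line, so x is a
multiple of some T b ≠ 0 and v = B x = 0. -/
theorem mulVec_ne_zero_of_rank {n : ℕ} {W B T : Matrix (Fin n) (Fin n) ℂ} {d : ℂ}
    (hBT : B * T = d • 1) (hTB : T * B = d • 1) (hT : T ≠ 0) (hr : n - 1 ≤ (W * B).rank)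
    {v : Fin n → ℂ} (hWv : W.mulVec v = 0) (hv : v ≠ 0) : T.mulVec v ≠ 0 := by
  intro hTv
  have hd : d = 0 := by
    have h1 : B.mulVec (T.mulVec v) = d • v := by
      rw [Matrix.mulVec_mulVec, hBT, Matrix.smul_mulVec, Matrix.one_mulVec]
    rw [hTv, Matrix.mulVec_zero] at h1
    exact (smul_eq_zero.1 h1.symm).resolve_right hv
  subst hd
  rw [zero_smul] at hBT hTB
  obtain ⟨b, hb⟩ : ∃ b, T.mulVec b ≠ 0 := by
    by_contra hcon
    push Not at hcon
    apply hT
    ext i j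
    have := congrFun (hcon (Pi.single j 1)) i
    simpa using this
  have hkerT : Module.finrank ℂ (LinearMap.ker T.mulVecLin) ≤ n - 1 := by
    have h1 : Module.finrank ℂ (LinearMap.ker T.mulVecLin) <
        Module.finrank ℂ (Fin n → ℂ) := by
      apply Submodule.finrank_lt
      intro h
      apply hb
      have : b ∈ LinearMap.ker T.mulVecLin := by rw [h]; trivial
      simpa using this
    rw [Module.finrank_fin_fun] at h1
    omega
  have hrB : n - 1 ≤ Module.finrank ℂ (LinearMap.range B.mulVecLin) :=
    hr.trans (Matrix.rank_mul_le_right W B)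
  have hle : LinearMap.range B.mulVecLin ≤ LinearMap.ker T.mulVecLin := by
    rintro _ ⟨x, rfl⟩
    simp [Matrix.mulVec_mulVec, hTB]
  have heq := Submodule.eq_of_le_of_finrank_le hle (hkerT.trans hrB)
  have hvmem : v ∈ LinearMap.range B.mulVecLin := by
    rw [heq, LinearMap.mem_ker]; exact hTv
  obtain ⟨x, hx⟩ := hvmem
  have hx : B.mulVec x = v := hx
  have hker : Module.finrank ℂ (LinearMap.ker (W * B).mulVecLin) ≤ 1 := by
    have h1 := LinearMap.finrank_range_add_finrank_ker (W * B).mulVecLin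
    rw [Module.finrank_fin_fun] at h1
    have h2 : n - 1 ≤ Module.finrank ℂ (LinearMap.range (W * B).mulVecLin) := hr
    omega
  obtain ⟨y, hy⟩ := finrank_le_one_iff.1 hker
  obtain ⟨c1, hc1⟩ := hy ⟨T.mulVec b, by
    rw [LinearMap.mem_ker, Matrix.mulVecLin_apply, ← Matrix.mulVec_mulVec,
      Matrix.mulVec_mulVec b B T, hBT, Matrix.zero_mulVec, Matrix.mulVec_zero]⟩
  obtain ⟨c2, hc2⟩ := hy ⟨x, by
    rw [LinearMap.mem_ker, Matrix.mulVecLin_apply, ← Matrix.mulVec_mulVec, hx, hWv]⟩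
  have hc1 : c1 • (y : Fin n → ℂ) = T.mulVec b := congrArg Subtype.val hc1
  have hc2 : c2 • (y : Fin n → ℂ) = x := congrArg Subtype.val hc2
  have hc10 : c1 ≠ 0 := by
    rintro rfl
    rw [zero_smul] at hc1
    exact hb hc1.symm
  have hBy : B.mulVec (y : Fin n → ℂ) = 0 := by
    have h1 : B.mulVec (c1 • (y : Fin n → ℂ)) = 0 := by
      rw [hc1, Matrix.mulVec_mulVec, hBT, Matrix.zero_mulVec]
    rw [Matrix.mulVec_smul] at h1
    exact (smul_eq_zero.1 h1).resolve_left hc10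
  apply hv
  rw [← hx, ← hc2, Matrix.mulVec_smul, hBy, smul_zero]

theorem rank_of_finrank_flip {n m : ℕ} {A : Matrix (Fin n) (Fin n) ℂ}
    (h : Module.finrank ℂ (firstColSpan m (flipMatrix A)) = m) : m ≤ A.rank := by
  have h1 : firstColSpan m (flipMatrix A) ≤ LinearMap.range (flipMatrix A).mulVecLin := by
    intro f hf
    obtain ⟨c, _, rfl⟩ := (mem_firstColSpan _ _).1 hf
    exact ⟨c, rfl⟩
  have h2 : flipMatrix A = (A.transpose).submatrix Fin.revPerm Fin.revPerm := by
    ext i j; rfl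
  have h3 : m ≤ (flipMatrix A).rank := by
    rw [← h]; exact Submodule.finrank_mono h1
  rwa [h2, Matrix.rank_submatrix, Matrix.rank_transpose] at h3

theorem sum_rev_mul_eq_zero_of_mem_flip {n m : ℕ} {A : Matrix (Fin n) (Fin n) ℂ}
    {v : Fin n → ℂ} (hv : A.mulVec v = 0) {f : Fin n → ℂ}
    (hf : f ∈ firstColSpan m (flipMatrix A)) : ∑ p : Fin n, v p.rev * f p = 0 := by
  obtain ⟨c, _, rfl⟩ := (mem_firstColSpan _ _).1 hf
  simp only [Matrix.mulVec, dotProduct, flipMatrix, Matrix.of_apply, Finset.mul_sum]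
  rw [Finset.sum_comm]
  refine Finset.sum_eq_zero fun q _ => ?_
  have h := congrFun hv q.rev
  simp only [Matrix.mulVec, dotProduct, Pi.zero_apply] at h
  rw [← Equiv.sum_comp Fin.revPerm] at h
  have h2 := congrArg (fun x => c q * x) h
  simp only [mul_zero] at h2
  rw [← h2, Finset.mul_sum]
  exact Finset.sum_congr rfl fun p _ => by simp only [Fin.revPerm_apply]; ring

theorem minor_congr {n : ℕ} {R : Type*} [CommRing R] (A : Matrix (Fin n) (Fin n) R)
    {I I' : Finset ℤ} (J : Finset ℤ) (h : residues n I = residues n I') :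
    minor A I J = minor A I' J := by
  have key : ∀ S S' T : Finset (Fin n), S = S' →
      (if h : S.card = T.card then
        (A.submatrix (S.orderEmbOfFin rfl) (T.orderEmbOfFin h.symm)).det else 0) =
      if h : S'.card = T.card then
        (A.submatrix (S'.orderEmbOfFin rfl) (T.orderEmbOfFin h.symm)).det else 0 := by
    rintro S _ T rfl
    rfl
  exact key _ _ _ h

theorem kappa_add {n k : ℕ} (X : RatRect n 1) (Y : RatRect n k) (j : ℤ) :
    kappa X Y (j + n) = kappa X Y j := by
  have h : residues n (Finset.Icc (j + n + k) (j + n + n - 1)) =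
      residues n (Finset.Icc (j + k) (j + n - 1)) := by
    ext p
    simp only [mem_residues, Finset.mem_Icc]
    constructor
    · rintro ⟨a, ha, h⟩
      exact ⟨a - n, by omega, (Int.modEq_iff_dvd.2 ⟨1, by ring⟩).trans h⟩
    · rintro ⟨a, ha, h⟩
      exact ⟨a + n, by omega, (Int.modEq_iff_dvd.2 ⟨-1, by ring⟩).trans h⟩
  unfold kappa tau plucker
  rw [maxMinor_congr _ h, minor_congr _ _ h]

theorem evalAt_X_sub_C_smul_one {n : ℕ} (μ z : ℂ) :
    evalAt ((Polynomial.X - C μ) • 1 : Matrix (Fin n) (Fin n) ℂ[X]) z = (z - μ) • 1 := by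
  ext i j
  by_cases h : i = j <;> simp [evalAt, h]

/-- The vector `κ_{j+1} η_j` spanning the kernel of `A_s`. -/
theorem mulVec_kappa_mul_kernelVec {n k : ℕ} (hk : 1 ≤ k) (hkn : k < n) (X : RatRect n 1)
    (Y : RatRect n k) :
    (evalAt (gMatrix (Theta X) * gMatrix (Theta Y)) ((-1) ^ (n - 1 + 1) * (X.t : ℂ))).mulVec
      (fun a : Fin n => kappa X Y ((a : ℤ) + 2) * kernelVec X a) = 0 := by
  obtain ⟨T, _, hBT, _, hT⟩ := exists_reduced_adjugate hk hkn Y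
  set z : ℂ := (-1) ^ (n - 1 + 1) * (X.t : ℂ)
  have h1 : (fun a : Fin n => kappa X Y ((a : ℤ) + 2) * kernelVec X a) =
      (-1 : ℂ) ^ (n - k) • (evalAt T z).mulVec (kernelVec X) := funext fun a => hT X a
  have h2 := congrArg (fun A => evalAt A z) hBT
  simp only [evalAt_mul, evalAt_X_sub_C_smul_one] at h2
  rw [h1, Matrix.mulVec_smul, evalAt_mul, ← Matrix.mulVec_mulVec, Matrix.mulVec_mulVec _ _ (evalAt T z),
    h2, Matrix.smul_mulVec, Matrix.one_mulVec, Matrix.mulVec_smul,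
    evalAt_mulVec_kernelVec (by omega), smul_zero, smul_zero]

/-- Since fl reverses products, g(S v) g(S u) = fl(g(u) g(v)). The intermediate involutions are
always defined on the image of Θ. -/
theorem isSecondOutput_iff {n k : ℕ} (hk : 1 ≤ k) (hkn : k < n) (X : RatRect n 1)
    (Y : RatRect n k) (X' : RatRect n 1) :
    IsSecondOutput X Y X' ↔ (∃ v', v' ∈ psi (Theta X) (Theta Y)) ∧
      ∃ w : XVar n (n - 1), w ∈ piMap (n - 1) X.t
        (flipMatrix (gMatrix (Theta X) * gMatrix (Theta Y))) ∧ Theta X' ∈ schutz w := by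
  have hgX := gDefined_Theta (by omega) X
  have hgY := gDefined_Theta hkn.le Y
  have hpsi : ∀ Sv : XVar n (n - k), Sv ∈ schutz (Theta Y) → ∀ Su : XVar n (n - 1),
      Su ∈ schutz (Theta X) → ∀ w, (w ∈ psi Sv Su ↔
        w ∈ piMap (n - 1) X.t (flipMatrix (gMatrix (Theta X) * gMatrix (Theta Y)))) := by
    intro Sv hSv Su hSu w
    rw [mem_psi, gMatrix_schutz (by omega) (by omega) hSv, gMatrix_schutz (by omega) (by omega) hSu,
      snd_of_mem_schutz hSu, flipMatrix_mul]
    exact ⟨fun h => h.2.2, fun h => ⟨gDefined_of_mem_schutz (by omega) (by omega) hSv,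
      gDefined_of_mem_schutz (by omega) (by omega) hSu, h⟩⟩
  unfold IsSecondOutput geomR
  simp only [Part.mem_bind_iff, Part.mem_map_iff, Prod.mk.injEq]
  constructor
  · rintro ⟨_, v', hv', Sv, hSv, Su, hSu, w, hw, u', hu', rfl, rfl⟩
    exact ⟨⟨_, hv'⟩, w, (hpsi Sv hSv Su hSu w).1 hw, hu'⟩
  · rintro ⟨⟨v', hv'⟩, w, hw, hu'⟩
    obtain ⟨Sv, hSv⟩ := exists_mem_schutz (by omega) (by omega) hgY
    obtain ⟨Su, hSu⟩ := exists_mem_schutz (by omega) (by omega) hgX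
    exact ⟨v', v', hv', Sv, hSv, Su, hSu, w, (hpsi Sv hSv Su hSu w).2 hw, _, hu', rfl, rfl⟩

theorem second_output_formula {n k : ℕ} (hk : 1 ≤ k) (hkn : k < n) (X : RatRect n 1)
    (Y : RatRect n k) (X' : RatRect n 1) (h : IsSecondOutput X Y X') :
    X'.t = X.t ∧ ∀ j ∈ Finset.Icc (1 : ℤ) n, kappa X Y (j + 1) ≠ 0 ∧
      rowVar X' j = rowVar X j * (kappa X Y j / kappa X Y (j + 1)) := by
  have hn : 1 < n := by omega
  obtain ⟨_, w, hw, hX'⟩ := (isSecondOutput_iff hk hkn X Y X').1 h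
  have hgw := (mem_schutz.1 hX').1
  obtain ⟨hfin, hweq⟩ := mem_piMap.1 hw
  set z : ℂ := (-1) ^ (n - 1 + 1) * (X.t : ℂ) with hz
  have hz0 : z ≠ 0 := coeff_ne_zero _
  set ξ : Fin n → ℂ := fun a => kappa X Y ((a : ℤ) + 2) * kernelVec X a with hξ
  have hker := mulVec_kappa_mul_kernelVec hk hkn X Y
  rw [← hz, ← hξ] at hker
  have hann : ∀ f ∈ w.1.1, ∑ p : Fin n, ξ p.rev * f p = 0 := by
    intro f hf
    rw [hweq] at hf
    exact sum_rev_mul_eq_zero_of_mem_flip hker hf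
  -- Definedness of the intermediate projection gives rank at least n - 1, which is what makes T η
  -- nonzero even when d = 0.
  have hξ0 : ξ ≠ 0 := by
    obtain ⟨T, hTB, hBT, hT0, hT⟩ := exists_reduced_adjugate hk hkn Y
    have h1 : ξ = (-1 : ℂ) ^ (n - k) • (evalAt T z).mulVec (kernelVec X) := funext fun a => hT X a
    have h2 := congrArg (fun A => evalAt A z) hBT
    have h4 := congrArg (fun A => evalAt A z) hTB
    simp only [evalAt_mul, evalAt_X_sub_C_smul_one] at h2 h4
    rw [h1]
    refine smul_ne_zero (pow_ne_zero _ (by norm_num)) ?_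
    refine mulVec_ne_zero_of_rank (W := evalAt (gMatrix (Theta X)) z) h2 h4 (hT0 z hz0) ?_
      (evalAt_mulVec_kernelVec hn X) ?_
    · rw [← evalAt_mul]
      exact rank_of_finrank_flip hfin
    · exact fun h => kernelVec_ne_zero X ⟨0, by omega⟩ (congrFun h _)
  have hl : (fun p : Fin n => ξ p.rev) ≠ 0 := by
    intro h0
    apply hξ0
    ext p
    simpa using congrFun h0 p.rev
  have hl0 := annihilator_ne_zero hn hgw hl hann
  obtain ⟨Z, hZ, hZc⟩ := exists_Theta_eq hn hl0 hann
  have hZt : Z.t = X.t := by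
    have h1 := congrArg Prod.snd hZ
    rw [hweq] at h1
    exact h1
  have hX't : X'.t = X.t := by
    have h1 := snd_of_mem_schutz hX'
    rw [hweq] at h1
    exact h1
  rw [← hZ] at hX'
  have hg := gMatrix_schutz (by omega) (by omega) hX'
  -- The x-variables are the diagonal of g, and S flips g over the anti-diagonal, so it reverses
  -- their order.
  have hratio : ∀ p : Fin n, X'.ratio 1 (p + 1) = Z.ratio 1 (p.rev + 1) := by
    intro p
    have h1 := congrFun (congrFun hg p) p
    simp only [flipMatrix, Matrix.of_apply] at h1
    rw [gMatrix_Theta_one hn, gMatrix_Theta_one hn, if_pos rfl, if_pos rfl] at h1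
    exact C_injective h1
  have hξne : ∀ p, ξ p ≠ 0 := fun p => by simpa using hl0 p.rev
  have hκ : ∀ p : Fin n, kappa X Y ((p : ℤ) + 2) ≠ 0 := fun p => left_ne_zero_of_mul (hξne p)
  refine ⟨hX't, fun j hj => ?_⟩
  rw [Finset.mem_Icc] at hj
  obtain ⟨p, rfl⟩ : ∃ p : Fin n, j = (p : ℤ) + 1 :=
    ⟨⟨(j - 1).toNat, by omega⟩, by simp only; omega⟩
  have hp := p.2
  rw [add_assoc, show (1 : ℤ) + 1 = 2 by norm_num]
  refine ⟨hκ p, ?_⟩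
  rw [rowVar_succ, rowVar_succ, hratio, RatRect.ratio, Nat.add_sub_cancel, hZc]
  have hkp := hκ p
  have hep := kernelVec_ne_zero X p
  have hl00 := hl0 ⟨0, by omega⟩
  -- For p = 0 the preceding kernel entry is the last one, reached through the corner entry z and
  -- the periodicity of κ.
  by_cases hp0 : (p : ℕ) = 0
  · have hlast : (p.rev : ℕ) + 1 = n := by rw [Fin.val_rev]; omega
    have hrev0 : (⟨0, by omega⟩ : Fin n).rev = ⟨n - 1, by omega⟩ := by
      ext; rw [Fin.val_rev]
    have hpl := ratio_mul_kernelVec_zero hn X (p := p) (q := ⟨n - 1, by omega⟩)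
      (by simp only; omega)
    rw [← hz] at hpl
    have hkl : kappa X Y ((p : ℤ) + 1) = kappa X Y (((⟨n - 1, by omega⟩ : Fin n) : ℤ) + 2) := by
      rw [← kappa_add]
      congr 1
      simp only
      omega
    rw [hlast, Z.coord_last, hZt, hkl]
    simp only [Fin.rev_rev, hrev0] at hl00 ⊢
    have hsgn : z = (-1) ^ ((p.rev : ℕ) + 1) * (X.t : ℂ) := by
      rw [hz, hlast, show n - 1 + 1 = n by omega]
    have h1 := neg_one_pow_mul_self (R := ℂ) (p.rev : ℕ)
    have hs : ((-1 : ℂ) ^ (p.rev : ℕ)) ≠ 0 := pow_ne_zero _ (by norm_num)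
    have hx : X.ratio 1 (p + 1) = -(z * kernelVec X ⟨n - 1, by omega⟩) / kernelVec X p := by
      rw [eq_div_iff hep]; linear_combination hpl
    rw [hx, hsgn, pow_succ]
    simp only [hξ] at hl00 ⊢
    set e := ((-1 : ℂ) ^ (p.rev : ℕ))
    have hkl0 := left_ne_zero_of_mul hl00
    have hel0 := right_ne_zero_of_mul hl00
    field_simp
    linear_combination -h1
  · have hq : (p.rev : ℕ) + 1 < n := by rw [Fin.val_rev]; omega
    have hzc := hZc ⟨p.rev + 1, hq⟩
    simp only at hzc
    have hrev : (⟨p.rev + 1, hq⟩ : Fin n).rev = ⟨p - 1, by omega⟩ := by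
      ext; simp only [Fin.val_rev]; omega
    rw [hrev] at hzc
    have hpl := ratio_mul_kernelVec X (p := p) (q := ⟨p - 1, by omega⟩) (by simp only; omega)
    have hkl : kappa X Y ((p : ℤ) + 1) = kappa X Y (((⟨p - 1, by omega⟩ : Fin n) : ℤ) + 2) := by
      congr 1
      simp only
      omega
    rw [hzc, hkl]
    have hs : ((-1 : ℂ) ^ (p.rev : ℕ)) ≠ 0 := pow_ne_zero _ (by norm_num)
    have hx : X.ratio 1 (p + 1) = -kernelVec X ⟨p - 1, by omega⟩ / kernelVec X p := by
      rw [eq_div_iff hep]; linear_combination hpl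
    rw [hx]
    simp only [Fin.rev_rev, hξ, pow_succ] at hl00 ⊢
    set e := ((-1 : ℂ) ^ (p.rev : ℕ))
    have hkl0 := left_ne_zero_of_mul hl00
    have hel0 := right_ne_zero_of_mul hl00
    field_simp

open scoped ComplexOrder

/-! ### Nonnegativity of maximal minors -/

/-- All maximal minors of `F` are nonnegative. -/
def MinorsNonneg {n m : ℕ} (F : Matrix (Fin n) (Fin m) ℂ) : Prop :=
  ∀ σ : Fin m → Fin n, StrictMono σ → 0 ≤ (F.submatrix σ id).det

theorem MinorsNonneg.maxMinor_nonneg {n m : ℕ} {F : Matrix (Fin n) (Fin m) ℂ}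
    (hF : MinorsNonneg F) (I : Finset ℤ) : 0 ≤ maxMinor F I := by
  unfold maxMinor
  split_ifs with h
  · exact hF _ (OrderEmbedding.strictMono _)
  · exact le_rfl

theorem minorsNonneg_one {n m : ℕ} (hm : m ≤ n) :
    MinorsNonneg ((1 : Matrix (Fin n) (Fin n) ℂ).submatrix id (Fin.castLE hm)) := by
  intro σ hσ
  by_cases h : ∀ i, (σ i : ℕ) < m
  · have hcard : (Finset.univ.filter fun p : Fin n => (p : ℕ) < m).card = m := by
      rw [Fin.card_filter_val_lt]; omega
    have h1 : σ = Fin.castLE hm := by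
      rw [Finset.orderEmbOfFin_unique hcard (by simpa using h) hσ]
      exact (Finset.orderEmbOfFin_unique hcard (by simp) (Fin.strictMono_castLE hm)).symm
    rw [h1, Matrix.submatrix_submatrix, Function.id_comp, Function.comp_id,
      Matrix.submatrix_one _ (Fin.strictMono_castLE hm).injective, Matrix.det_one]
    exact zero_le_one
  · push Not at h
    obtain ⟨i, hi⟩ := h
    rw [Matrix.det_eq_zero_of_row_eq_zero i]
    intro j
    simp only [Matrix.submatrix_apply, id_eq]
    rw [Matrix.one_apply_ne]
    intro h
    have h1 : (σ i : ℕ) = j := congrArg Fin.val h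
    have := j.2
    omega

/-- Expand multilinearly in the rows: each σ i is kept or moved back by one. The resulting indices
are still weakly increasing, so each term is a nonnegative multiple of a minor of F, or zero because
a row repeats. -/
theorem MinorsNonneg.of_bidiagonal {n m : ℕ} {F G : Matrix (Fin n) (Fin m) ℂ}
    (hF : MinorsNonneg F) {d e : Fin n → ℂ} (hd : ∀ p, 0 ≤ d p) (he : ∀ p, 0 ≤ e p)
    {π : Fin n → Fin n} (hπ : ∀ p, (π p : ℕ) = p - 1)
    (hG : ∀ p, G p = d p • F p + e p • F (π p)) : MinorsNonneg G := by
  intro σ hσ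
  have h1 : (G.submatrix σ id).det = ∑ s : Finset (Fin m),
      (∏ i, if i ∈ s then d (σ i) else e (σ i)) *
        (F.submatrix (fun i => if i ∈ s then σ i else π (σ i)) id).det := by
    have h2 := (Matrix.detRowAlternating (n := Fin m) (R := ℂ)).toMultilinearMap.map_add_univ
      (fun i => d (σ i) • F (σ i)) (fun i => e (σ i) • F (π (σ i)))
    have h3 : (fun i => d (σ i) • F (σ i)) + (fun i => e (σ i) • F (π (σ i))) =
        (G.submatrix σ id : Fin m → Fin m → ℂ) := by
      funext i
      exact (hG (σ i)).symm
    rw [h3] at h2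
    refine h2.trans (Finset.sum_congr rfl fun s _ => ?_)
    have h4 := (Matrix.detRowAlternating (n := Fin m) (R := ℂ)).toMultilinearMap.map_smul_univ
      (fun i => if i ∈ s then d (σ i) else e (σ i))
      (fun i => F (if i ∈ s then σ i else π (σ i)))
    refine Eq.trans ?_ h4
    congr 1
    funext i
    by_cases hi : i ∈ s <;> simp [hi]
  rw [h1]
  refine Finset.sum_nonneg fun s _ => mul_nonneg (Finset.prod_nonneg fun i _ => ?_) ?_
  · split_ifs
    exacts [hd _, he _]
  set τ : Fin m → Fin n := fun i => if i ∈ s then σ i else π (σ i) with hτ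
  have hlo : ∀ i, (σ i : ℕ) - 1 ≤ τ i := fun i => by
    simp only [hτ]; split_ifs
    · omega
    · rw [hπ]
  have hhi : ∀ i, (τ i : ℕ) ≤ σ i := fun i => by
    simp only [hτ]; split_ifs
    · rfl
    · rw [hπ]; omega
  by_cases hinj : Function.Injective τ
  · refine hF τ fun i j hij => lt_of_le_of_ne ?_ (hinj.ne hij.ne)
    have h5 : (σ i : ℕ) < σ j := hσ hij
    have := hlo j
    have := hhi i
    rw [Fin.le_def]; omega
  · unfold Function.Injective at hinj
    push Not at hinj
    obtain ⟨i, j, hij, hne⟩ := hinj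
    rw [Matrix.det_zero_of_row_eq hne (by
      funext q
      simp only [Matrix.submatrix_apply]
      rw [hij])]

theorem RatRect.IsPositive.coord_pos {n k : ℕ} {Y : RatRect n k} (hY : Y.IsPositive) (i j : ℕ) :
    0 < Y.coord i j := by
  unfold RatRect.coord
  split_ifs with h
  · obtain ⟨r, hr, h1⟩ := hY.1 ⟨(i, j), h⟩
    rw [h1]; exact_mod_cast hr
  · obtain ⟨r, hr, h1⟩ := hY.2
    rw [h1]; exact_mod_cast hr
  · exact zero_lt_one

theorem RatRect.IsPositive.ratio_pos {n k : ℕ} {Y : RatRect n k} (hY : Y.IsPositive) (i j : ℕ) :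
    0 < Y.ratio i j :=
  div_pos (hY.coord_pos _ _) (hY.coord_pos _ _)

theorem minorsNonneg_tableauProd {n k m : ℕ} (hm : m ≤ n) {Y : RatRect n k} (hY : Y.IsPositive)
    (r : ℕ) : MinorsNonneg ((tableauProd Y r).submatrix id (Fin.castLE hm)) := by
  induction r with
  | zero => exact minorsNonneg_one hm
  | succ r ih =>
    refine ih.of_bidiagonal
      (d := fun p => if r + 1 ≤ (p : ℕ) + 1 ∧ (p : ℕ) + 1 ≤ r + 1 + n - k then
        Y.ratio (r + 1) (p + 1) else 1)
      (e := fun p => if r + 1 + 1 ≤ (p : ℕ) + 1 ∧ (p : ℕ) + 1 ≤ r + 1 + n - k then 1 else 0)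
      (π := fun p => ⟨p - 1, by omega⟩) (fun p => ?_) (fun p => ?_) (fun p => rfl) (fun p => ?_)
    · split_ifs
      exacts [(hY.ratio_pos _ _).le, zero_le_one]
    · split_ifs
      exacts [zero_le_one, le_rfl]
    · funext j
      have h1 := rowFactor_mulVec Y (r + 1) (fun q => tableauProd Y r q (Fin.castLE hm j)) p
      refine Eq.trans ?_ (h1.trans ?_)
      · rfl
      · simp only [Pi.add_apply, Pi.smul_apply, smul_eq_mul, Matrix.submatrix_apply, id_eq]
        congr 1
        split_ifs with h2
        · rw [Finset.sum_eq_single ⟨p - 1, by omega⟩, if_pos ⟨by simp only; omega, h2⟩, one_mul]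
          · intro q _ hq
            rw [if_neg]
            rintro ⟨h3, _⟩
            exact hq (Fin.ext (by simp only; omega))
          · simp
        · rw [zero_mul]
          exact Finset.sum_eq_zero fun q _ => if_neg fun h3 => h2 h3.2

theorem plucker_div_nonneg {n k : ℕ} {Y : RatRect n k} (hY : Y.IsPositive) (I J : Finset ℤ) :
    0 ≤ plucker (Theta Y).1 I / plucker (Theta Y).1 J := by
  set B := (tableauMatrix Y).submatrix id (Fin.castLE (Nat.sub_le n k)) with hB
  have hspan : Submodule.span ℂ (Set.range fun j => B.col j) = (Theta Y).1.1 := by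
    have h1 : (Set.range fun j => B.col j) =
        Set.range fun j : {j : Fin n // (j : ℕ) < n - k} => (tableauMatrix Y).col j := by
      ext v
      constructor
      · rintro ⟨j, rfl⟩
        exact ⟨⟨Fin.castLE (Nat.sub_le n k) j, j.2⟩, rfl⟩
      · rintro ⟨⟨j, hj⟩, rfl⟩
        exact ⟨⟨j, hj⟩, rfl⟩
    rw [h1]
    rfl
  obtain ⟨c, hc, h⟩ := plucker_eq_smul _ B hspan
  have hnn : MinorsNonneg B := minorsNonneg_tableauProd _ hY k
  have := div_nonneg (hnn.maxMinor_nonneg I) (hnn.maxMinor_nonneg J)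
  rwa [h, h, mul_div_mul_left _ _ hc] at this

/-- All terms of the explicit formula are nonnegative, and the one with s = 0 is positive because
its Plücker ratio is 1. -/
theorem kappa_ne_zero {n k : ℕ} (hk : 1 ≤ k) (hkn : k < n) {X : RatRect n 1} {Y : RatRect n k}
    (hX : X.IsPositive) (hY : Y.IsPositive) {j : ℤ} (hj : j ∈ Finset.Icc (1 : ℤ) n) :
    kappa X Y j ≠ 0 := by
  have hrow : ∀ i, 0 < rowVar X i := fun i => hX.ratio_pos _ _
  have ht : 0 < (Y.t : ℂ) := by
    obtain ⟨r, hr, h1⟩ := hY.2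
    rw [h1]; exact_mod_cast hr
  rw [kappa_formula hk hkn X Y j hj]
  refine ne_of_gt (Finset.sum_pos' (fun s _ => ?_) ⟨0, by simp, ?_⟩)
  · exact mul_nonneg (mul_nonneg (Finset.prod_nonneg fun i _ => (hrow i).le)
      (pow_nonneg ht.le _)) (plucker_div_nonneg hY _ _)
  · have hI : Finset.Icc (j + k - 1) (j + n - 1) \ {j + k + ((0 : ℕ) : ℤ) - 1} =
        Finset.Icc (j + k) (j + n - 1) := by
      ext a
      simp only [Finset.mem_sdiff, Finset.mem_Icc, Finset.mem_singleton]
      omega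
    rw [hI, div_self (plucker_window_ne_zero hkn Y j), mul_one]
    exact mul_pos (Finset.prod_pos fun i _ => hrow i) (pow_pos ht _)

/-! ### Existence of the second output -/

/-- κ_1 is a maximal minor of the first n - k columns of A_t, so these columns are independent. -/
theorem exists_mem_psi {n k : ℕ} (hk : 1 ≤ k) (hkn : k < n) {X : RatRect n 1} {Y : RatRect n k}
    (h : kappa X Y 1 ≠ 0) : ∃ v', v' ∈ psi (Theta X) (Theta Y) := by
  refine ⟨_, mem_psi.2 ⟨gDefined_Theta (by omega) X, gDefined_Theta hkn.le Y,
    mem_piMap.2 ⟨?_, rfl⟩⟩⟩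
  change Module.finrank ℂ (firstColSpan (n - k) (productAt X Y)) = n - k
  refine finrank_firstColSpan_of_injective (Nat.sub_le n k) _ fun c hc hA => ?_
  rw [kappa_one_eq_minor hkn, show (n : ℤ) - k = ((n - k : ℕ) : ℤ) by omega,
    minor_Icc_eq_maxMinor (Nat.sub_le n k)] at h
  unfold maxMinor at h
  split_ifs at h with hI
  · set σ := (residues n (Finset.Icc ((k : ℤ) + 1) n)).orderEmbOfFin hI
    have h0 := Matrix.eq_zero_of_mulVec_eq_zero h
      (v := fun q => c (Fin.castLE (Nat.sub_le n k) q)) (by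
        funext i
        have h1 := congrFun hA (σ i)
        simp only [Matrix.mulVec, dotProduct, Pi.zero_apply] at h1 ⊢
        rw [← h1]
        refine Finset.sum_bij_ne_zero (fun q _ _ => Fin.castLE (Nat.sub_le n k) q)
          (fun _ _ _ => Finset.mem_univ _)
          (fun _ _ _ _ _ _ h => Fin.castLE_injective (Nat.sub_le n k) h) (fun q _ hq => ?_)
          (fun _ _ _ => rfl)
        have hq1 : (q : ℕ) < n - k := by
          by_contra hcon
          exact hq (by rw [hc q (by omega), mul_zero])
        exact ⟨⟨q, hq1⟩, Finset.mem_univ _, hq, rfl⟩)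
    ext p
    by_cases hp : n - k ≤ p
    · exact hc p hp
    · exact congrFun h0 ⟨p, by omega⟩
  · exact absurd rfl h

/-- A dependency of flipped columns is a row vector with first entry 0 killing A_s. Since d ≠ 0, T
cancels the factor g(Θ(Y)), and the subdiagonal ones of W propagate the zero to all entries. -/
theorem finrank_flip_product {n k : ℕ} (hk : 1 ≤ k) (hkn : k < n) {X : RatRect n 1}
    {Y : RatRect n k}
    (hd : (-1) ^ (n - 1 + 1) * (X.t : ℂ) - (-1) ^ (n - k + 1) * (Y.t : ℂ) ≠ 0) :
    Module.finrank ℂ (firstColSpan (n - 1)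
      (evalAt (flipMatrix (gMatrix (Theta X) * gMatrix (Theta Y)))
        ((-1) ^ (n - 1 + 1) * (X.t : ℂ)))) = n - 1 := by
  have hn : 1 < n := by omega
  set z : ℂ := (-1) ^ (n - 1 + 1) * (X.t : ℂ) with hz
  obtain ⟨T, _, hBT, _, _⟩ := exists_reduced_adjugate hk hkn Y
  have h2 := congrArg (fun A => evalAt A z) hBT
  simp only [evalAt_mul, evalAt_X_sub_C_smul_one] at h2
  refine finrank_firstColSpan_of_injective (Nat.sub_le n 1) _ fun c hc hA => ?_
  set W := evalAt (gMatrix (Theta X)) z with hW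
  have h4 : Matrix.vecMul (fun q : Fin n => c q.rev) (W * evalAt (gMatrix (Theta Y)) z) = 0 := by
    funext p
    have h5 := congrFun hA p.rev
    rw [evalAt_flipMatrix, evalAt_mul] at h5
    simp only [Matrix.mulVec, dotProduct, flipMatrix, Matrix.of_apply, Fin.rev_rev,
      Pi.zero_apply] at h5
    simp only [Matrix.vecMul, dotProduct, Pi.zero_apply]
    rw [← h5, ← Equiv.sum_comp Fin.revPerm]
    refine Finset.sum_congr rfl fun q _ => ?_
    rw [Fin.revPerm_apply, Fin.rev_rev, mul_comm]
  have h6 : Matrix.vecMul (fun q : Fin n => c q.rev) W = 0 := by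
    have h7 := congrArg (fun v => Matrix.vecMul v (evalAt T z)) h4
    simp only [Matrix.vecMul_vecMul, Matrix.zero_vecMul] at h7
    rw [Matrix.mul_assoc, h2, Matrix.mul_smul, Matrix.mul_one, Matrix.vecMul_smul] at h7
    exact (smul_eq_zero.1 h7).resolve_left hd
  have h8 : ∀ i (hi : i < n), c (⟨i, hi⟩ : Fin n).rev = 0 := by
    intro i
    induction i with
    | zero =>
      intro hi
      exact hc _ (by rw [Fin.val_rev])
    | succ i ih =>
      intro hi
      have h9 := congrFun h6 ⟨i, by omega⟩
      simp only [Matrix.vecMul, dotProduct, Pi.zero_apply] at h9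
      rw [Finset.sum_eq_single ⟨i + 1, hi⟩] at h9
      · simpa [hW, evalAt, gMatrix_Theta_one hn] using h9
      · intro q _ hq
        have hq' : (q : ℕ) ≠ i + 1 := fun h => hq (Fin.ext h)
        by_cases hqi : q = ⟨i, Nat.lt_of_succ_lt hi⟩
        · rw [hqi, ih, zero_mul]
        · have hqi' : (q : ℕ) ≠ i := fun h => hqi (Fin.ext h)
          have : W q ⟨i, by omega⟩ = 0 := by
            simp only [hW, evalAt, Matrix.map_apply]
            rw [gMatrix_Theta_one hn, if_neg hqi, if_neg hq', if_neg (by simp only; omega),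
              eval_zero]
          rw [this, mul_zero]
      · simp
  ext p
  have h9 := h8 p.rev p.rev.2
  rwa [Fin.eta, Fin.rev_rev] at h9

theorem exists_isSecondOutput {n k : ℕ} (hk : 1 ≤ k) (hkn : k < n) {X : RatRect n 1}
    {Y : RatRect n k} (hX : X.IsPositive) (hY : Y.IsPositive) (hst : X.t ≠ Y.t) :
    ∃ X' : RatRect n 1, IsSecondOutput X Y X' := by
  have hn : 1 < n := by omega
  have hκ : ∀ j ∈ Finset.Icc (1 : ℤ) n, kappa X Y j ≠ 0 := fun j hj =>
    kappa_ne_zero hk hkn hX hY hj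
  have hd : (-1) ^ (n - 1 + 1) * (X.t : ℂ) - (-1) ^ (n - k + 1) * (Y.t : ℂ) ≠ 0 := by
    -- Squaring removes the signs, whose parities depend on n and k; positivity then gives s = t.
    obtain ⟨s, hs, hXs⟩ := hX.2
    obtain ⟨t, ht, hYt⟩ := hY.2
    intro h
    rw [sub_eq_zero] at h
    have h1 : (X.t : ℂ) ^ 2 = (Y.t : ℂ) ^ 2 := by
      have h2 := congrArg (fun x : ℂ => x ^ 2) h
      simp only [mul_pow, ← pow_mul, mul_comm _ 2] at h2
      simpa [pow_mul] using h2
    rw [hXs, hYt] at h1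
    have h3 : s ^ 2 = t ^ 2 := by exact_mod_cast h1
    have h4 := (pow_left_inj₀ hs.le ht.le two_ne_zero).1 h3
    exact hst (Units.ext (by rw [hXs, hYt, h4]))
  set w : XVar n (n - 1) := (⟨_, finrank_flip_product hk hkn hd⟩, X.t) with hw
  set l : Fin n → ℂ := fun p => kappa X Y ((p.rev : ℤ) + 2) * kernelVec X p.rev with hl
  have hl0 : ∀ p, l p ≠ 0 := by
    intro p
    refine mul_ne_zero ?_ (kernelVec_ne_zero X _)
    by_cases hp : (p.rev : ℕ) + 2 ≤ n
    · exact hκ _ (Finset.mem_Icc.2 ⟨by omega, by exact_mod_cast hp⟩)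
    · have := p.rev.2
      rw [show ((p.rev : ℕ) : ℤ) + 2 = 1 + n by omega, kappa_add]
      exact hκ 1 (Finset.mem_Icc.2 ⟨le_rfl, by omega⟩)
  have hann : ∀ f ∈ w.1.1, ∑ p, l p * f p = 0 := fun f hf =>
    sum_rev_mul_eq_zero_of_mem_flip (mulVec_kappa_mul_kernelVec hk hkn X Y) hf
  have hgw := gDefined_of_annihilator hn hl0 hann
  obtain ⟨u, hu⟩ := exists_mem_schutz (by omega) (by omega) hgw
  obtain ⟨l', hl', hann'⟩ := exists_annihilator hn u.1
  obtain ⟨X', rfl, _⟩ := exists_Theta_eq hn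
    (annihilator_ne_zero hn (gDefined_of_mem_schutz (by omega) (by omega) hu) hl' hann') hann'
  exact ⟨X', (isSecondOutput_iff hk hkn X Y X').2
    ⟨exists_mem_psi hk hkn (hκ 1 (Finset.mem_Icc.2 ⟨le_rfl, by omega⟩)), w,
      mem_piMap.2 ⟨_, rfl⟩, hu⟩⟩

end

end GeometricR

theorem mainTheorem9 (n k : ℕ) (hk : 1 ≤ k) (hkn : k < n) :
    -- the second output of `ΘR`, wherever it is defined
    (∀ (X : RatRect n 1) (Y : RatRect n k) (X' : RatRect n 1), IsSecondOutput X Y X' →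
      X'.t = X.t ∧
      ∀ j ∈ Finset.Icc (1 : ℤ) n,
        kappa X Y (j + 1) ≠ 0 ∧
        rowVar X' j = rowVar X j * (kappa X Y j / kappa X Y (j + 1))) ∧
    -- it is defined at all points with positive real coordinates such that `s ≠ t`
    (∀ (X : RatRect n 1) (Y : RatRect n k), X.IsPositive → Y.IsPositive → X.t ≠ Y.t →
      ∃ X' : RatRect n 1, IsSecondOutput X Y X') ∧
    -- the explicit formula for `κ_j`
    (∀ (X : RatRect n 1) (Y : RatRect n k), GDefined (Theta Y) →
      ∀ j ∈ Finset.Icc (1 : ℤ) n,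
        kappa X Y j =
          ∑ s ∈ Finset.range (n - k + 1),
            (∏ i ∈ Finset.Icc (j + k + s) (j + n - 1), rowVar X i) *
              (Y.t : ℂ) ^ (if (n : ℤ) + 2 - s ≤ j + k ∧ j + k ≤ n + 1 then 1 else 0) *
              (plucker (Theta Y).1 (Finset.Icc (j + k - 1) (j + n - 1) \ {j + k + s - 1}) /
                plucker (Theta Y).1 (Finset.Icc (j + k) (j + n - 1)))) ∧
    -- the coenergy function
    (∀ (X : RatRect n 1) (Y : RatRect n k), GDefined (Theta Y) →
      Polynomial.C (kappa X Y 1) ∈ coenergy (Theta X) (Theta Y) ∧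
      kappa X Y 1 =
        ∑ s ∈ Finset.range (n - k + 1),
          (∏ i ∈ Finset.Icc ((k : ℤ) + s + 1) n, rowVar X i) * Y.coord k (k + s - 1)) := by
  refine ⟨fun X Y X' h => second_output_formula hk hkn X Y X' h,
    fun X Y hX hY hst => exists_isSecondOutput hk hkn hX hY hst,
    fun X Y _ j hj => kappa_formula hk hkn X Y j hj,
    fun X Y _ => ⟨C_kappa_one_mem_coenergy hk hkn X Y, kappa_one_eq hk hkn X Y⟩⟩
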